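/- **Setting.** In a graphical game on a finite graph $G$ with two actions per player, the players are the vertices of $G$, and each player $v$ has a payoff table that assigns a real number $u_v(\sigma_v,\sigma_{\mathcal N(v)})$ to every choice of an action of $v$ and of actions of the neighbours of $v$. In the random game on $G$ all payoff entries are independent with a common atomless distribution $\mu$ on $\mathbb R$. A random $G(n,p)$-game is obtained by first drawing $G$ from $G(n,p)$ and then, given $G$, drawing the random game on $G$. A strategy profile $\sigma$ is a pure Nash equilibrium (PNE) if $u_v(\sigma_v,\sigma_{\mathcal N(v)})\ge u_v(a,\sigma_{\mathcal N(v)})$ for every player $v$ and every action $a$ of $v$. Let $Z$ be the number of PNE, let $W$ be a Poisson$(1)$ random variable, and for distributions of $\mathbb Z_{\ge 0}$-valued variables put $\|Z-W\|=\frac12\sum_{i\ge 0}|\mathbb P[Z=i]-\mathbb P[W=i]|$. **Theorem (High connectivity).** (a) Let $\mu$ be an atomless probability distribution on $\mathbb R$, let $\varepsilon=\varepsilon(n)>0$ and $p=p(n)=\frac{(2+\varepsilon(n))\log n}{n}\le 1$ for all large $n$, and let $Z_n$ be the number of PNE of a random $G(n,p(n))$-game with payoff distribution $\mu$. Then $Z_n$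 converges in distribution to Poisson$(1)$ as $n\to\infty$. (b) There are absolute constants $C,c>0$ such that for every atomless probability distribution $\mu$ on $\mathbb R$, every $n\ge 1$ and every $\varepsilon>0$ with $p=\frac{(2+\varepsilon)\log n}{n}\le 1$: with probability at least $1-n^{-\varepsilon/8}-2^{-n}$ over the random graph $G\sim G(n,p)$, the distribution of the number $Z$ of PNE of the random game on the fixed graph $G$ satisfies $$\|Z-W\|\le C\,n^{-\varepsilon/8}+e^{-cn}.$$ -/

import Mathlib

open MeasureTheory ProbabilityTheory Filter
open scoped Topology

/-- Index set of the payoff entries of a graphical game on `G` in which every player has the two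
actions `false` and `true`: a player `v`, an action of `v`, and an action for each neighbour
of `v`. -/
abbrev PayoffEntry {V : Type*} (G : SimpleGraph V) : Type _ :=
  Σ v : V, Bool × (G.neighborSet v → Bool)

/-- The payoff tables of all the players: `u ⟨v, a, τ⟩` is the payoff of player `v` when `v` plays
`a` and the neighbours of `v` play `τ`. -/
abbrev PayoffTables {V : Type*} (G : SimpleGraph V) : Type _ :=
  PayoffEntry G → ℝ

/-- The strategy profile `σ` is a pure Nash equilibrium: no player can gain by deviating alone. -/
def IsPNE {V : Type*} {G : SimpleGraph V} (u : PayoffTables G) (σ : V → Bool) : Prop :=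
  ∀ (v : V) (a : Bool), u ⟨v, a, fun w => σ w⟩ ≤ u ⟨v, σ v, fun w => σ w⟩

/-- The number of pure Nash equilibria. -/
noncomputable def numPNE {V : Type*} {G : SimpleGraph V} (u : PayoffTables G) : ℕ :=
  {σ : V → Bool | IsPNE u σ}.ncard

/-- The law of random payoff tables on a fixed graph: all the entries are independent with
distribution `μ`. -/
noncomputable def payoffLaw {V : Type*} (μ : Measure ℝ) [IsProbabilityMeasure μ]
    (G : SimpleGraph V) : Measure (PayoffTables G) :=
  Measure.infinitePi fun _ : PayoffEntry G => μ

/-- The law of the number of pure Nash equilibria of the random game on a fixed graph. -/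
noncomputable def pneLaw {V : Type*} (μ : Measure ℝ) [IsProbabilityMeasure μ]
    (G : SimpleGraph V) : Measure ℕ :=
  (payoffLaw μ G).map numPNE

/-- A graphical game with two actions per player: a graph together with payoff tables on it. -/
abbrev GraphicalGame (V : Type*) : Type _ :=
  Σ G : SimpleGraph V, PayoffTables G

/-- The law of the random `G(V, p)`-game: first the graph is drawn from the binomial random graph
model, then, given the graph, the payoff entries are drawn independently from `μ`. -/
noncomputable def randomGameLaw (V : Type*) (μ : Measure ℝ) [IsProbabilityMeasure μ] (p : unitInterval) :
    Measure (GraphicalGame V) :=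
  (SimpleGraph.binomialRandom V p).bind fun G => (payoffLaw μ G).map (Sigma.mk G)

/-- Total variation distance of two distributions on `ℕ`. -/
noncomputable def tvDist (P Q : Measure ℕ) : ℝ :=
  1 / 2 * ∑' i : ℕ, |P.real {i} - Q.real {i}|

instance instIsProbabilityMeasurePayoffLaw {V : Type*} (μ : Measure ℝ) [IsProbabilityMeasure μ] (G : SimpleGraph V) :
    IsProbabilityMeasure (payoffLaw μ G) := by
  unfold payoffLaw
  infer_instance

theorem SimpleGraph.measurable_of_finite {V α : Type*} [Finite V] [MeasurableSpace α]
    (f : SimpleGraph V → α) : Measurable f := by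
  intro s _
  refine ⟨SimpleGraph.Adj '' (f ⁻¹' s), (Set.toFinite _).measurableSet, ?_⟩
  exact Set.preimage_image_eq _ fun _ _ h => SimpleGraph.ext h

theorem measurable_sigma_mk {ι : Type*} {X : ι → Type*} [∀ i, MeasurableSpace (X i)] (i : ι) :
    Measurable (Sigma.mk i : X i → Σ i, X i) := by
  intro s hs
  exact MeasurableSpace.measurableSet_iInf.1 hs i

theorem measurable_numPNE {V : Type*} [Finite V] (G : SimpleGraph V) :
    Measurable (numPNE : PayoffTables G → ℕ) := by
  refine measurable_to_countable' fun k => ?_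
  have h : ∀ T : Set (V → Bool), MeasurableSet {u : PayoffTables G | {σ | IsPNE u σ} = T} := by
    intro T
    have hσ : ∀ σ : V → Bool, MeasurableSet {u : PayoffTables G | IsPNE u σ} := by
      intro σ
      simp only [IsPNE, Set.ofPred_forall]
      exact MeasurableSet.iInter fun v => MeasurableSet.iInter fun a =>
        measurableSet_le (measurable_pi_apply _) (measurable_pi_apply _)
    have hT : {u : PayoffTables G | {σ | IsPNE u σ} = T} =
        ⋂ σ : V → Bool, {u | IsPNE u σ ↔ σ ∈ T} := by
      ext u
      simp [Set.ext_iff]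
    rw [hT]
    refine MeasurableSet.iInter fun σ => ?_
    by_cases h : σ ∈ T
    · simp only [h, iff_true]
      exact hσ σ
    · simp only [h, iff_false]
      exact (hσ σ).compl
  have hk : (numPNE ⁻¹' {k} : Set (PayoffTables G)) =
      ⋃ T ∈ {T : Set (V → Bool) | T.ncard = k}, {u | {σ | IsPNE u σ} = T} := by
    ext u
    simp [numPNE]
  rw [hk]
  exact MeasurableSet.biUnion (Set.to_countable _) fun T _ => h T

instance instIsProbabilityMeasureRandomGameLaw {V : Type*} [Finite V] (μ : Measure ℝ) [IsProbabilityMeasure μ] (p : unitInterval) :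
    IsProbabilityMeasure (randomGameLaw V μ p) := by
  refine isProbabilityMeasure_bind (SimpleGraph.measurable_of_finite _).aemeasurable ?_
  exact ae_of_all _ fun G =>
    Measure.isProbabilityMeasure_map (measurable_sigma_mk G).aemeasurable

/-! Ties have probability zero because payoffs are atomless, and exchanging a player's two actions
in chosen contexts preserves the payoff law. Hence the best responses form a table of independent
fair bits, one per context (a player together with the actions of its neighbours). A profile is an
equilibrium when one prescribed bit per player comes out right, so the mean number of equilibria is
1 and the Poisson limit is a question of dependence. Two profiles interact through a player only if
that player sees the same context in both, that is, has no neighbour in the set S where the profiles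
differ.

Chen–Stein is run on a nonempty set M of players (`abs_expect_stein_le`): the bits which M reads
under a profile σ are independent of what happens to σ outside M, and of the number of equilibria
sharing no context with σ in M. The error consists of the fluctuation of the normalized number of
profiles acceptable outside M, controlled by a second moment, and the expected number of pairs of
profiles sharing a context in M. In terms of S these are `secondMoment` and `avoidMoment`.

Averaged over G(n,p), the products in these moments expand into sums over T of ±(1-p)^e(S,T), where
e counts the pairs joining S and T. Exchanging S and T reduces large S to small T, except when both
are large, which is exponentially unlikely. Small sets are governed by `smallSum`, which is
O(n^(-ε/4)) (`IsLarge.smallSum_le`).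

For (b), M is the whole vertex set: the fluctuation term disappears, the mean error is O(n^(-ε/4)),
and Markov's inequality splits this into a bound and a failure probability of order n^(-ε/8) each.
For (a) that bound need not vanish, since ε may tend to 0. Instead M has a fixed size m:
cancellation of signs gains a factor p in the small-set terms, and fixing the avoiding vertex gains
a factor 1/n in the large-set terms. As n grows only terms in δ and 2^(-m) survive, and these are
made small by choosing δ, then m (`tendsto_integral_randomGameLaw`). -/

/-! ### Chen–Stein bound for uniformly random response tables. -/

section Response

set_option linter.unusedSectionVars false

open Finset
open scoped BigOperators

/-- Averaging against an event that fixes one coordinate of a uniform bit vector halves the average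
of a function that ignores that coordinate. -/
theorem expect_mul_ite_coord {J : Type*} [Fintype J] [DecidableEq J] (f : (J → Bool) → ℝ) (j : J)
    (b : Bool) (hf : ∀ β x, f (Function.update β j x) = f β) :
    (𝔼 β, f β * if β j = b then 1 else 0) = 1 / 2 * 𝔼 β, f β := by
  have hflip : Function.Involutive fun β : J → Bool => Function.update β j (!β j) := by
    intro β
    simp
  have h1 : (𝔼 β, f β * if β j = b then (1 : ℝ) else 0) =
      𝔼 β, f β * if β j = b then (0 : ℝ) else 1 := by
    refine Fintype.expect_bijective _ hflip.bijective _ _ fun β => ?_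
    rw [hf]
    rcases hb : β j <;> cases b <;> simp
  have h2 : (𝔼 β, f β) = (𝔼 β, f β * if β j = b then (1 : ℝ) else 0) +
      𝔼 β, f β * if β j = b then (0 : ℝ) else 1 := by
    rw [← expect_add_distrib]
    refine expect_congr rfl fun β _ => ?_
    split_ifs <;> simp
  rw [h2, ← h1]
  ring

variable {V J : Type*} [Fintype V] [DecidableEq V] [Fintype J] [DecidableEq J]

/-- The indicator that in the response table `β` all the players in `U` are content with the
profile `σ`; here `c v σ` is the context that player `v` sees. -/
noncomputable def content (c : V → (V → Bool) → J) (U : Finset V) (σ : V → Bool) (β : J → Bool) : ℝ :=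
  ∏ v ∈ U, if β (c v σ) = σ v then 1 else 0

/-- The number of profiles with which all players are content. -/
noncomputable def fixedCount (c : V → (V → Bool) → J) (β : J → Bool) : ℕ :=
  #{σ : V → Bool | ∀ v, β (c v σ) = σ v}

/-- The relative likelihood that player `v` is content with both profiles, compared to
independence. -/
noncomputable def pairFactor (c : V → (V → Bool) → J) (σ τ : V → Bool) (v : V) : ℝ :=
  if c v σ = c v τ then (if σ v = τ v then 2 else 0) else 1

variable {c : V → (V → Bool) → J}

theorem content_eq_ite (U : Finset V) (σ : V → Bool) (β : J → Bool) :
    content c U σ β = if ∀ v ∈ U, β (c v σ) = σ v then 1 else 0 := by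
  simp [content, Finset.prod_ite_zero]

theorem content_nonneg (U : Finset V) (σ : V → Bool) (β : J → Bool) : 0 ≤ content c U σ β := by
  rw [content_eq_ite]; split_ifs <;> norm_num

theorem content_mul_compl (M : Finset V) (σ : V → Bool) (β : J → Bool) :
    content c Mᶜ σ β * content c M σ β = content c univ σ β :=
  Finset.prod_compl_mul_prod _ _

theorem content_update_of_ne {U : Finset V} {σ : V → Bool} {j : J} (h : ∀ v ∈ U, c v σ ≠ j)
    (β : J → Bool) (x : Bool) :
    content c U σ (Function.update β j x) = content c U σ β := by
  refine prod_congr rfl fun v hv => ?_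
  rw [Function.update_of_ne (h v hv)]

theorem fixedCount_eq_sum (β : J → Bool) :
    (fixedCount c β : ℝ) = ∑ σ : V → Bool, content c univ σ β := by
  simp [fixedCount, content_eq_ite]

/-- By `hc` different players never read the same bit, so the requirements in `U` concern distinct
coordinates, each met with probability 1/2 independently of `f`. -/
theorem expect_mul_content (hc : ∀ v w σ τ, c v σ = c w τ → v = w) (U : Finset V) (σ : V → Bool)
    (f : (J → Bool) → ℝ) (hf : ∀ v ∈ U, ∀ β x, f (Function.update β (c v σ) x) = f β) :
    (𝔼 β, f β * content c U σ β) = (1 / 2) ^ #U * 𝔼 β, f β := by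
  induction U using Finset.induction_on with
  | empty => simp [content]
  | insert v U hv ih =>
    have h : ∀ β : J → Bool, f β * content c (insert v U) σ β =
        (f β * content c U σ β) * if β (c v σ) = σ v then 1 else 0 := by
      intro β
      rw [content, prod_insert hv, content]
      ring
    simp_rw [h]
    rw [expect_mul_ite_coord, ih fun w hw => hf w (mem_insert_of_mem hw), card_insert_of_notMem hv]
    · ring
    · intro β x
      rw [hf v (mem_insert_self v U), content_update_of_ne]
      intro w hw hwv
      exact hv (hc _ _ _ _ hwv ▸ hw)

/-- Players contribute independently. With two distinct contexts a player meets both requirements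
with probability 1/4; with a common context the probability is 1/2 or 0. `pairFactor` is the ratio
to 1/4. -/
theorem expect_content_mul_content (hc : ∀ v w σ τ, c v σ = c w τ → v = w) (U : Finset V)
    (σ τ : V → Bool) :
    (𝔼 β, content c U σ β * content c U τ β) = (1 / 4) ^ #U * ∏ v ∈ U, pairFactor c σ τ v := by
  induction U using Finset.induction_on with
  | empty => simp [content]
  | insert v U hv ih =>
    have h : ∀ β : J → Bool, content c (insert v U) σ β * content c (insert v U) τ β =
        ((content c U σ β * content c U τ β) * if β (c v σ) = σ v then 1 else 0) *
          if β (c v τ) = τ v then 1 else 0 := by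
      intro β
      simp only [content, prod_insert hv]
      ring
    have hU : ∀ (σ' : V → Bool) β x, content c U σ β * content c U τ β =
        content c U σ (Function.update β (c v σ') x) * content c U τ (Function.update β (c v σ') x) := by
      intro σ' β x
      rw [content_update_of_ne, content_update_of_ne] <;>
      · intro w hw hwv
        exact hv (hc _ _ _ _ hwv ▸ hw)
    simp_rw [h]
    rw [prod_insert hv, card_insert_of_notMem hv, pairFactor]
    split_ifs with h1 h2
    · have h3 : ∀ β : J → Bool, ((content c U σ β * content c U τ β) *
          if β (c v σ) = σ v then (1 : ℝ) else 0) * (if β (c v τ) = τ v then (1 : ℝ) else 0) =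
          (content c U σ β * content c U τ β) * if β (c v σ) = σ v then (1 : ℝ) else 0 := by
        intro β
        rw [← h1, ← h2]
        split_ifs <;> simp
      simp_rw [h3]
      rw [expect_mul_ite_coord _ _ _ fun β x => (hU σ β x).symm, ih]
      ring
    · have h3 : ∀ β : J → Bool, ((content c U σ β * content c U τ β) *
          if β (c v σ) = σ v then (1 : ℝ) else 0) * (if β (c v τ) = τ v then (1 : ℝ) else 0) = 0 := by
        intro β
        rw [← h1]
        split_ifs with h4 h5 <;> simp
        exact absurd (h4.symm.trans h5) h2
      simp_rw [h3]
      simp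
    · rw [expect_mul_ite_coord, expect_mul_ite_coord _ _ _ fun β x => (hU σ β x).symm, ih]
      · ring
      · intro β x
        rw [← hU, Function.update_of_ne h1]

/-- Expected number of pairs of profiles, the first acceptable outside `M` and the second an
equilibrium, which are seen in the same context by some player in `M`. -/
noncomputable def dependentSum (c : V → (V → Bool) → J) (U M : Finset V) : ℝ :=
  ∑ σ : V → Bool, ∑ τ : V → Bool with (∃ v ∈ M, c v σ = c v τ) ∧ τ ≠ σ, ∏ v ∈ U, pairFactor c σ τ v

theorem expect_content_univ (hc : ∀ v w σ τ, c v σ = c w τ → v = w) (U : Finset V) (σ : V → Bool) :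
    (𝔼 β, content c U σ β) = (1 / 2) ^ #U := by
  have := expect_mul_content hc U σ (fun _ => 1) (by simp)
  simpa [Fintype.expect_const] using this

theorem expect_content_compl_mul (hc : ∀ v w σ τ, c v σ = c w τ → v = w) (M : Finset V)
    (σ τ : V → Bool) :
    (𝔼 β, content c Mᶜ σ β * content c univ τ β) =
      (1 / 2) ^ #M * ((1 / 4) ^ #Mᶜ * ∏ v ∈ Mᶜ, pairFactor c σ τ v) := by
  rw [← expect_content_mul_content hc, ← expect_mul_content hc M τ]
  · refine expect_congr rfl fun β _ => ?_
    rw [← content_mul_compl M τ β]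
    ring
  · intro v hv β x
    rw [content_update_of_ne, content_update_of_ne] <;>
    · intro w hw hwv
      exact mem_compl.1 hw (hc _ _ _ _ hwv ▸ hv)

/-- The number of equilibria which no player in `M` sees in the same context as `σ`. -/
noncomputable def independentCount (c : V → (V → Bool) → J) (M : Finset V) (σ : V → Bool)
    (β : J → Bool) : ℕ :=
  #{τ : V → Bool | (∀ v, β (c v τ) = τ v) ∧ ¬ ∃ v ∈ M, c v σ = c v τ}

/-- A profile counted here does not read the bit `c v σ` through `v`, and by `hc` through no other
player either. This is the independence on which Stein's method rests. -/
theorem independentCount_update (hc : ∀ v w σ τ, c v σ = c w τ → v = w) {M : Finset V} {v : V}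
    (hv : v ∈ M) (σ : V → Bool) (β : J → Bool) (x : Bool) :
    independentCount c M σ (Function.update β (c v σ) x) = independentCount c M σ β := by
  unfold independentCount
  congr 1
  refine filter_congr fun τ _ => and_congr_left fun hτ => forall_congr' fun w => ?_
  rw [Function.update_of_ne]
  intro h
  obtain rfl := hc _ _ _ _ h
  exact hτ ⟨w, hv, h.symm⟩

theorem independentCount_add (M : Finset V) (σ : V → Bool) (β : J → Bool) :
    fixedCount c β = independentCount c M σ β +
      #{τ : V → Bool | (∀ v, β (c v τ) = τ v) ∧ ∃ v ∈ M, c v σ = c v τ} := by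
  classical
  unfold fixedCount independentCount
  rw [← card_filter_add_card_filter_not (s := univ.filter fun σ : V → Bool => ∀ v, β (c v σ) = σ v)
    (fun τ => ∃ v ∈ M, c v σ = c v τ), filter_filter, filter_filter, add_comm]

theorem card_dependent_eq_sum (M : Finset V) (σ : V → Bool) (β : J → Bool) :
    (#{τ : V → Bool | (∀ v, β (c v τ) = τ v) ∧ ∃ v ∈ M, c v σ = c v τ} : ℝ) =
      ∑ τ : V → Bool with ∃ v ∈ M, c v σ = c v τ, content c univ τ β := by
  classical
  simp_rw [content_eq_ite]
  rw [sum_boole, filter_filter]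
  simp [and_comm]

/-- Only boundedness of `g` is needed, not smoothness: the difference vanishes for `k = 0`, and
otherwise `k` is at least 1. -/
theorem abs_sub_le_of_count {g : ℕ → ℝ} {B : ℝ} (hg : ∀ k, |g k| ≤ B) (a k : ℕ) :
    |g a - g (a + k)| ≤ 2 * B * k := by
  have hB : 0 ≤ B := (abs_nonneg _).trans (hg 0)
  rcases Nat.eq_zero_or_pos k with rfl | hk
  · simp
  · have h1 : (1 : ℝ) ≤ k := by exact_mod_cast hk
    calc |g a - g (a + k)| ≤ |g a| + |g (a + k)| := abs_sub _ _
      _ ≤ 2 * B * 1 := by linarith [hg a, hg (a + k)]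
      _ ≤ 2 * B * k := by gcongr

/-- The subtracted sum has mean zero. The rest splits into the deviation from 1 of the normalized
number of profiles acceptable outside `M`, and two replacements of the full count by
`independentCount`, each paid for by the equilibria that share a context with `σ`. -/
theorem abs_stein_pointwise_le {M : Finset V} (hM : M.Nonempty) {g : ℕ → ℝ} {B : ℝ}
    (hg : ∀ k, |g k| ≤ B) {δ : ℝ} (hδ : 0 < δ) (β : J → Bool) :
    |g (fixedCount c β + 1) - fixedCount c β * g (fixedCount c β) -
        ∑ σ, ((1 / 2) ^ #M * content c Mᶜ σ β - content c univ σ β) *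
          g (independentCount c M σ β + 1)| ≤
      B * (δ / 2 + ((1 / 2) ^ #M * ∑ σ, content c Mᶜ σ β - 1) ^ 2 / (2 * δ)) +
      2 * B * ((1 / 2) ^ #M * ∑ σ : V → Bool, ∑ τ : V → Bool with ∃ v ∈ M, c v σ = c v τ,
        content c Mᶜ σ β * content c univ τ β) +
      2 * B * ∑ σ : V → Bool, ∑ τ : V → Bool with (∃ v ∈ M, c v σ = c v τ) ∧ τ ≠ σ,
        content c univ σ β * content c univ τ β := by
  classical
  set N := fixedCount c β with hN
  have hB : 0 ≤ B := (abs_nonneg _).trans (hg 0)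
  set Y : ℝ := (1 / 2) ^ #M * ∑ σ, content c Mᶜ σ β - 1 with hY
  have key : g (N + 1) - N * g N - ∑ σ, ((1 / 2) ^ #M * content c Mᶜ σ β - content c univ σ β) *
          g (independentCount c M σ β + 1) =
      -(Y * g (N + 1)) +
      ∑ σ, (1 / 2) ^ #M * (content c Mᶜ σ β * (g (N + 1) - g (independentCount c M σ β + 1))) +
      ∑ σ, content c univ σ β * (g (independentCount c M σ β + 1) - g N) := by
    rw [hN, fixedCount_eq_sum, ← hN]
    simp only [sub_mul, mul_sub, sum_sub_distrib, hY, sum_mul, mul_sum]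
    simp only [mul_assoc]
    ring
  have h1 : |-(Y * g (N + 1))| ≤ B * (δ / 2 + Y ^ 2 / (2 * δ)) := by
    rw [abs_neg, abs_mul, mul_comm]
    -- Weighted AM–GM trades `|Y|` for `Y ^ 2`, whose mean is computable.
    have h2 : |Y| ≤ δ / 2 + Y ^ 2 / (2 * δ) := by
      have h3 : δ / 2 + Y ^ 2 / (2 * δ) - |Y| = (|Y| - δ) ^ 2 / (2 * δ) := by
        rw [← sq_abs Y]
        field_simp
        ring
      have h4 : 0 ≤ (|Y| - δ) ^ 2 / (2 * δ) := by positivity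
      linarith
    gcongr
    exact hg _
  have h2 : |∑ σ, (1 / 2) ^ #M * (content c Mᶜ σ β *
      (g (N + 1) - g (independentCount c M σ β + 1)))| ≤
      2 * B * ((1 / 2) ^ #M * ∑ σ : V → Bool, ∑ τ : V → Bool with ∃ v ∈ M, c v σ = c v τ,
        content c Mᶜ σ β * content c univ τ β) := by
    refine (abs_sum_le_sum_abs _ _).trans ?_
    rw [mul_sum, mul_sum]
    refine sum_le_sum fun σ _ => ?_
    rw [abs_mul, abs_mul, abs_of_nonneg (content_nonneg _ _ _), abs_of_nonneg (by positivity : (0 : ℝ) ≤ (1 / 2) ^ #M),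
      ← mul_sum, ← card_dependent_eq_sum, abs_sub_comm, hN, independentCount_add M σ β,
      add_right_comm]
    have := abs_sub_le_of_count hg (independentCount c M σ β + 1)
      #{τ : V → Bool | (∀ v, β (c v τ) = τ v) ∧ ∃ v ∈ M, c v σ = c v τ}
    have h0 := content_nonneg (c := c) Mᶜ σ β
    refine (mul_le_mul_of_nonneg_left (mul_le_mul_of_nonneg_left this h0)
      (by positivity : (0 : ℝ) ≤ (1 / 2) ^ #M)).trans_eq ?_
    ring
  have h3 : |∑ σ, content c univ σ β * (g (independentCount c M σ β + 1) - g N)| ≤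
      2 * B * ∑ σ : V → Bool, ∑ τ : V → Bool with (∃ v ∈ M, c v σ = c v τ) ∧ τ ≠ σ,
        content c univ σ β * content c univ τ β := by
    refine (abs_sum_le_sum_abs _ _).trans ?_
    rw [mul_sum]
    refine sum_le_sum fun σ _ => ?_
    rw [abs_mul, abs_of_nonneg (content_nonneg _ _ _), ← mul_sum]
    by_cases hσ : ∀ v ∈ univ, β (c v σ) = σ v
    -- As `M` is nonempty, the equilibrium `σ` shares a context with itself. It accounts for the `+
    -- 1` in the argument of `g`, so only the `k` other profiles cost anything.
    · obtain ⟨v₀, hv₀⟩ := hM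
      have hmem : σ ∈ univ.filter fun τ : V → Bool =>
          (∀ v, β (c v τ) = τ v) ∧ ∃ v ∈ M, c v σ = c v τ := by
        simpa using ⟨by simpa using hσ, v₀, hv₀⟩
      obtain ⟨k, hk⟩ := Nat.exists_eq_succ_of_ne_zero (card_pos.2 ⟨σ, hmem⟩).ne'
      have hsum : (∑ τ : V → Bool with (∃ v ∈ M, c v σ = c v τ) ∧ τ ≠ σ, content c univ τ β) = k := by
        have h4 := card_dependent_eq_sum (c := c) M σ β
        rw [hk] at h4
        have h5 : (univ.filter fun τ : V → Bool => (∃ v ∈ M, c v σ = c v τ) ∧ τ ≠ σ) =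
            (univ.filter fun τ : V → Bool => ∃ v ∈ M, c v σ = c v τ).erase σ := by
          ext τ; simp [and_comm]
        have h6 : σ ∈ univ.filter fun τ : V → Bool => ∃ v ∈ M, c v σ = c v τ := by
          simpa using ⟨v₀, hv₀⟩
        have h7 : content c univ σ β = 1 := by rw [content_eq_ite, if_pos hσ]
        rw [h5]
        rw [← add_sum_erase _ _ h6, h7] at h4
        push_cast at h4
        linarith
      rw [hsum, hN, independentCount_add M σ β, hk]
      have := abs_sub_le_of_count hg (independentCount c M σ β + 1) k
      rw [show independentCount c M σ β + k.succ = independentCount c M σ β + 1 + k by omega]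
      have h0 := content_nonneg (c := c) univ σ β
      exact (mul_le_mul_of_nonneg_left this h0).trans_eq (by ring)
    · rw [content_eq_ite, if_neg hσ]
      simp
  rw [key]
  refine (abs_add_three _ _ _).trans ?_
  gcongr

/-- A Chen–Stein bound for the number of equilibria in a uniformly random response table. The
players outside `M` are only used through the second moment of the number of profiles with which
they are content. -/
theorem abs_expect_stein_le (hc : ∀ v w σ τ, c v σ = c w τ → v = w) {M : Finset V}
    (hM : M.Nonempty) {g : ℕ → ℝ} {B : ℝ} (hg : ∀ k, |g k| ≤ B) {δ : ℝ} (hδ : 0 < δ) :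
    |𝔼 β, (g (fixedCount c β + 1) - fixedCount c β * g (fixedCount c β))| ≤
      B * (δ / 2 + ((1 / 4) ^ Fintype.card V *
          (∑ σ : V → Bool, ∑ τ : V → Bool, ∏ v ∈ Mᶜ, pairFactor c σ τ v) - 1) / (2 * δ)) +
      2 * B * ((1 / 2) ^ #M + (1 / 4) ^ Fintype.card V * dependentSum c Mᶜ M) +
      2 * B * ((1 / 4) ^ Fintype.card V * dependentSum c univ M) := by
  classical
  have hB : 0 ≤ B := (abs_nonneg _).trans (hg 0)
  have hcard : #Mᶜ + #M = Fintype.card V := by rw [add_comm, card_add_card_compl]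
  -- Given the bits outside those read by `M` under `σ`, the players of `M` are content with
  -- probability `(1 / 2) ^ #M`.
  have hzero : (𝔼 β, ∑ σ, ((1 / 2) ^ #M * content c Mᶜ σ β - content c univ σ β) *
          g (independentCount c M σ β + 1)) = 0 := by
    rw [expect_sum_comm]
    refine sum_eq_zero fun σ _ => ?_
    have h := expect_mul_content hc M σ
      (fun β => content c Mᶜ σ β * g (independentCount c M σ β + 1)) fun v hv β x => by
        rw [independentCount_update hc hv, content_update_of_ne]
        intro w hw hwv
        exact mem_compl.1 hw (hc _ _ _ _ hwv ▸ hv)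
    rw [mul_expect] at h
    simp only [sub_mul, expect_sub_distrib]
    rw [sub_eq_zero]
    refine Eq.trans ?_ (h.symm.trans ?_) <;> refine expect_congr rfl fun β _ => ?_
    · ring
    · rw [← content_mul_compl M σ β]; ring
  have hmono := expect_le_expect (s := univ) fun β _ => abs_stein_pointwise_le (c := c) hM hg hδ β
  refine le_trans ?_ (hmono.trans_eq ?_)
  · refine le_trans (le_of_eq ?_) (abs_expect_le _ _)
    exact congrArg abs (by
      rw [← sub_zero (𝔼 β : J → Bool, (_ : ℝ)), ← hzero, ← expect_sub_distrib])
  · rw [expect_add_distrib, expect_add_distrib]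
    congr 1
    · congr 1
      · rw [← mul_expect, expect_add_distrib, Fintype.expect_const, ← expect_div]
        congr 4
        have h1 : (𝔼 β, (∑ σ, content c Mᶜ σ β)) = 2 ^ #M := by
          rw [expect_sum_comm]
          simp_rw [expect_content_univ hc]
          simp only [sum_const, card_univ, Fintype.card_fun, Fintype.card_bool, nsmul_eq_mul]
          rw [← hcard]
          push_cast
          rw [pow_add, one_div, inv_pow]
          field_simp
        have h2 : (𝔼 β, (∑ σ, content c Mᶜ σ β) ^ 2) =
            (1 / 4) ^ #Mᶜ * ∑ σ : V → Bool, ∑ τ : V → Bool, ∏ v ∈ Mᶜ, pairFactor c σ τ v := by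
          simp_rw [sq, sum_mul_sum, expect_sum_comm, expect_content_mul_content hc, mul_sum]
        have h3 : ∀ β : J → Bool, ((1 / 2) ^ #M * ∑ σ, content c Mᶜ σ β - 1) ^ 2 =
            (1 / 4) ^ #M * (∑ σ, content c Mᶜ σ β) ^ 2 -
              2 * (1 / 2) ^ #M * (∑ σ, content c Mᶜ σ β) + 1 := by
          intro β
          rw [show (1 / 4 : ℝ) = (1 / 2) * (1 / 2) by norm_num, mul_pow]
          ring
        simp_rw [h3]
        rw [expect_add_distrib, expect_sub_distrib, ← mul_expect, ← mul_expect, h1, h2,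
          Fintype.expect_const, ← hcard, pow_add]
        have h4 : (1 / 2 : ℝ) ^ #M * 2 ^ #M = 1 := by rw [← mul_pow]; norm_num
        linear_combination (-2) * h4
      · rw [← mul_expect, ← mul_expect, expect_sum_comm]
        congr 1
        simp_rw [expect_sum_comm, expect_content_compl_mul hc]
        -- The diagonal `τ = σ` is split off; after the sum over `σ` and the outer factor it becomes
        -- the term `(1 / 2) ^ #M`.
        have h1 : ∀ σ : V → Bool, (∑ τ : V → Bool with ∃ v ∈ M, c v σ = c v τ,
            (1 / 2 : ℝ) ^ #M * ((1 / 4) ^ #Mᶜ * ∏ v ∈ Mᶜ, pairFactor c σ τ v)) =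
            (1 / 2) ^ Fintype.card V + (1 / 2) ^ #M * (1 / 4) ^ #Mᶜ *
              ∑ τ : V → Bool with (∃ v ∈ M, c v σ = c v τ) ∧ τ ≠ σ, ∏ v ∈ Mᶜ, pairFactor c σ τ v := by
          intro σ
          obtain ⟨v₀, hv₀⟩ := hM
          have h5 : (univ.filter fun τ : V → Bool => (∃ v ∈ M, c v σ = c v τ) ∧ τ ≠ σ) =
              (univ.filter fun τ : V → Bool => ∃ v ∈ M, c v σ = c v τ).erase σ := by
            ext τ; simp [and_comm]
          have h6 : σ ∈ univ.filter fun τ : V → Bool => ∃ v ∈ M, c v σ = c v τ := by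
            simpa using ⟨v₀, hv₀⟩
          rw [← add_sum_erase _ _ h6, h5, mul_sum]
          congr 1
          · simp only [pairFactor, if_true, prod_const]
            rw [← mul_pow, ← hcard, pow_add, mul_comm]
            norm_num
          · exact sum_congr rfl fun τ _ => by ring
        simp_rw [h1]
        rw [sum_add_distrib, mul_add, dependentSum, ← mul_sum]
        congr 1
        · simp only [sum_const, card_univ, Fintype.card_fun, Fintype.card_bool, nsmul_eq_mul]
          push_cast
          rw [← mul_pow]
          norm_num
        · rw [← hcard, pow_add, show (1 / 4 : ℝ) ^ #M = (1 / 2) ^ #M * (1 / 2) ^ #M by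
            rw [← mul_pow]; norm_num]
          ring
    · rw [← mul_expect, expect_sum_comm]
      congr 1
      simp_rw [expect_sum_comm, expect_content_mul_content hc]
      simp only [dependentSum, mul_sum, card_univ]

end Response

/-! ### From payoff tables to uniformly random best responses. -/

section Payoffs

open Finset
open scoped BigOperators

variable {V : Type*} {G : SimpleGraph V}

/-- The part of a profile that player `v` sees. -/
def seenBy (G : SimpleGraph V) (v : V) (σ : V → Bool) : Σ v : V, (G.neighborSet v → Bool) :=
  ⟨v, fun w => σ w⟩

theorem seenBy_fst {v w : V} {σ τ : V → Bool} (h : seenBy G v σ = seenBy G w τ) : v = w :=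
  congrArg Sigma.fst h

theorem seenBy_eq_iff {v : V} {σ τ : V → Bool} :
    seenBy G v σ = seenBy G v τ ↔ ∀ w, G.Adj v w → σ w = τ w := by
  constructor
  · intro h w hw
    exact congrFun (eq_of_heq (Sigma.mk.inj h).2) ⟨w, hw⟩
  · intro h
    unfold seenBy
    congr 1
    funext w
    exact h w w.2

/-- The best responses in the game with payoffs `u`, without regard to ties. -/
noncomputable def bestResponse (u : PayoffTables G) : (Σ v : V, (G.neighborSet v → Bool)) → Bool :=
  fun j => decide (u ⟨j.1, false, j.2⟩ < u ⟨j.1, true, j.2⟩)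

theorem bestResponse_eq_true_iff {u : PayoffTables G} {j : Σ v : V, (G.neighborSet v → Bool)} :
    bestResponse u j = true ↔ u ⟨j.1, false, j.2⟩ < u ⟨j.1, true, j.2⟩ :=
  decide_eq_true_iff

/-- No player is ever indifferent between the two actions. -/
def NoTies (u : PayoffTables G) : Prop :=
  ∀ j : Σ v : V, (G.neighborSet v → Bool), u ⟨j.1, false, j.2⟩ ≠ u ⟨j.1, true, j.2⟩

theorem isPNE_iff_of_noTies {u : PayoffTables G} (hu : NoTies u) (σ : V → Bool) :
    IsPNE u σ ↔ ∀ v, bestResponse u (seenBy G v σ) = σ v := by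
  refine forall_congr' fun v => ?_
  have h := hu (seenBy G v σ)
  cases hσ : σ v
  · rw [← Bool.not_eq_true, bestResponse_eq_true_iff, not_lt, Bool.forall_bool]
    simp [seenBy]
  · rw [bestResponse_eq_true_iff, lt_iff_le_and_ne, and_iff_left h, Bool.forall_bool]
    simp [seenBy]

/-- Exchange the two actions of a player in the contexts where `D` is true. -/
def swapActions (D : (Σ v : V, (G.neighborSet v → Bool)) → Bool) : PayoffEntry G ≃ PayoffEntry G :=
  Function.Involutive.toPerm (fun e => ⟨e.1, xor e.2.1 (D ⟨e.1, e.2.2⟩), e.2.2⟩) fun e => by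
    obtain ⟨v, a, τ⟩ := e
    simp

theorem swapActions_apply (D : (Σ v : V, (G.neighborSet v → Bool)) → Bool)
    (j : Σ v : V, (G.neighborSet v → Bool)) (a : Bool) :
    swapActions D ⟨j.1, a, j.2⟩ = ⟨j.1, xor a (D j), j.2⟩ :=
  rfl

theorem bestResponse_comp_swapActions {u : PayoffTables G} (hu : NoTies u)
    (D : (Σ v : V, (G.neighborSet v → Bool)) → Bool) :
    bestResponse (u ∘ swapActions D) = fun j => xor (bestResponse u j) (D j) := by
  funext j
  have h := hu j
  rw [Bool.eq_iff_iff, bestResponse_eq_true_iff]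
  simp only [Function.comp, swapActions_apply]
  cases hD : D j
  · simp [bestResponse_eq_true_iff]
  · simp only [Bool.xor_true, Bool.not_false, Bool.not_true, Bool.not_eq_true', ← Bool.not_eq_true,
      bestResponse_eq_true_iff]
    rw [not_lt, le_iff_lt_or_eq, or_iff_left h.symm]

theorem map_comp_payoffLaw (μ : Measure ℝ) [IsProbabilityMeasure μ]
    (e : PayoffEntry G ≃ PayoffEntry G) :
    (payoffLaw μ G).map (fun u => u ∘ e) = payoffLaw μ G := by
  have := Measure.infinitePi_map_piCongrLeft (fun _ : PayoffEntry G => μ) e.symm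
  refine Eq.trans ?_ this
  unfold payoffLaw
  congr 1
  funext u i
  rw [MeasurableEquiv.coe_piCongrLeft, Equiv.piCongrLeft_apply]
  simp

/-- The two payoffs compared in a context are independent, and the diagonal is null for the square
of an atomless law. -/
theorem ae_noTies [Finite V] (μ : Measure ℝ) [IsProbabilityMeasure μ] [NullSingletonClass μ] :
    ∀ᵐ u ∂payoffLaw μ G, NoTies u := by
  unfold NoTies
  rw [ae_all_iff]
  intro j
  set a : PayoffEntry G := ⟨j.1, false, j.2⟩
  set b : PayoffEntry G := ⟨j.1, true, j.2⟩
  have hab : a ≠ b := by simp [a, b]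
  have hind : IndepFun (fun u : PayoffTables G => u a) (fun u => u b) (payoffLaw μ G) :=
    (iIndepFun_infinitePi (P := fun _ : PayoffEntry G => μ) (X := fun _ x => x)
      (fun _ => measurable_id)).indepFun hab
  have hmap : ∀ e : PayoffEntry G, (payoffLaw μ G).map (fun u => u e) = μ := fun e =>
    Measure.infinitePi_map_eval (fun _ : PayoffEntry G => μ) e
  have hpair := (indepFun_iff_map_prod_eq_prod_map_map (measurable_pi_apply a).aemeasurable
    (measurable_pi_apply b).aemeasurable).1 hind
  rw [hmap, hmap] at hpair
  have hnull : (μ.prod μ) {x : ℝ × ℝ | x.1 = x.2} = 0 := by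
    rw [Measure.prod_apply (measurableSet_eq_fun measurable_fst measurable_snd)]
    simp [Set.preimage]
  rw [← hpair, Measure.map_apply ((measurable_pi_apply a).prodMk (measurable_pi_apply b))
    (measurableSet_eq_fun measurable_fst measurable_snd)] at hnull
  rw [ae_iff]
  simpa [Set.preimage] using hnull

theorem measurable_bestResponse : Measurable (bestResponse : PayoffTables G → _) := by
  refine measurable_pi_lambda _ fun j => ?_
  refine measurable_to_bool ?_
  have : (fun u : PayoffTables G => bestResponse u j) ⁻¹' {true} =
      {u | u ⟨j.1, false, j.2⟩ < u ⟨j.1, true, j.2⟩} := by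
    ext u; simp [bestResponse]
  rw [this]
  exact measurableSet_lt (measurable_pi_apply _) (measurable_pi_apply _)

instance isProbabilityMeasure_map_bestResponse (μ : Measure ℝ) [IsProbabilityMeasure μ] :
    IsProbabilityMeasure ((payoffLaw μ G).map bestResponse) :=
  Measure.isProbabilityMeasure_map measurable_bestResponse.aemeasurable

/-- Swapping the actions exactly in the contexts where `β` and `β'` differ preserves the payoff law
and carries one table to the other, so all tables are equally likely. -/
theorem map_bestResponse_singleton_eq [Finite V] (μ : Measure ℝ) [IsProbabilityMeasure μ]
    [NullSingletonClass μ] (β β' : (Σ v : V, (G.neighborSet v → Bool)) → Bool) :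
    ((payoffLaw μ G).map bestResponse).real {β} = ((payoffLaw μ G).map bestResponse).real {β'} := by
  have key : (payoffLaw μ G).map bestResponse = ((payoffLaw μ G).map bestResponse).map
      fun γ j => xor (γ j) (xor (β j) (β' j)) := by
    have hx : Measurable fun (γ : (Σ v : V, (G.neighborSet v → Bool)) → Bool) j =>
        xor (γ j) (xor (β j) (β' j)) := measurable_pi_lambda _ fun j =>
      (measurable_of_finite (fun x : Bool => xor x (xor (β j) (β' j)))).comp (measurable_pi_apply j)
    rw [Measure.map_map hx measurable_bestResponse]
    conv_lhs => rw [← map_comp_payoffLaw μ (swapActions fun j => xor (β j) (β' j))]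
    rw [Measure.map_map measurable_bestResponse
      (measurable_pi_lambda _ fun _ => measurable_pi_apply _)]
    refine Measure.map_congr ?_
    filter_upwards [ae_noTies μ] with u hu
    exact bestResponse_comp_swapActions hu _
  conv_lhs => rw [key]
  rw [measureReal_def, measureReal_def, Measure.map_apply]
  · congr 2
    ext γ
    simp only [Set.mem_preimage, Set.mem_singleton_iff, funext_iff]
    refine forall_congr' fun j => ?_
    cases γ j <;> cases β j <;> cases β' j <;> simp
  · exact measurable_pi_lambda _ fun j =>
      (measurable_of_finite (fun x : Bool => xor x (xor (β j) (β' j)))).comp (measurable_pi_apply j)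
  · exact measurableSet_singleton _

variable [Fintype V] [DecidableEq V]

/-- The number of pure Nash equilibria is distributed as in a uniformly random best response
table. -/
theorem integral_numPNE [Fintype (Σ v : V, (G.neighborSet v → Bool))]
    [DecidableEq (Σ v : V, (G.neighborSet v → Bool))] (μ : Measure ℝ) [IsProbabilityMeasure μ]
    [NullSingletonClass μ] (F : ℕ → ℝ) :
    ∫ u, F (numPNE u) ∂payoffLaw μ G = 𝔼 β, F (fixedCount (seenBy G) β) := by
  have h1 : ∫ u, F (numPNE u) ∂payoffLaw μ G =
      ∫ u, F (fixedCount (seenBy G) (bestResponse u)) ∂payoffLaw μ G := by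
    refine integral_congr_ae ?_
    filter_upwards [ae_noTies μ] with u hu
    congr 1
    unfold numPNE fixedCount
    rw [← Set.ncard_coe_finset]
    congr 1
    ext σ
    simp [isPNE_iff_of_noTies hu]
  have h2 : ∀ β, ((payoffLaw μ G).map bestResponse).real {β} =
      (Fintype.card ((Σ v : V, (G.neighborSet v → Bool)) → Bool) : ℝ)⁻¹ := by
    intro β
    have h3 : ∑ β' : (Σ v : V, (G.neighborSet v → Bool)) → Bool,
        ((payoffLaw μ G).map bestResponse).real {β'} = 1 := by
      rw [sum_measureReal_singleton]
      simp
    rw [sum_congr rfl fun β' _ => map_bestResponse_singleton_eq μ β' β] at h3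
    rw [sum_const, nsmul_eq_mul, card_univ] at h3
    exact eq_inv_of_mul_eq_one_right h3
  rw [h1, ← integral_map (φ := bestResponse) measurable_bestResponse.aemeasurable
    (f := fun β => F (fixedCount (seenBy G) β)) (measurable_of_finite _).aestronglyMeasurable,
    integral_fintype .of_finite, Fintype.expect_eq_sum_div_card]
  simp_rw [h2, smul_eq_mul]
  rw [← mul_sum, div_eq_inv_mul]

end Payoffs

/-! ### Pairs of profiles as sets of differences. -/

section GraphStein

set_option linter.unusedSectionVars false

open Finset
open scoped BigOperators

variable {V : Type*} [Fintype V] [DecidableEq V] (G : SimpleGraph V)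

/-- The vertex `v` has no neighbour in `S`. -/
def Avoids (S : Finset V) (v : V) : Prop := ∀ w ∈ S, ¬ G.Adj v w

open scoped Classical in
/-- `±1` if `v` has no neighbour in `S`, with sign `-1` if `v ∈ S`, and `0` otherwise. -/
noncomputable def avoidSign (S : Finset V) (v : V) : ℝ :=
  if Avoids G S v then (if v ∈ S then -1 else 1) else 0

/-- The set of vertices where two profiles differ. -/
def profileDiff (σ τ : V → Bool) : Finset V := {w | σ w ≠ τ w}

variable {G}

theorem seenBy_eq_iff_avoids {v : V} {σ τ : V → Bool} :
    seenBy G v σ = seenBy G v τ ↔ Avoids G (profileDiff σ τ) v := by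
  rw [seenBy_eq_iff]
  simp only [Avoids, profileDiff, mem_filter, mem_univ, true_and]
  exact forall_congr' fun w => by rw [← not_imp_not, ne_eq]

theorem pairFactor_seenBy [Fintype (Σ v : V, (G.neighborSet v → Bool))]
    [DecidableEq (Σ v : V, (G.neighborSet v → Bool))] (σ τ : V → Bool) (v : V) :
    pairFactor (seenBy G) σ τ v = 1 + avoidSign G (profileDiff σ τ) v := by
  have h : v ∈ profileDiff σ τ ↔ ¬ σ v = τ v := by simp [profileDiff]
  have hs := seenBy_eq_iff_avoids (G := G) (v := v) (σ := σ) (τ := τ)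
  by_cases h1 : Avoids G (profileDiff σ τ) v <;> by_cases h2 : σ v = τ v <;>
    simp [pairFactor, avoidSign, hs, h, h1, h2]
  norm_num

/-- For fixed `σ`, the set of differences determines `τ`, and every set occurs. -/
theorem sum_profileDiff (f : Finset V → ℝ) :
    (∑ σ : V → Bool, ∑ τ : V → Bool, f (profileDiff σ τ)) = 2 ^ Fintype.card V * ∑ S, f S := by
  have h : ∀ σ : V → Bool, (∑ τ : V → Bool, f (profileDiff σ τ)) = ∑ S, f S := by
    intro σ
    refine Fintype.sum_bijective (profileDiff σ) ⟨fun τ τ' hτ => ?_, fun S => ?_⟩ _ _ fun _ => rfl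
    · funext w
      have hw : w ∈ profileDiff σ τ ↔ w ∈ profileDiff σ τ' := by rw [hτ]
      simp only [profileDiff, mem_filter, mem_univ, true_and] at hw
      cases h1 : σ w <;> cases h2 : τ w <;> cases h3 : τ' w <;> simp_all
    · refine ⟨fun w => xor (σ w) (decide (w ∈ S)), ?_⟩
      ext w
      by_cases hw : w ∈ S <;> simp [profileDiff, hw]
  simp [h]

theorem profileDiff_eq_empty {σ τ : V → Bool} : profileDiff σ τ = ∅ ↔ τ = σ := by
  rw [profileDiff, filter_eq_empty_iff, funext_iff]
  simp [eq_comm]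

variable (G)

/-- The normalized second moment of the number of profiles with which the players of `U` are
content. -/
noncomputable def secondMoment (U : Finset V) : ℝ :=
  (1 / 2) ^ Fintype.card V * ∑ S : Finset V, ∏ v ∈ U, (1 + avoidSign G S v)

open scoped Classical in
/-- The contribution to `secondMoment G U` of the nonempty sets which have no neighbours of some
vertex of `M`. -/
noncomputable def avoidMoment (U M : Finset V) : ℝ :=
  (1 / 2) ^ Fintype.card V * ∑ S : Finset V with S.Nonempty ∧ ∃ v ∈ M, Avoids G S v,
    ∏ v ∈ U, (1 + avoidSign G S v)

/-- The Chen–Stein bound for the number of pure Nash equilibria of the random game on `G`. -/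
theorem abs_integral_stein_le (μ : Measure ℝ) [IsProbabilityMeasure μ] [NullSingletonClass μ]
    {M : Finset V} (hM : M.Nonempty) {g : ℕ → ℝ} {B : ℝ} (hg : ∀ k, |g k| ≤ B) {δ : ℝ}
    (hδ : 0 < δ) :
    |∫ u, (g (numPNE u + 1) - numPNE u * g (numPNE u)) ∂payoffLaw μ G| ≤
      B * (δ / 2 + (secondMoment G Mᶜ - 1) / (2 * δ)) +
      2 * B * ((1 / 2) ^ #M + avoidMoment G Mᶜ M) + 2 * B * avoidMoment G univ M := by
  classical
  have : Fintype (Σ v : V, (G.neighborSet v → Bool)) := Fintype.ofFinite _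
  have h4 : (1 / 4 : ℝ) ^ Fintype.card V = (1 / 2) ^ Fintype.card V * (1 / 2) ^ Fintype.card V := by
    rw [← mul_pow]; norm_num
  have h2 : (1 / 2 : ℝ) ^ Fintype.card V * 2 ^ Fintype.card V = 1 := by
    rw [← mul_pow]; norm_num
  have hdep : ∀ U : Finset V, (1 / 4 : ℝ) ^ Fintype.card V * dependentSum (seenBy G) U M =
      avoidMoment G U M := by
    intro U
    have h := sum_profileDiff fun S : Finset V => if S.Nonempty ∧ ∃ v ∈ M, Avoids G S v then
      ∏ v ∈ U, (1 + avoidSign G S v) else 0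
    have h' : dependentSum (seenBy G) U M = ∑ σ : V → Bool, ∑ τ : V → Bool,
        if (profileDiff σ τ).Nonempty ∧ ∃ v ∈ M, Avoids G (profileDiff σ τ) v then
          ∏ v ∈ U, (1 + avoidSign G (profileDiff σ τ) v) else 0 := by
      unfold dependentSum
      simp_rw [pairFactor_seenBy, seenBy_eq_iff_avoids]
      refine sum_congr rfl fun σ _ => ?_
      rw [sum_filter]
      refine sum_congr rfl fun τ _ => ?_
      refine if_congr ?_ rfl rfl
      rw [nonempty_iff_ne_empty, Ne, Ne, profileDiff_eq_empty, and_comm]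
    rw [h', h, avoidMoment, sum_filter, h4]
    set X := ∑ S : Finset V, if S.Nonempty ∧ ∃ v ∈ M, Avoids G S v then
      ∏ v ∈ U, (1 + avoidSign G S v) else 0
    linear_combination (1 / 2 : ℝ) ^ Fintype.card V * X * h2
  have hsec : (1 / 4 : ℝ) ^ Fintype.card V *
      (∑ σ : V → Bool, ∑ τ : V → Bool, ∏ v ∈ Mᶜ, pairFactor (seenBy G) σ τ v) =
      secondMoment G Mᶜ := by
    have h := sum_profileDiff fun S : Finset V => ∏ v ∈ Mᶜ, (1 + avoidSign G S v)
    simp_rw [pairFactor_seenBy]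
    rw [h, secondMoment, h4]
    linear_combination (1 / 2 : ℝ) ^ Fintype.card V * (∑ S, ∏ v ∈ Mᶜ, (1 + avoidSign G S v)) * h2
  have := abs_expect_stein_le (c := seenBy G) (fun _ _ _ _ => seenBy_fst) hM hg hδ
  rw [hdep, hdep, hsec] at this
  rwa [integral_numPNE μ fun k => g (k + 1) - k * g k]

end GraphStein

/-! ### Stein's equation for Poisson(1) and total variation. -/

section PoissonStein

set_option linter.unusedSectionVars false

open Finset
open scoped BigOperators Nat

/-- This is the vanishing mean of the centred `h`, multiplied by e. It lets partial sums be
rewritten as tails, which keeps the Stein solution bounded. -/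
theorem hasSum_sub_integral_poisson_div_factorial {h : ℕ → ℝ} (hh : ∀ k, |h k| ≤ 1) :
    HasSum (fun k : ℕ => (h k - ∫ i, h i ∂poissonMeasure 1) / k !) 0 := by
  have hint : Integrable h (poissonMeasure 1) :=
    Integrable.of_bound (measurable_of_countable h).aestronglyMeasurable 1 (ae_of_all _ hh)
  have h1 := hasSum_integral_poissonMeasure hint
  have h2 := (hasSum_one_poissonMeasure 1).mul_right (∫ i, h i ∂poissonMeasure 1)
  have h3 := (h1.sub h2).mul_left (Real.exp 1)
  have he : Real.exp 1 * Real.exp (-1) = 1 := by rw [← Real.exp_add]; simp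
  convert! h3 using 1
  · funext k
    simp only [NNReal.coe_one, one_pow, smul_eq_mul, mul_one]
    linear_combination (-((h k - ∫ i, h i ∂poissonMeasure 1) / k !)) * he
  · simp

theorem factorial_div_factorial_le (k i : ℕ) : (k ! : ℝ) / (i + (k + 1))! ≤ (1 / 2) ^ i := by
  have h1 : k ! * (i + 1)! ≤ (i + (k + 1))! := by
    have := Nat.le_of_dvd (Nat.factorial_pos _) (Nat.factorial_mul_factorial_dvd_factorial_add k (i + 1))
    rwa [show k + (i + 1) = i + (k + 1) by ring] at this
  have h2 : 2 ^ i ≤ (i + 1)! := by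
    induction i with
    | zero => simp
    | succ i ih =>
      rw [pow_succ, Nat.factorial_succ, mul_comm]
      refine Nat.mul_le_mul (by omega) (ih ?_)
      have := Nat.le_of_dvd (Nat.factorial_pos _) (Nat.factorial_mul_factorial_dvd_factorial_add k (i + 1))
      rwa [show k + (i + 1) = i + (k + 1) by ring] at this
  have h3 : k ! * 2 ^ i ≤ (i + (k + 1))! := (Nat.mul_le_mul_left _ h2).trans h1
  have h4 : (k ! : ℝ) * 2 ^ i ≤ (i + (k + 1))! := by exact_mod_cast h3
  rw [div_le_iff₀ (by positivity), one_div, inv_pow, inv_mul_eq_div, le_div_iff₀ (by positivity)]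
  exact h4

/-- The Stein equation of the Poisson distribution with parameter one has a bounded solution. -/
theorem exists_poisson_stein_solution {h : ℕ → ℝ} (hh : ∀ k, |h k| ≤ 1) :
    ∃ g : ℕ → ℝ, (∀ k, |g k| ≤ 4) ∧
      ∀ k : ℕ, g (k + 1) - k * g k = h k - ∫ i, h i ∂poissonMeasure 1 := by
  set a := ∫ i, h i ∂poissonMeasure 1 with ha
  have hsum := hasSum_sub_integral_poisson_div_factorial hh
  rw [← ha] at hsum
  have haabs : |a| ≤ 1 := by
    have := norm_integral_le_of_norm_le_const (μ := poissonMeasure 1) (f := h) (C := 1)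
      (ae_of_all _ fun k => by simpa using hh k)
    simpa using this
  have hd : ∀ k, |h k - a| ≤ 2 := fun k => (abs_sub _ _).trans (by linarith [hh k])
  -- The solution of the recursion; the truncated `k - 1` at `k = 0` is harmless because the sum is
  -- empty.
  refine ⟨fun k => (k - 1)! * ∑ j ∈ range k, (h j - a) / j !, fun k => ?_, fun k => ?_⟩
  · cases k with
    | zero => simp
    | succ k =>
      simp only [Nat.add_sub_cancel]
      have h1 := hsum.summable.sum_add_tsum_nat_add (k + 1)
      rw [hsum.tsum_eq] at h1
      -- The partial sum is minus the tail, whose terms times `k !` are at most `2 * (1 / 2) ^ i`.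
      -- This gives the constant 4.
      rw [eq_neg_of_add_eq_zero_left h1, mul_neg, abs_neg, ← tsum_mul_left]
      have h2 : ∀ i : ℕ, ‖(k ! : ℝ) * ((h (i + (k + 1)) - a) / (i + (k + 1))!)‖ ≤ 2 * (1 / 2) ^ i := by
        intro i
        rw [mul_div_left_comm, norm_mul, Real.norm_eq_abs, Real.norm_eq_abs,
          abs_of_nonneg (by positivity : (0 : ℝ) ≤ k ! / (i + (k + 1))!)]
        exact mul_le_mul (hd _) (factorial_div_factorial_le k i) (by positivity) (by norm_num)
      have h3 : HasSum (fun i : ℕ => (2 : ℝ) * (1 / 2) ^ i) (2 * 2) := by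
        have := (hasSum_geometric_of_lt_one (by norm_num : (0 : ℝ) ≤ 1 / 2) (by norm_num)).mul_left 2
        norm_num at this ⊢
        exact this
      have := tsum_of_norm_bounded h3 h2
      rw [Real.norm_eq_abs] at this
      linarith
  · simp only [Nat.add_sub_cancel]
    rw [sum_range_succ, mul_add]
    cases k with
    | zero => simp
    | succ k =>
      simp only [Nat.add_sub_cancel]
      rw [mul_div_cancel₀ _ (by positivity), Nat.factorial_succ]
      push_cast
      ring

variable {V : Type*} [Fintype V] [DecidableEq V] (G : SimpleGraph V)

/-- The error in the Poisson approximation of the number of equilibria in the random game on `G`,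
when Stein's method is used on the players of `M`. -/
noncomputable def steinError (M : Finset V) (δ : ℝ) : ℝ :=
  4 * (δ / 2 + (secondMoment G Mᶜ - 1) / (2 * δ)) +
    2 * 4 * ((1 / 2) ^ #M + avoidMoment G Mᶜ M) + 2 * 4 * avoidMoment G univ M

variable {G}

theorem integrable_comp_numPNE (μ : Measure ℝ) [IsProbabilityMeasure μ] {h : ℕ → ℝ}
    (hh : ∀ k, |h k| ≤ 1) : Integrable (fun u => h (numPNE u)) (payoffLaw μ G) :=
  Integrable.of_bound ((measurable_of_countable h).comp (measurable_numPNE G)).aestronglyMeasurable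
    1 (ae_of_all _ fun _ => hh _)

theorem abs_integral_numPNE_sub_le (μ : Measure ℝ) [IsProbabilityMeasure μ] [NullSingletonClass μ]
    {M : Finset V} (hM : M.Nonempty) {δ : ℝ} (hδ : 0 < δ) {h : ℕ → ℝ} (hh : ∀ k, |h k| ≤ 1) :
    |∫ u, h (numPNE u) ∂payoffLaw μ G - ∫ i, h i ∂poissonMeasure 1| ≤ steinError G M δ := by
  obtain ⟨g, hg, hgh⟩ := exists_poisson_stein_solution hh
  have := abs_integral_stein_le G μ hM hg hδ
  simp_rw [hgh] at this
  rwa [integral_sub (integrable_comp_numPNE μ hh) (integrable_const _), integral_const,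
    probReal_univ, one_smul] at this

/-- The sign of the difference of point masses is an optimal test function, so bounds uniform over
test functions bounded by 1 control total variation. -/
theorem tsum_abs_sub_eq_integral_sub (P Q : Measure ℕ) [IsProbabilityMeasure P]
    [IsProbabilityMeasure Q] :
    ∃ h : ℕ → ℝ, (∀ k, |h k| ≤ 1) ∧
      ∑' i : ℕ, |P.real {i} - Q.real {i}| = ∫ i, h i ∂P - ∫ i, h i ∂Q := by
  have hh : ∀ k, |((SignType.sign (P.real {k} - Q.real {k}) : SignType) : ℝ)| ≤ 1 := fun k => by
    generalize SignType.sign (P.real {k} - Q.real {k}) = s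
    cases s <;> simp
  refine ⟨fun i => SignType.sign (P.real {i} - Q.real {i}), hh, ?_⟩
  · set h : ℕ → ℝ := fun i => SignType.sign (P.real {i} - Q.real {i})
    have hs : ∀ ν : Measure ℕ, IsProbabilityMeasure ν →
        HasSum (fun i => ν.real {i} • h i) (∫ i, h i ∂ν) := fun ν _ => by
      have hi : Integrable h ν :=
        Integrable.of_bound (measurable_of_countable h).aestronglyMeasurable 1 (ae_of_all _ hh)
      have := hasSum_integral_iUnion (μ := ν) (f := h) (s := fun i : ℕ => {i})
        (fun i => measurableSet_singleton i)
        (fun i j hij => by simpa using hij) hi.integrableOn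
      simpa [Set.iUnion_of_singleton, measureReal_def] using this
    rw [← ((hs P inferInstance).sub (hs Q inferInstance)).tsum_eq]
    refine tsum_congr fun i => ?_
    rw [smul_eq_mul, smul_eq_mul, ← sub_mul, mul_comm]
    exact (sign_mul_self _).symm

theorem tvDist_pneLaw_le (μ : Measure ℝ) [IsProbabilityMeasure μ] [NullSingletonClass μ]
    {M : Finset V} (hM : M.Nonempty) {δ : ℝ} (hδ : 0 < δ) :
    tvDist (pneLaw μ G) (poissonMeasure 1) ≤ 1 / 2 * steinError G M δ := by
  have : IsProbabilityMeasure (pneLaw μ G) :=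
    Measure.isProbabilityMeasure_map (measurable_numPNE G).aemeasurable
  obtain ⟨h, hh, heq⟩ := tsum_abs_sub_eq_integral_sub (pneLaw μ G) (poissonMeasure 1)
  rw [tvDist, heq, pneLaw, integral_map (measurable_numPNE G).aemeasurable
    (measurable_of_countable h).aestronglyMeasurable]
  gcongr
  exact (le_abs_self _).trans (abs_integral_numPNE_sub_le μ hM hδ hh)

end PoissonStein

/-! ### Cross edges and averages over the random graph. -/

section RandomGraph

set_option linter.unusedSectionVars false

open Finset
open scoped BigOperators

variable {V : Type*} [Fintype V] [DecidableEq V]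

/-- The pairs of distinct vertices with one end in `S` and the other in `T`. -/
def crossEdges (S T : Finset V) : Finset (Sym2 V) :=
  ({x ∈ S ×ˢ T | x.1 ≠ x.2}).image fun x => s(x.1, x.2)

theorem mem_crossEdges {S T : Finset V} {e : Sym2 V} :
    e ∈ crossEdges S T ↔ ∃ a ∈ S, ∃ b ∈ T, a ≠ b ∧ s(a, b) = e := by
  simp only [crossEdges, mem_image, mem_filter, mem_product, Prod.exists]
  constructor
  · rintro ⟨a, b, ⟨⟨ha, hb⟩, hab⟩, h⟩
    exact ⟨a, ha, b, hb, hab, h⟩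
  · rintro ⟨a, ha, b, hb, hab, h⟩
    exact ⟨a, b, ⟨⟨ha, hb⟩, hab⟩, h⟩

theorem crossEdges_comm (S T : Finset V) : crossEdges S T = crossEdges T S := by
  ext e
  simp only [mem_crossEdges]
  constructor <;>
  · rintro ⟨a, ha, b, hb, hab, h⟩
    exact ⟨b, hb, a, ha, hab.symm, by rw [Sym2.eq_swap, h]⟩

theorem card_crossEdges_le (S T : Finset V) : #(crossEdges S T) ≤ #S * #T :=
  card_image_le.trans ((card_filter_le _ _).trans (card_product _ _).le)

theorem card_crossEdges_of_disjoint {S T : Finset V} (h : Disjoint S T) :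
    #(crossEdges S T) = #S * #T := by
  rw [crossEdges, filter_true_of_mem, card_image_of_injOn, card_product]
  · rintro ⟨a, b⟩ hab ⟨c, d⟩ hcd heq
    simp only [coe_product, Set.mem_prod, mem_coe] at hab hcd
    rcases Sym2.eq_iff.1 heq with ⟨rfl, rfl⟩ | ⟨rfl, rfl⟩
    · rfl
    · exact absurd hcd.2 (disjoint_left.1 h hab.1)
  · rintro ⟨a, b⟩ hab heq
    rw [mem_product] at hab
    exact disjoint_left.1 h hab.1 (heq ▸ hab.2)

theorem card_crossEdges_union {S A C : Finset V} (hA : A ⊆ S) (hC : Disjoint S C) :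
    #(crossEdges S (A ∪ C)) = #(crossEdges S A) + #S * #C := by
  rw [← card_crossEdges_of_disjoint hC, ← card_union_of_disjoint]
  · congr 1
    ext e
    simp only [mem_union, mem_crossEdges]
    constructor
    · rintro ⟨a, ha, b, hb | hb, h⟩
      · exact Or.inl ⟨a, ha, b, hb, h⟩
      · exact Or.inr ⟨a, ha, b, hb, h⟩
    · rintro (⟨a, ha, b, hb, h⟩ | ⟨a, ha, b, hb, h⟩)
      · exact ⟨a, ha, b, Or.inl hb, h⟩
      · exact ⟨a, ha, b, Or.inr hb, h⟩
  · rw [disjoint_left]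
    intro e he he'
    obtain ⟨a, ha, b, hb, -, rfl⟩ := mem_crossEdges.1 he
    obtain ⟨c, hc, d, hd, -, h⟩ := mem_crossEdges.1 he'
    rcases Sym2.eq_iff.1 h with ⟨rfl, rfl⟩ | ⟨rfl, rfl⟩
    · exact disjoint_left.1 hC (hA hb) hd
    · exact disjoint_left.1 hC ha hd

/-- Each vertex of `S` has at least `#T - 1` partners in `T` other than itself, and an unordered
pair comes from at most two ordered ones. -/
theorem mul_pred_le_two_mul_card_crossEdges (S T : Finset V) :
    #S * (#T - 1) ≤ 2 * #(crossEdges S T) := by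
  have h1 : #S * (#T - 1) ≤ #{x ∈ S ×ˢ T | x.1 ≠ x.2} := by
    have h : ({x ∈ S ×ˢ T | x.1 ≠ x.2} : Finset (V × V)) = S.biUnion fun a => (T.erase a).image (Prod.mk a) := by
      ext ⟨a, b⟩
      simp only [mem_filter, mem_product, mem_biUnion, mem_image, mem_erase, Prod.mk.injEq]
      constructor
      · rintro ⟨⟨ha, hb⟩, hab⟩
        exact ⟨a, ha, b, ⟨Ne.symm hab, hb⟩, rfl, rfl⟩
      · rintro ⟨a, ha, b, ⟨hab, hb⟩, rfl, rfl⟩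
        exact ⟨⟨ha, hb⟩, Ne.symm hab⟩
    rw [h, card_biUnion]
    · rw [← smul_eq_mul, ← sum_const]
      refine sum_le_sum fun a _ => ?_
      rw [card_image_of_injective _ (Prod.mk_right_injective a)]
      exact pred_card_le_card_erase
    · intro a _ b _ hab
      refine disjoint_left.2 ?_
      rintro ⟨c, d⟩ hc hd
      simp only [mem_image, Prod.mk.injEq] at hc hd
      obtain ⟨_, _, rfl, _⟩ := hc
      obtain ⟨_, _, h, _⟩ := hd
      exact hab h.symm
  refine h1.trans ?_
  refine card_le_mul_card_image _ 2 fun e _ => ?_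
  induction e using Sym2.ind with
  | _ a b =>
    refine (card_le_card (t := {(a, b), (b, a)}) ?_).trans card_le_two
    rintro ⟨c, d⟩ h
    rw [mem_filter] at h
    rcases Sym2.eq_iff.1 h.2 with ⟨h1, h2⟩ | ⟨h1, h2⟩ <;> simp only at h1 h2 <;> simp [h1, h2]

theorem forall_avoids_iff {G : SimpleGraph V} {S T : Finset V} :
    (∀ v ∈ T, Avoids G S v) ↔ ∀ e ∈ crossEdges S T, e ∉ G.edgeSet := by
  constructor
  · intro h e he
    obtain ⟨a, ha, b, hb, -, rfl⟩ := mem_crossEdges.1 he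
    exact fun hab => h b hb a ha (SimpleGraph.Adj.symm hab)
  · intro h v hv w hw hvw
    exact h s(w, v) (mem_crossEdges.2 ⟨w, hw, v, hv, hvw.ne', rfl⟩) hvw.symm

theorem binomialRandom_real_avoids (p : unitInterval) {E : Finset (Sym2 V)}
    (hE : ∀ e ∈ E, ¬ e.IsDiag) :
    (SimpleGraph.binomialRandom V p).real {G | ∀ e ∈ E, e ∉ G.edgeSet} = (1 - p : ℝ) ^ #E := by
  have hmeas : MeasurableSet {G : SimpleGraph V | ∀ e ∈ E, e ∉ G.edgeSet} := by
    have := (SimpleGraph.measurable_of_finite fun G : SimpleGraph V => ∀ e ∈ E, e ∉ G.edgeSet)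
      (measurableSet_singleton True)
    simpa [Set.preimage] using this
  have h1 : SimpleGraph.binomialRandom V p {G | ∀ e ∈ E, e ∉ G.edgeSet} =
      (unitInterval.toNNReal (unitInterval.symm p) : ENNReal) ^ #E := by
    rw [SimpleGraph.binomialRandom_eq_map, Measure.map_apply SimpleGraph.measurable_fromEdgeSet hmeas,
      setBernoulli_apply']
    have hset : (fun q : Sym2 V → Prop => {i | q i}) ⁻¹' (SimpleGraph.fromEdgeSet ⁻¹'
        {G | ∀ e ∈ E, e ∉ G.edgeSet}) = Set.pi E fun _ => {False} := by
      ext q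
      simp only [Set.mem_preimage, Set.mem_ofPred_eq, SimpleGraph.edgeSet_fromEdgeSet, Set.mem_pi,
        mem_coe, Set.mem_singleton_iff, eq_iff_iff, iff_false]
      refine forall₂_congr fun e he => ?_
      have := hE e he
      simp [Set.mem_sdiff, this]
    rw [hset, Measure.infinitePi_pi _ fun _ _ => measurableSet_singleton _]
    rw [← prod_const]
    refine prod_congr rfl fun e he => ?_
    have := hE e he
    simp [this]
  rw [measureReal_def, h1]
  simp

theorem integrable_graph (p : unitInterval) (f : SimpleGraph V → ℝ) :
    Integrable f (SimpleGraph.binomialRandom V p) := by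
  obtain ⟨C, hC⟩ := (Set.finite_range fun G => ‖f G‖).bddAbove
  exact Integrable.of_bound (SimpleGraph.measurable_of_finite f).aestronglyMeasurable C
    (ae_of_all _ fun G => hC ⟨G, rfl⟩)

open scoped Classical in
theorem integral_avoids (p : unitInterval) (S T : Finset V) :
    ∫ G, (if ∀ v ∈ T, Avoids G S v then (1 : ℝ) else 0) ∂SimpleGraph.binomialRandom V p =
      (1 - p : ℝ) ^ #(crossEdges S T) := by
  rw [← binomialRandom_real_avoids p (E := crossEdges S T)]
  · have hmeas : MeasurableSet {G : SimpleGraph V | ∀ e ∈ crossEdges S T, e ∉ G.edgeSet} := by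
      have := (SimpleGraph.measurable_of_finite fun G : SimpleGraph V => ∀ e ∈ crossEdges S T, e ∉ G.edgeSet)
        (measurableSet_singleton True)
      simpa [Set.preimage] using this
    rw [← integral_indicator_one hmeas]
    refine integral_congr_ae (ae_of_all _ fun G => ?_)
    simp only [Set.indicator, Set.mem_ofPred_eq, Pi.one_apply]
    exact if_congr forall_avoids_iff rfl rfl
  · intro e he
    obtain ⟨a, -, b, -, hab, rfl⟩ := mem_crossEdges.1 he
    simpa using hab

open scoped Classical in
theorem prod_avoidSign (G : SimpleGraph V) (S T : Finset V) :
    ∏ v ∈ T, avoidSign G S v = (-1) ^ #(S ∩ T) * if ∀ v ∈ T, Avoids G S v then 1 else 0 := by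
  have h : ∀ v, avoidSign G S v = (if v ∈ S then -1 else 1) * if Avoids G S v then 1 else 0 := by
    intro v
    unfold avoidSign
    split_ifs <;> norm_num
  simp_rw [h, prod_mul_distrib]
  congr 1
  · rw [prod_ite]
    simp [filter_mem_eq_inter, inter_comm]
  · rw [prod_ite_zero]
    simp

/-- Expanding the product selects a set `T` of vertices required to avoid `S`. The weight of the
pair is symmetric in `S` and `T`, which later allows their roles to be exchanged. -/
theorem integral_prod_avoidSign (p : unitInterval) (S U : Finset V) :
    ∫ G, ∏ v ∈ U, (1 + avoidSign G S v) ∂SimpleGraph.binomialRandom V p =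
      ∑ T ∈ U.powerset, (-1) ^ #(S ∩ T) * (1 - p : ℝ) ^ #(crossEdges S T) := by
  classical
  simp_rw [prod_one_add, prod_avoidSign]
  rw [integral_finsetSum _ fun T _ => integrable_graph p _]
  refine sum_congr rfl fun T _ => ?_
  rw [integral_const_mul, integral_avoids]

/-- The sum over `T ⊆ R` splits into independent sums over the parts of `T` inside and outside of
`S`. -/
theorem sum_powerset_crossEdges (q : ℝ) (S R : Finset V) :
    ∑ T ∈ R.powerset, (-1) ^ #(S ∩ T) * q ^ #(crossEdges S T) =
      (1 + q ^ #S) ^ #(R \ S) * ∑ A ∈ (R ∩ S).powerset, (-1) ^ #A * q ^ #(crossEdges S A) := by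
  have h1 : (1 + q ^ #S) ^ #(R \ S) = ∑ C ∈ (R \ S).powerset, (q ^ #S) ^ #C := by
    rw [← prod_const, prod_one_add]
    simp
  rw [h1, sum_mul_sum, ← sum_product']
  refine sum_nbij' (fun T => (T \ S, T ∩ S)) (fun x => x.2 ∪ x.1) ?_ ?_ ?_ ?_ ?_
  · intro T hT
    rw [mem_powerset] at hT
    simp only [mem_product, mem_powerset]
    exact ⟨sdiff_subset_sdiff hT subset_rfl, inter_subset_inter_right hT⟩
  · rintro ⟨C, A⟩ h
    simp only [mem_product, mem_powerset] at h ⊢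
    exact union_subset (h.2.trans inter_subset_left) (h.1.trans sdiff_subset)
  · intro T _
    ext x
    simp only [mem_union, mem_inter, Finset.mem_sdiff]
    tauto
  · rintro ⟨C, A⟩ h
    simp only [mem_product, mem_powerset] at h
    have hC : Disjoint C S := disjoint_of_subset_left h.1 sdiff_disjoint
    have hA : A ⊆ S := h.2.trans inter_subset_right
    have hC' : ∀ x ∈ C, x ∉ S := fun x hx => disjoint_left.1 hC hx
    have hA' : ∀ x ∈ A, x ∈ S := fun x hx => hA hx
    refine Prod.ext ?_ ?_ <;> ext x <;> simp only [Finset.mem_sdiff, mem_inter, mem_union] <;> grind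
  · intro T _
    have hT : T ∩ S ∪ T \ S = T := by
      ext x
      simp only [mem_union, mem_inter, Finset.mem_sdiff]
      tauto
    have h2 := card_crossEdges_union (S := S) (A := T ∩ S) (C := T \ S) inter_subset_right
      disjoint_sdiff
    rw [hT] at h2
    rw [h2, pow_add, pow_mul, inter_comm]
    ring

/-- At `p = 0` the alternating sum over subsets of a nonempty set vanishes. By Bernoulli's
inequality each term moves by at most `p` times the number of cross edges; this is the gain of a
factor `p`. -/
theorem abs_sum_powerset_crossEdges_le {p : ℝ} (hp : 0 ≤ p) (hp1 : p ≤ 1) {S W : Finset V}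
    (hW : W.Nonempty) (hWS : W ⊆ S) :
    |∑ A ∈ W.powerset, (-1) ^ #A * (1 - p) ^ #(crossEdges S A)| ≤ 2 ^ #W * (p * #S ^ 2) := by
  have h0 : ∑ A ∈ W.powerset, (-1 : ℝ) ^ #A = 0 := by
    have := sum_powerset_neg_one_pow_card_of_nonempty hW
    exact_mod_cast this
  have h1 : ∑ A ∈ W.powerset, (-1) ^ #A * (1 - p) ^ #(crossEdges S A) =
      ∑ A ∈ W.powerset, (-1) ^ #A * ((1 - p) ^ #(crossEdges S A) - 1) := by
    simp only [mul_sub, sum_sub_distrib, mul_one, h0, sub_zero]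
  rw [h1]
  refine (abs_sum_le_sum_abs _ _).trans ?_
  refine (sum_le_card_nsmul _ _ (p * #S ^ 2) fun A hA => ?_).trans_eq ?_
  · rw [abs_mul, abs_pow, abs_neg, abs_one, one_pow, one_mul]
    have h2 : (1 - p) ^ #(crossEdges S A) ≤ 1 := pow_le_one₀ (by linarith) (by linarith)
    have h3 := one_add_mul_le_pow (a := -p) (by linarith) #(crossEdges S A)
    have h4 : (#(crossEdges S A) : ℝ) ≤ #S ^ 2 := by
      have := (card_crossEdges_le S A).trans
        (Nat.mul_le_mul_left _ (card_le_card ((mem_powerset.1 hA).trans hWS)))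
      rw [sq]
      exact_mod_cast this
    rw [abs_sub_comm, abs_of_nonneg (by linarith)]
    rw [← sub_eq_add_neg] at h3
    nlinarith
  · rw [card_powerset, nsmul_eq_mul]
    push_cast
    ring

end RandomGraph

/-! ### Sums over small and large vertex sets. -/

section CrossSums

set_option linter.unusedSectionVars false

open Finset
open scoped BigOperators

/-- A weighted sum over the sizes `t` of small nonempty sets. -/
noncomputable def smallSum (n : ℕ) (q : ℝ) : ℝ :=
  ∑ t ∈ range (n + 1) with 1 ≤ t ∧ 128 * t ≤ n, n.choose t * ((t : ℝ) ^ 2 * ((1 + q ^ t) / 2) ^ (n - t))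

/-- The number of small sets. -/
noncomputable def smallCount (n : ℕ) : ℝ :=
  ∑ t ∈ range (n + 1) with 128 * t ≤ n, n.choose t

/-- A bound for the contribution of the pairs of large sets. -/
noncomputable def largeBound (n : ℕ) (p : ℝ) : ℝ :=
  2 ^ n * Real.exp (-(p * n ^ 2 / 65536))

variable {V : Type*} [Fintype V] [DecidableEq V]

theorem sum_powerset_filter_card {W : Finset V} (P : ℕ → Prop) [DecidablePred P] (F : ℕ → ℝ) :
    ∑ S ∈ W.powerset with P #S, F #S = ∑ t ∈ range (#W + 1) with P t, (#W).choose t * F t := by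
  rw [sum_filter, sum_filter, sum_powerset_apply_card (fun t => if P t then F t else 0)]
  refine sum_congr rfl fun t _ => ?_
  split_ifs <;> simp

theorem sum_filter_card (P : ℕ → Prop) [DecidablePred P] (F : ℕ → ℝ) :
    ∑ S : Finset V with P #S, F #S =
      ∑ t ∈ range (Fintype.card V + 1) with P t, (Fintype.card V).choose t * F t := by
  have := sum_powerset_filter_card (W := (univ : Finset V)) P F
  rwa [powerset_univ, card_univ] at this

/-- Here `s` exceeds n/128 and, since `256 ≤ n`, `t` exceeds n/256; with the 2 from `he` the
exponent `e` is at least n²/65536. The `t + 1` leaves room for a vertex that has been removed. -/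
theorem pow_le_exp_of_large {n : ℕ} (hn : 256 ≤ n) {p : ℝ} (hp : 0 ≤ p) (hp1 : p ≤ 1) {s t e : ℕ}
    (hs : n < 128 * s) (ht : n < 128 * (t + 1)) (he : s * t ≤ 2 * e) :
    (1 - p) ^ e ≤ Real.exp (-(p * n ^ 2 / 65536)) := by
  have h1 : (1 - p) ≤ Real.exp (-p) := by
    have := Real.add_one_le_exp (-p); linarith
  refine (pow_le_pow_left₀ (by linarith) h1 e).trans ?_
  rw [← Real.exp_nat_mul, Real.exp_le_exp]
  have h2 : (n : ℝ) < 128 * s := by exact_mod_cast hs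
  have h3 : (n : ℝ) < 128 * (t + 1) := by exact_mod_cast ht
  have h4 : (s : ℝ) * t ≤ 2 * e := by exact_mod_cast he
  have h5 : (256 : ℝ) ≤ n := by exact_mod_cast hn
  have h6 : (n : ℝ) / 128 * (n / 256) ≤ s * t := by
    refine mul_le_mul ?_ ?_ (by positivity) (by positivity) <;> linarith
  have h7 : (n : ℝ) ^ 2 / 65536 ≤ e := by nlinarith
  nlinarith

theorem half_pow_mul_eq {n t : ℕ} (ht : t ≤ n) (x : ℝ) :
    (1 / 2) ^ n * ((1 + x) ^ (n - t) * 2 ^ t) = ((1 + x) / 2) ^ (n - t) := by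
  have h1 : (1 / 2 : ℝ) ^ n = (1 / 2) ^ (n - t) * (1 / 2) ^ t := by
    rw [← pow_add, Nat.sub_add_cancel ht]
  have h2 : (1 / 2 : ℝ) ^ t * 2 ^ t = 1 := by rw [← mul_pow]; norm_num
  rw [h1, div_eq_mul_one_div (1 + x), mul_pow]
  linear_combination (1 / 2 : ℝ) ^ (n - t) * (1 + x) ^ (n - t) * h2

theorem sum_card_smul_eq_smallSum (q : ℝ) :
    (1 / 2) ^ Fintype.card V * ∑ T : Finset V with 1 ≤ #T ∧ 128 * #T ≤ Fintype.card V,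
      (1 + q ^ #T) ^ (Fintype.card V - #T) * 2 ^ #T * (#T : ℝ) ^ 2 = smallSum (Fintype.card V) q := by
  rw [sum_filter_card (fun t => 1 ≤ t ∧ 128 * t ≤ Fintype.card V)
    fun t => (1 + q ^ t) ^ (Fintype.card V - t) * 2 ^ t * (t : ℝ) ^ 2, smallSum, mul_sum]
  refine sum_congr rfl fun t ht => ?_
  rw [mem_filter, mem_range] at ht
  rw [← half_pow_mul_eq (by omega : t ≤ Fintype.card V)]
  ring

theorem sum_small_le_smallSum {q : ℝ} (hq : 0 ≤ q) :
    (1 / 2) ^ Fintype.card V * ∑ T : Finset V with 1 ≤ #T ∧ 128 * #T ≤ Fintype.card V,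
      (1 + q ^ #T) ^ (Fintype.card V - #T) ≤ smallSum (Fintype.card V) q := by
  rw [← sum_card_smul_eq_smallSum]
  gcongr with T hT
  rw [mem_filter] at hT
  have h1 : (1 : ℝ) ≤ #T := by exact_mod_cast hT.2.1
  have h2 : (1 : ℝ) ≤ 2 ^ #T * (#T : ℝ) ^ 2 :=
    one_le_mul_of_one_le_of_one_le (one_le_pow₀ (by norm_num)) (one_le_pow₀ h1)
  rw [mul_assoc]
  exact le_mul_of_one_le_right (by positivity) h2

theorem smallSum_nonneg (n : ℕ) {q : ℝ} (hq : 0 ≤ q) : 0 ≤ smallSum n q :=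
  sum_nonneg fun _ _ => by positivity

theorem card_small : (#{S : Finset V | 128 * #S ≤ Fintype.card V} : ℝ) =
    smallCount (Fintype.card V) := by
  have := sum_filter_card (V := V) (fun t => 128 * t ≤ Fintype.card V) fun _ => 1
  simpa [smallCount] using this

/-- There are at most 4^n pairs of sets, and the normalization leaves the 2^n in `largeBound`. -/
theorem sum_large_le {n : ℕ} {p : ℝ} (hn : Fintype.card V = n)
    {s : Finset (Finset V)} {t : Finset V → Finset (Finset V)} {f : Finset V → Finset V → ℝ}
    (h : ∀ S ∈ s, ∀ T ∈ t S, f S T ≤ Real.exp (-(p * n ^ 2 / 65536))) :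
    (1 / 2) ^ n * ∑ S ∈ s, ∑ T ∈ t S, f S T ≤ largeBound n p := by
  have hcard : ∀ r : Finset (Finset V), (#r : ℝ) ≤ 2 ^ n := by
    intro r
    have := card_le_univ r
    rw [Fintype.card_finset, hn] at this
    exact_mod_cast this
  have h1 : ∑ S ∈ s, ∑ T ∈ t S, f S T ≤ 2 ^ n * (2 ^ n * Real.exp (-(p * n ^ 2 / 65536))) := by
    calc _ ≤ ∑ S ∈ s, 2 ^ n * Real.exp (-(p * n ^ 2 / 65536)) := by
          refine sum_le_sum fun S hS => (sum_le_card_nsmul _ _ _ (h S hS)).trans ?_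
          rw [nsmul_eq_mul]
          gcongr
          exact hcard _
      _ ≤ _ := by
          rw [sum_const, nsmul_eq_mul]
          gcongr
          exact hcard _
  calc _ ≤ (1 / 2) ^ n * (2 ^ n * (2 ^ n * Real.exp (-(p * n ^ 2 / 65536)))) := by gcongr
    _ = _ := by
      rw [largeBound, ← mul_assoc, ← mul_pow]
      norm_num

theorem sum_powerset_comm (W : Finset V) (f : Finset V → Finset V → ℝ) :
    ∑ S ∈ W.powerset, ∑ T ∈ (W \ S).powerset, f S T =
      ∑ T ∈ W.powerset, ∑ S ∈ (W \ T).powerset, f S T := by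
  refine sum_comm' fun S T => ?_
  simp only [mem_powerset, subset_sdiff, disjoint_comm]
  tauto

theorem one_add_pow_card_eq_sum (x : ℝ) (W : Finset V) :
    (1 + x) ^ #W = ∑ T ∈ W.powerset, x ^ #T := by
  rw [← prod_const, prod_one_add]
  simp

/-- The large sets avoided by a fixed vertex. -/
theorem sum_large_erase_le (hn : 256 ≤ Fintype.card V) {p : ℝ} (hp : 0 ≤ p) (hp1 : p ≤ 1) (v : V) :
    (1 / 2) ^ Fintype.card V * ∑ S ∈ (univ.erase v).powerset with Fintype.card V < 128 * (#S + 1),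
      (1 - p) ^ #S * (1 + (1 - p) ^ #S) ^ (Fintype.card V - 1 - #S) ≤
      smallSum (Fintype.card V) (1 - p) / Fintype.card V + largeBound (Fintype.card V) p := by
  set n := Fintype.card V with hn'
  have hq : 0 ≤ 1 - p := by linarith
  set W := univ.erase v with hW
  have hWcard : #W = n - 1 := by rw [hW, card_erase_of_mem (mem_univ v), card_univ]
  have h1 : ∀ S ∈ W.powerset, (1 - p) ^ #S * (1 + (1 - p) ^ #S) ^ (n - 1 - #S) =
      ∑ T ∈ (W \ S).powerset, (1 - p) ^ (#S * (#T + 1)) := by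
    intro S hS
    rw [mem_powerset] at hS
    rw [← hWcard, ← card_sdiff_of_subset hS, one_add_pow_card_eq_sum, mul_sum]
    refine sum_congr rfl fun T _ => ?_
    rw [← pow_mul, ← pow_add]
    ring
  have h2 : ∑ S ∈ W.powerset with n < 128 * (#S + 1),
      (1 - p) ^ #S * (1 + (1 - p) ^ #S) ^ (n - 1 - #S) ≤
      (∑ T ∈ W.powerset with 128 * (#T + 1) ≤ n, (1 + (1 - p) ^ (#T + 1)) ^ (n - (#T + 1))) +
      ∑ T ∈ W.powerset with n < 128 * (#T + 1), ∑ S ∈ (W \ T).powerset with n < 128 * (#S + 1),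
        (1 - p) ^ (#S * (#T + 1)) := by
    -- After expanding the power over sets `T` disjoint from `S`, the two sets are exchanged, so
    -- that small `T` can be treated by summing freely over `S`.
    have h3 : ∑ S ∈ W.powerset with n < 128 * (#S + 1),
      (1 - p) ^ #S * (1 + (1 - p) ^ #S) ^ (n - 1 - #S) =
      ∑ T ∈ W.powerset, ∑ S ∈ (W \ T).powerset with n < 128 * (#S + 1), (1 - p) ^ (#S * (#T + 1)) := by
      have := sum_powerset_comm W fun S T => if n < 128 * (#S + 1) then (1 - p) ^ (#S * (#T + 1)) else 0
      simp_rw [sum_filter]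
      rw [← this]
      refine sum_congr rfl fun S hS => ?_
      rw [h1 S hS]
      split_ifs <;> simp
    rw [h3, ← sum_filter_add_sum_filter_not _ (fun T => 128 * (#T + 1) ≤ n)]
    simp only [not_le]
    gcongr with T hT
    rw [mem_filter, mem_powerset] at hT
    rw [show n - (#T + 1) = #(W \ T) by rw [card_sdiff_of_subset hT.1, hWcard]; omega,
      one_add_pow_card_eq_sum]
    refine (sum_le_sum_of_subset_of_nonneg (filter_subset _ _) fun _ _ _ => by positivity).trans_eq ?_
    exact sum_congr rfl fun S _ => by rw [← pow_mul, mul_comm]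
  refine (mul_le_mul_of_nonneg_left h2 (by positivity)).trans ?_
  rw [mul_add]
  refine add_le_add ?_ (sum_large_le hn'.symm (p := p) ?_)
  · rw [sum_powerset_filter_card (fun j => 128 * (j + 1) ≤ n)
      fun j => (1 + (1 - p) ^ (j + 1)) ^ (n - (j + 1)), hWcard, Nat.sub_add_cancel (by omega)]
    have hn0 : (0 : ℝ) < n := by exact_mod_cast (by omega : 0 < n)
    rw [le_div_iff₀ hn0, smallSum, mul_sum, sum_mul]
    have h4 : ∀ j ∈ {j ∈ range n | 128 * (j + 1) ≤ n},
        (1 / 2) ^ n * (((n - 1).choose j : ℝ) * (1 + (1 - p) ^ (j + 1)) ^ (n - (j + 1))) * n ≤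
        n.choose (j + 1) * (((j + 1 : ℕ) : ℝ) ^ 2 * ((1 + (1 - p) ^ (j + 1)) / 2) ^ (n - (j + 1))) := by
      intro j hj
      rw [mem_filter, mem_range] at hj
      -- A set of size `j + 1` contains the fixed vertex in a fraction `(j + 1) / n` of cases: this
      -- is the gain of 1/n.
      have h5 : (n : ℝ) * (n - 1).choose j = n.choose (j + 1) * (j + 1 : ℕ) := by
        have := Nat.add_one_mul_choose_eq (n - 1) j
        rw [Nat.sub_add_cancel (by omega)] at this
        exact_mod_cast this
      rw [← half_pow_mul_eq (by omega : j + 1 ≤ n)]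
      have h6 : (1 : ℝ) ≤ (j + 1 : ℕ) := by exact_mod_cast Nat.le_add_left 1 j
      have h7 : (1 : ℝ) ≤ 2 ^ (j + 1) * (j + 1 : ℕ) :=
        one_le_mul_of_one_le_of_one_le (one_le_pow₀ (by norm_num)) h6
      calc _ = (n * (n - 1).choose j : ℝ) * ((1 / 2) ^ n * (1 + (1 - p) ^ (j + 1)) ^ (n - (j + 1))) * 1 := by ring
        _ ≤ (n * (n - 1).choose j : ℝ) * ((1 / 2) ^ n * (1 + (1 - p) ^ (j + 1)) ^ (n - (j + 1))) *
            (2 ^ (j + 1) * (j + 1 : ℕ)) := by gcongr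
        _ = _ := by rw [h5]; ring
    refine (sum_le_sum h4).trans (le_of_eq ?_)
    refine sum_nbij' (fun j => j + 1) (fun t => t - 1) ?_ ?_ ?_ ?_ ?_
    · intro j hj; simp only [mem_filter, mem_range] at hj ⊢; omega
    · intro t ht; simp only [mem_filter, mem_range] at ht ⊢; omega
    · intro j hj; simp
    · intro t ht; simp only [mem_filter, mem_range] at ht ⊢; omega
    · intro j hj; rfl
  · intro T hT S hS
    rw [mem_filter] at hT hS
    exact pow_le_exp_of_large hn hp hp1 hT.2 hS.2 (by rw [mul_comm]; exact Nat.le_mul_of_pos_left _ two_pos)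

/-- The expected number of pairs of disjoint nonempty sets without edges between them. -/
theorem sum_one_add_pow_sub_one_le (hn : 256 ≤ Fintype.card V) {p : ℝ} (hp : 0 ≤ p) (hp1 : p ≤ 1) :
    (1 / 2) ^ Fintype.card V * ∑ S : Finset V with 1 ≤ #S,
      ((1 + (1 - p) ^ #S) ^ (Fintype.card V - #S) - 1) ≤
      2 * smallSum (Fintype.card V) (1 - p) + Fintype.card V * largeBound (Fintype.card V) p := by
  set n := Fintype.card V with hn'
  have hq : 0 ≤ 1 - p := by linarith
  rw [← sum_filter_add_sum_filter_not _ (fun S => 128 * #S ≤ n), filter_filter, filter_filter, mul_add]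
  have hA : (1 / 2) ^ n * ∑ S : Finset V with 1 ≤ #S ∧ 128 * #S ≤ n,
      ((1 + (1 - p) ^ #S) ^ (n - #S) - 1) ≤ smallSum n (1 - p) := by
    refine le_trans ?_ (sum_small_le_smallSum (V := V) hq)
    gcongr with S hS
    linarith
  have hB : (1 / 2) ^ n * ∑ S : Finset V with 1 ≤ #S ∧ ¬ 128 * #S ≤ n,
      ((1 + (1 - p) ^ #S) ^ (n - #S) - 1) ≤ n * (smallSum n (1 - p) / n + largeBound n p) := by
    have h1 : ∑ S : Finset V with 1 ≤ #S ∧ ¬ 128 * #S ≤ n,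
        ((1 + (1 - p) ^ #S) ^ (n - #S) - 1) ≤
        ∑ v : V, ∑ S ∈ (univ.erase v).powerset with n < 128 * (#S + 1),
          (1 - p) ^ #S * (1 + (1 - p) ^ #S) ^ (n - 1 - #S) := by
      -- The inequality (1+x)^k - 1 ≤ k x (1+x)^(k-1), with the factor `k` spread over the vertices
      -- outside `S` so that the bound for a fixed vertex applies.
      have h2 : ∀ S : Finset V, (1 + (1 - p) ^ #S) ^ (n - #S) - 1 ≤
          ∑ v ∈ Sᶜ, (1 - p) ^ #S * (1 + (1 - p) ^ #S) ^ (n - 1 - #S) := by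
        intro S
        rw [sum_const, card_compl, ← hn', nsmul_eq_mul, show n - 1 - #S = n - #S - 1 by omega]
        generalize n - #S = k
        set x := (1 - p) ^ #S with hx
        have hx0 : 0 ≤ x := by positivity
        induction k with
        | zero => simp
        | succ k ih =>
          cases k with
          | zero => simp
          | succ k =>
            simp only [Nat.add_sub_cancel] at ih ⊢
            rw [pow_succ (1 + x) (k + 1)]
            have h3 : 1 ≤ (1 + x) ^ (k + 1) := one_le_pow₀ (by linarith)
            push_cast at ih ⊢
            have h4 : (1 + x) ^ (k + 1) = (1 + x) ^ k * (1 + x) := pow_succ _ _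
            have h5 : 0 ≤ (1 + x) ^ k := by positivity
            nlinarith [mul_nonneg hx0 h5, mul_nonneg hx0 (mul_nonneg hx0 h5),
              mul_nonneg (Nat.cast_nonneg k : (0 : ℝ) ≤ k) (mul_nonneg hx0 (mul_nonneg hx0 h5))]
      calc _ ≤ ∑ S : Finset V with 1 ≤ #S ∧ ¬ 128 * #S ≤ n,
            ∑ v ∈ Sᶜ, (1 - p) ^ #S * (1 + (1 - p) ^ #S) ^ (n - 1 - #S) :=
            sum_le_sum fun S _ => h2 S
        _ ≤ ∑ S : Finset V with n < 128 * (#S + 1),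
            ∑ v ∈ Sᶜ, (1 - p) ^ #S * (1 + (1 - p) ^ #S) ^ (n - 1 - #S) := by
            refine sum_le_sum_of_subset_of_nonneg (fun S hS => ?_)
              fun S _ _ => sum_nonneg fun _ _ => by positivity
            simp only [mem_filter, mem_univ, true_and] at hS ⊢
            omega
        _ = _ := by
            refine sum_comm' fun S v => ?_
            simp only [mem_filter, mem_univ, true_and, mem_compl, mem_powerset, subset_erase, subset_univ, and_comm]
    refine (mul_le_mul_of_nonneg_left h1 (by positivity)).trans ?_
    rw [mul_sum]
    refine (sum_le_card_nsmul _ _ _ fun v _ => sum_large_erase_le hn hp hp1 v).trans_eq ?_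
    rw [nsmul_eq_mul, card_univ]
  refine (add_le_add hA hB).trans_eq ?_
  have hn0 : (n : ℝ) ≠ 0 := by exact_mod_cast (by omega : n ≠ 0)
  field_simp
  ring

end CrossSums

/-! ### Mean of the second moment. -/

section ExpectedMoments

set_option linter.unusedSectionVars false

open Finset
open scoped BigOperators

variable {V : Type*} [Fintype V] [DecidableEq V]

/-- The part of `T` outside `S` gives the power; the part inside gives an alternating sum, small by
cancellation unless `S ⊆ M`, when only the empty set remains and contributes 1. -/
theorem abs_sum_crossEdges_le {p : ℝ} (hp : 0 ≤ p) (hp1 : p ≤ 1) {M S R : Finset V}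
    (hS : S.Nonempty) (hR : R ∩ S = Mᶜ ∩ S) :
    |∑ T ∈ R.powerset, (-1) ^ #(S ∩ T) * (1 - p) ^ #(crossEdges S T)| ≤
      (1 + (1 - p) ^ #S) ^ (Fintype.card V - #S) *
        (2 ^ #S * (p * #S ^ 2) + if S ⊆ M then 1 else 0) := by
  have hq : 0 ≤ 1 - p := by linarith
  rw [sum_powerset_crossEdges, hR, abs_mul, abs_of_nonneg (by positivity)]
  refine mul_le_mul ?_ ?_ (abs_nonneg _) (by positivity)
  · refine pow_le_pow_right₀ (by linarith [pow_nonneg hq #S]) ?_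
    rw [← card_compl]
    refine card_le_card fun x hx => ?_
    rw [mem_compl]
    exact (Finset.mem_sdiff.1 hx).2
  · rcases (Mᶜ ∩ S).eq_empty_or_nonempty with h | h
    · have hSM : S ⊆ M := fun x hx => by
        by_contra hxM
        have : x ∈ Mᶜ ∩ S := mem_inter.2 ⟨mem_compl.2 hxM, hx⟩
        simp [h] at this
      rw [h, if_pos hSM]
      have h1 : 0 ≤ (2 : ℝ) ^ #S * (p * #S ^ 2) := by positivity
      have h2 : crossEdges S ∅ = ∅ := by simp [crossEdges]
      simp only [powerset_empty, sum_singleton, card_empty, h2, pow_zero, mul_one, abs_one]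
      linarith
    · refine (abs_sum_powerset_crossEdges_le hp hp1 h inter_subset_right).trans ?_
      have h1 : (2 : ℝ) ^ #(Mᶜ ∩ S) ≤ 2 ^ #S :=
        pow_le_pow_right₀ (by norm_num) (card_le_card inter_subset_right)
      have h2 : (0 : ℝ) ≤ if S ⊆ M then 1 else 0 := by split_ifs <;> norm_num
      have h3 : (2 : ℝ) ^ #(Mᶜ ∩ S) * (p * #S ^ 2) ≤ 2 ^ #S * (p * #S ^ 2) := by gcongr
      linarith

/-- The cancelling part is `p` times `smallSum`. The exceptional sets lie in `M`, so there are at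
most `2 ^ #M` of them. -/
theorem sum_small_crossEdges_le {p : ℝ} (hp : 0 ≤ p) (hp1 : p ≤ 1) (M : Finset V) :
    (1 / 2) ^ Fintype.card V * ∑ S : Finset V with 1 ≤ #S ∧ 128 * #S ≤ Fintype.card V,
      (1 + (1 - p) ^ #S) ^ (Fintype.card V - #S) *
        (2 ^ #S * (p * #S ^ 2) + if S ⊆ M then 1 else 0) ≤
      p * smallSum (Fintype.card V) (1 - p) +
        2 ^ #M * ((1 + (1 - p)) / 2) ^ (Fintype.card V - #M) := by
  set n := Fintype.card V with hn
  have hq : 0 ≤ 1 - p := by linarith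
  simp_rw [mul_add, sum_add_distrib]
  rw [mul_add]
  refine add_le_add (le_of_eq ?_) ?_
  · rw [← sum_card_smul_eq_smallSum (V := V), mul_left_comm, ← hn, mul_sum _ _ p]
    congr 1
    exact sum_congr rfl fun S _ => by ring
  · simp_rw [mul_ite, mul_one, mul_zero]
    rw [← sum_filter, filter_filter, mul_sum]
    have h1 : ∀ S ∈ ({S : Finset V | (1 ≤ #S ∧ 128 * #S ≤ n) ∧ S ⊆ M} : Finset (Finset V)),
        (1 / 2) ^ n * (1 + (1 - p) ^ #S) ^ (n - #S) ≤ ((1 + (1 - p)) / 2) ^ (n - #M) := by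
      intro S hS
      rw [mem_filter] at hS
      have hSn : #S ≤ n := card_le_univ S
      have h2 : (1 / 2) ^ n * (1 + (1 - p) ^ #S) ^ (n - #S) ≤ ((1 + (1 - p) ^ #S) / 2) ^ (n - #S) := by
        rw [← half_pow_mul_eq hSn]
        gcongr
        exact le_mul_of_one_le_right (by positivity) (one_le_pow₀ (by norm_num))
      have h3 : (1 - p) ^ #S ≤ 1 - p :=
        pow_le_of_le_one hq (by linarith) (by omega)
      calc _ ≤ ((1 + (1 - p) ^ #S) / 2) ^ (n - #S) := h2
        _ ≤ ((1 + (1 - p)) / 2) ^ (n - #S) := by gcongr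
        _ ≤ _ := pow_le_pow_of_le_one (by linarith) (by linarith)
            (Nat.sub_le_sub_left (card_le_card hS.2.2) n)
    refine (sum_le_card_nsmul _ _ _ h1).trans ?_
    rw [nsmul_eq_mul]
    gcongr
    have h4 : #({S : Finset V | (1 ≤ #S ∧ 128 * #S ≤ n) ∧ S ⊆ M}) ≤ 2 ^ #M := by
      rw [← card_powerset]
      refine card_le_card fun S hS => ?_
      rw [mem_filter] at hS
      exact mem_powerset.2 hS.2.2
    exact_mod_cast h4

theorem integral_secondMoment (p : unitInterval) (U : Finset V) :
    ∫ G, secondMoment G U ∂SimpleGraph.binomialRandom V p =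
      (1 / 2) ^ Fintype.card V * ∑ S : Finset V, ∑ T ∈ U.powerset,
        (-1) ^ #(S ∩ T) * (1 - p : ℝ) ^ #(crossEdges S T) := by
  unfold secondMoment
  rw [integral_const_mul, integral_finsetSum _ fun S _ => integrable_graph p _]
  simp_rw [integral_prod_avoidSign]

/-- Symmetry of the weight allows small `T` to be handled by summing first over `S`, and small `S`
by summing first over `T`. The empty `T` yields the main term 1, the empty `S` yields `(1 / 2) ^
#M`, and large pairs are negligible. -/
theorem integral_secondMoment_sub_one_le (hn : 256 ≤ Fintype.card V) (p : unitInterval)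
    (M : Finset V) :
    ∫ G, secondMoment G Mᶜ ∂SimpleGraph.binomialRandom V p - 1 ≤
      2 * (p * smallSum (Fintype.card V) (1 - p)) + largeBound (Fintype.card V) p + (1 / 2) ^ #M +
      (1 / 2) ^ Fintype.card V * smallCount (Fintype.card V) ^ 2 +
      2 ^ #M * ((1 + (1 - p : ℝ)) / 2) ^ (Fintype.card V - #M) := by
  have hp := p.2.1
  have hp1 := p.2.2
  rw [integral_secondMoment]
  set n := Fintype.card V with hn'
  generalize (p : ℝ) = p at *
  have hq : 0 ≤ 1 - p := by linarith
  set w : Finset V → Finset V → ℝ := fun S T => (-1) ^ #(S ∩ T) * (1 - p) ^ #(crossEdges S T) with hw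
  have hw1 : ∀ S T, |w S T| ≤ 1 := by
    intro S T
    rw [hw, abs_mul, abs_pow, abs_neg, abs_one, one_pow, one_mul, abs_of_nonneg (by positivity)]
    exact pow_le_one₀ hq (by linarith)
  have hwcomm : ∀ S T, w S T = w T S := by
    intro S T
    simp only [hw]
    rw [inter_comm, crossEdges_comm]
  -- the four parts of the sum
  have hsplit : ∑ S : Finset V, ∑ T ∈ (Mᶜ).powerset, w S T ≤
      2 ^ n +
      ∑ T : Finset V with 1 ≤ #T ∧ 128 * #T ≤ n, |∑ S : Finset V, w S T| +
      ∑ S : Finset V with ¬ 128 * #S ≤ n, ∑ T ∈ (Mᶜ).powerset with ¬ 128 * #T ≤ n, w S T +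
      (2 ^ (n - #M) + ∑ S : Finset V with 1 ≤ #S ∧ 128 * #S ≤ n, |∑ T ∈ (Mᶜ).powerset, w S T|) +
      smallCount n ^ 2 := by
    have h1 : ∑ S : Finset V, ∑ T ∈ (Mᶜ).powerset, w S T =
        ∑ T ∈ (Mᶜ).powerset with 128 * #T ≤ n, ∑ S : Finset V, w S T +
        (∑ S : Finset V with 128 * #S ≤ n, ∑ T ∈ (Mᶜ).powerset with ¬ 128 * #T ≤ n, w S T +
        ∑ S : Finset V with ¬ 128 * #S ≤ n, ∑ T ∈ (Mᶜ).powerset with ¬ 128 * #T ≤ n, w S T) := by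
      rw [sum_filter_add_sum_filter_not, sum_comm, sum_comm (s := univ),
        sum_filter_add_sum_filter_not]
    have h2 : ∑ T ∈ (Mᶜ).powerset with 128 * #T ≤ n, ∑ S : Finset V, w S T ≤
        2 ^ n + ∑ T : Finset V with 1 ≤ #T ∧ 128 * #T ≤ n, |∑ S : Finset V, w S T| := by
      have h3 : ∑ T ∈ (Mᶜ).powerset with 128 * #T ≤ n, ∑ S : Finset V, w S T =
          ∑ S : Finset V, w S ∅ + ∑ T ∈ ({T ∈ (Mᶜ).powerset | 128 * #T ≤ n}).erase ∅, ∑ S : Finset V, w S T :=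
        (add_sum_erase _ _ (by simp)).symm
      rw [h3]
      refine add_le_add (le_of_eq ?_) ((sum_le_sum fun T _ => le_abs_self _).trans
        (sum_le_sum_of_subset_of_nonneg (fun T hT => ?_) fun _ _ _ => abs_nonneg _))
      · simp [hw, crossEdges, hn']
      · simp only [mem_erase, mem_filter, mem_univ, true_and] at hT ⊢
        exact ⟨card_pos.2 (nonempty_iff_ne_empty.2 hT.1), hT.2.2⟩
    have h4 : ∑ S : Finset V with 128 * #S ≤ n, ∑ T ∈ (Mᶜ).powerset with ¬ 128 * #T ≤ n, w S T ≤
        (2 ^ (n - #M) + ∑ S : Finset V with 1 ≤ #S ∧ 128 * #S ≤ n, |∑ T ∈ (Mᶜ).powerset, w S T|) +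
        smallCount n ^ 2 := by
      -- Restoring the small `T` to complete the inner sum costs at most one unit each, hence the
      -- square of `smallCount` in total.
      have h5 : ∀ S, ∑ T ∈ (Mᶜ).powerset with ¬ 128 * #T ≤ n, w S T ≤
          ∑ T ∈ (Mᶜ).powerset, w S T + smallCount n := by
        intro S
        rw [← sum_filter_add_sum_filter_not (Mᶜ).powerset (fun T => 128 * #T ≤ n)]
        have h6 : |∑ T ∈ (Mᶜ).powerset with 128 * #T ≤ n, w S T| ≤ smallCount n := by
          refine (abs_sum_le_sum_abs _ _).trans ((sum_le_card_nsmul _ _ 1 fun T _ => hw1 S T).trans ?_)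
          rw [nsmul_eq_mul, mul_one, hn', ← card_small (V := V)]
          exact_mod_cast card_le_card (filter_subset_filter _ (subset_univ _))
        linarith [neg_abs_le (∑ T ∈ (Mᶜ).powerset with 128 * #T ≤ n, w S T)]
      refine (sum_le_sum fun S _ => h5 S).trans ?_
      rw [sum_add_distrib, sum_const, nsmul_eq_mul, card_small, ← hn', ← sq]
      gcongr
      have h7 : ∑ S : Finset V with 128 * #S ≤ n, ∑ T ∈ (Mᶜ).powerset, w S T =
          ∑ T ∈ (Mᶜ).powerset, w ∅ T +
          ∑ S ∈ ({S : Finset V | 128 * #S ≤ n} : Finset (Finset V)).erase ∅, ∑ T ∈ (Mᶜ).powerset, w S T :=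
        (add_sum_erase _ _ (by simp)).symm
      rw [h7]
      refine add_le_add (le_of_eq ?_) ((sum_le_sum fun T _ => le_abs_self _).trans
        (sum_le_sum_of_subset_of_nonneg (fun T hT => ?_) fun _ _ _ => abs_nonneg _))
      · simp [hw, crossEdges, card_compl, hn']
      · simp only [mem_erase, mem_filter, mem_univ, true_and] at hT ⊢
        exact ⟨card_pos.2 (nonempty_iff_ne_empty.2 hT.1), hT.2⟩
    rw [h1]
    linarith
  have hA : (1 / 2) ^ n * ∑ T : Finset V with 1 ≤ #T ∧ 128 * #T ≤ n, |∑ S : Finset V, w S T| ≤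
      p * smallSum n (1 - p) := by
    have h1 : ∀ T ∈ ({T : Finset V | 1 ≤ #T ∧ 128 * #T ≤ n} : Finset (Finset V)),
        |∑ S : Finset V, w S T| ≤ p * ((1 + (1 - p) ^ #T) ^ (n - #T) * 2 ^ #T * (#T : ℝ) ^ 2) := by
      intro T hT
      rw [mem_filter] at hT
      have h2 := abs_sum_crossEdges_le hp hp1 (M := ∅) (S := T) (R := univ)
        (card_pos.1 hT.2.1) (by simp)
      rw [powerset_univ, if_neg fun h => by
        rw [subset_empty.1 h] at hT; simp at hT] at h2
      simp_rw [hwcomm _ T]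
      refine h2.trans_eq ?_
      ring
    rw [← sum_card_smul_eq_smallSum (V := V), mul_left_comm, mul_sum _ _ p, ← hn']
    gcongr with T hT
    exact h1 T hT
  have hB : (1 / 2) ^ n * ∑ S : Finset V with ¬ 128 * #S ≤ n,
      ∑ T ∈ (Mᶜ).powerset with ¬ 128 * #T ≤ n, w S T ≤ largeBound n p := by
    refine sum_large_le hn'.symm fun S hS T hT => ?_
    rw [mem_filter] at hS hT
    have h1 : w S T ≤ (1 - p) ^ #(crossEdges S T) := by
      refine (le_abs_self _).trans (le_of_eq ?_)
      rw [hw, abs_mul, abs_pow, abs_neg, abs_one, one_pow, one_mul, abs_of_nonneg (by positivity)]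
    refine h1.trans (pow_le_exp_of_large hn hp hp1 (s := #S) (t := #T - 1) (by omega) (by omega) ?_)
    exact mul_pred_le_two_mul_card_crossEdges S T
  have hC : (1 / 2) ^ n * ∑ S : Finset V with 1 ≤ #S ∧ 128 * #S ≤ n, |∑ T ∈ (Mᶜ).powerset, w S T| ≤
      p * smallSum n (1 - p) + 2 ^ #M * ((1 + (1 - p)) / 2) ^ (n - #M) := by
    refine le_trans ?_ (sum_small_crossEdges_le hp hp1 M)
    rw [← hn']
    gcongr with S hS
    rw [mem_filter] at hS
    exact abs_sum_crossEdges_le hp hp1 (card_pos.1 hS.2.1) rfl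
  have h2 : (1 / 2 : ℝ) ^ n * 2 ^ n = 1 := by rw [← mul_pow]; norm_num
  have h3 : (1 / 2 : ℝ) ^ n * 2 ^ (n - #M) = (1 / 2) ^ #M := by
    have h4 : (1 / 2 : ℝ) ^ n = (1 / 2) ^ (n - #M) * (1 / 2) ^ #M := by
      rw [← pow_add, Nat.sub_add_cancel (card_le_univ M)]
    have h5 : (1 / 2 : ℝ) ^ (n - #M) * 2 ^ (n - #M) = 1 := by rw [← mul_pow]; norm_num
    rw [h4]
    linear_combination (1 / 2 : ℝ) ^ #M * h5
  have h4 := mul_le_mul_of_nonneg_left hsplit (by positivity : (0 : ℝ) ≤ (1 / 2) ^ n)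
  rw [mul_add, mul_add, mul_add, mul_add, mul_add, h2, h3] at h4
  linarith

end ExpectedMoments

/-! ### Mean number of pairs of profiles sharing a context. -/

section AvoidMoments

set_option linter.unusedSectionVars false

open Finset
open scoped BigOperators

variable {V : Type*} [Fintype V] [DecidableEq V] {G : SimpleGraph V}

theorem avoidSign_of_mem {S : Finset V} {v : V} (hv : v ∈ S) :
    0 ≤ 1 + avoidSign G S v ∧ 1 + avoidSign G S v ≤ 1 := by
  unfold avoidSign
  split_ifs <;> norm_num

theorem avoidSign_of_notMem {S : Finset V} {v : V} (hv : v ∉ S) :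
    1 ≤ 1 + avoidSign G S v ∧ 1 + avoidSign G S v ≤ 2 := by
  unfold avoidSign
  split_ifs <;> norm_num

theorem one_add_avoidSign_nonneg (S : Finset V) (v : V) : 0 ≤ 1 + avoidSign G S v := by
  by_cases hv : v ∈ S
  · exact (avoidSign_of_mem hv).1
  · linarith [(avoidSign_of_notMem (G := G) hv).1]

/-- Vertices of `S` may be dropped from, and other vertices added to, a product of the factors
`1 + avoidSign G S v`. -/
theorem prod_avoidSign_le {S U W : Finset V} (h1 : U \ W ⊆ S) (h2 : Disjoint (W \ U) S) :
    ∏ v ∈ U, (1 + avoidSign G S v) ≤ ∏ v ∈ W, (1 + avoidSign G S v) := by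
  have h3 : ∏ v ∈ U \ W, (1 + avoidSign G S v) ≤ 1 :=
    prod_le_one (fun v _ => one_add_avoidSign_nonneg S v) fun v hv => (avoidSign_of_mem (h1 hv)).2
  have h4 : 1 ≤ ∏ v ∈ W \ U, (1 + avoidSign G S v) :=
    (prod_const_one (s := W \ U)).symm.le.trans (prod_le_prod (fun _ _ => zero_le_one)
      fun v hv => (avoidSign_of_notMem (disjoint_left.1 h2 hv)).1)
  have h5 : 0 ≤ ∏ v ∈ U ∩ W, (1 + avoidSign G S v) :=
    prod_nonneg fun v _ => one_add_avoidSign_nonneg S v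
  rw [← prod_inter_mul_prod_sdiff U W, ← prod_inter_mul_prod_sdiff W U, inter_comm W U]
  exact mul_le_mul_of_nonneg_left (h3.trans h4) h5

theorem one_le_prod_avoidSign {S W : Finset V} (h : Disjoint S W) :
    1 ≤ ∏ v ∈ W, (1 + avoidSign G S v) := by
  have := prod_avoidSign_le (G := G) (S := S) (U := ∅) (W := W) (by simp) (by simpa using h.symm)
  simpa using this

theorem two_le_prod_compl_avoidSign {S : Finset V} {v : V} (hv : v ∉ S) (h : Avoids G S v) :
    2 ≤ ∏ w ∈ Sᶜ, (1 + avoidSign G S w) := by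
  have h1 : avoidSign G S v = 1 := by rw [avoidSign, if_pos h, if_neg hv]
  have h2 := one_le_prod_avoidSign (G := G) (S := S) (W := Sᶜ.erase v)
    (disjoint_of_subset_right (erase_subset _ _) disjoint_compl_right)
  rw [← mul_prod_erase _ _ (mem_compl.2 hv), h1]
  linarith

theorem avoidSign_erase_le {S : Finset V} {v w : V} (hw : w ∉ S) :
    1 + avoidSign G S w ≤ 1 + avoidSign G (S.erase v) w := by
  have hw' : w ∉ S.erase v := fun h => hw (mem_of_mem_erase h)
  have h : Avoids G S w → Avoids G (S.erase v) w := fun h x hx => h x (mem_of_mem_erase hx)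
  unfold avoidSign
  rw [if_neg hw, if_neg hw']
  by_cases h1 : Avoids G S w
  · rw [if_pos h1, if_pos (h h1)]
  · rw [if_neg h1]
    split_ifs <;> norm_num

/-- The excess of the product over the vertices outside of `S` due to the vertex `v`. -/
noncomputable def avoidExcess (G : SimpleGraph V) (v : V) (S : Finset V) : ℝ :=
  ∏ w ∈ Sᶜ, (1 + avoidSign G S w) - ∏ w ∈ Sᶜ.erase v, (1 + avoidSign G S w)

theorem avoidExcess_eq {v : V} {S : Finset V} (hv : v ∉ S) :
    avoidExcess G v S = avoidSign G S v * ∏ w ∈ Sᶜ.erase v, (1 + avoidSign G S w) := by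
  rw [avoidExcess, ← mul_prod_erase _ _ (mem_compl.2 hv)]
  ring

theorem avoidExcess_nonneg {v : V} {S : Finset V} (hv : v ∉ S) : 0 ≤ avoidExcess G v S := by
  rw [avoidExcess_eq hv]
  exact mul_nonneg (by linarith [(avoidSign_of_notMem (G := G) hv).1])
    (prod_nonneg fun w _ => one_add_avoidSign_nonneg S w)

/-- When `v` avoids `S`, the excess captures the product up to a factor 2. If `v ∈ S`, it is first
removed from `S`, which can only enlarge the factors of the vertices outside `S`. -/
theorem prod_compl_le_avoidExcess {v : V} {S : Finset V} (h : Avoids G S v) :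
    ∏ w ∈ Sᶜ, (1 + avoidSign G S w) ≤
      if v ∈ S then avoidExcess G v (S.erase v) else 2 * avoidExcess G v S := by
  split_ifs with hv
  · have h1 : avoidSign G (S.erase v) v = 1 := by
      have h2 : Avoids G (S.erase v) v := fun x hx => h x (mem_of_mem_erase hx)
      rw [avoidSign, if_pos h2, if_neg (notMem_erase v S)]
    rw [avoidExcess_eq (notMem_erase v S), h1, one_mul, compl_erase, erase_insert (by simpa using hv)]
    exact prod_le_prod (fun w _ => one_add_avoidSign_nonneg S w)
      fun w hw => avoidSign_erase_le (mem_compl.1 hw)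
  · have h1 : avoidSign G S v = 1 := by rw [avoidSign, if_pos h, if_neg hv]
    rw [avoidExcess_eq hv, ← mul_prod_erase _ _ (mem_compl.2 hv), h1]
    linarith

theorem integral_prod_compl_avoidSign (p : unitInterval) (S W : Finset V) (hW : Disjoint S W) :
    ∫ G, ∏ v ∈ W, (1 + avoidSign G S v) ∂SimpleGraph.binomialRandom V p =
      (1 + (1 - p : ℝ) ^ #S) ^ #W := by
  rw [integral_prod_avoidSign, one_add_pow_card_eq_sum]
  refine sum_congr rfl fun T hT => ?_
  have h : Disjoint S T := disjoint_of_subset_right (mem_powerset.1 hT) hW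
  rw [disjoint_iff_inter_eq_empty.1 h, card_crossEdges_of_disjoint h, pow_mul]
  simp

theorem integral_avoidExcess (p : unitInterval) {v : V} {S : Finset V} (hv : v ∉ S) :
    ∫ G, avoidExcess G v S ∂SimpleGraph.binomialRandom V p =
      (1 - p : ℝ) ^ #S * (1 + (1 - p : ℝ) ^ #S) ^ (Fintype.card V - 1 - #S) := by
  unfold avoidExcess
  rw [integral_sub (integrable_graph p _) (integrable_graph p _),
    integral_prod_compl_avoidSign p S _ disjoint_compl_right,
    integral_prod_compl_avoidSign p S _ (disjoint_of_subset_right (erase_subset _ _) disjoint_compl_right),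
    card_erase_of_mem (mem_compl.2 hv), card_compl,
    show Fintype.card V - 1 - #S = Fintype.card V - #S - 1 by omega]
  have h1 : 0 < Fintype.card V - #S := by
    rw [← card_compl]
    exact card_pos.2 ⟨v, mem_compl.2 hv⟩
  obtain ⟨k, hk⟩ := Nat.exists_eq_succ_of_ne_zero h1.ne'
  rw [hk, Nat.succ_sub_one, pow_succ]
  ring

open scoped Classical in
theorem integral_avoidMoment (p : unitInterval) (U M : Finset V) :
    ∫ G, avoidMoment G U M ∂SimpleGraph.binomialRandom V p =
      (1 / 2) ^ Fintype.card V * ∑ S : Finset V with 1 ≤ #S,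
        ∫ G, (if ∃ v ∈ M, Avoids G S v then ∏ v ∈ U, (1 + avoidSign G S v) else 0)
          ∂SimpleGraph.binomialRandom V p := by
  unfold avoidMoment
  rw [integral_const_mul, ← integral_finsetSum _ fun S _ => integrable_graph p _]
  congr 2
  funext G
  rw [sum_filter, sum_filter]
  refine sum_congr rfl fun S _ => ?_
  simp only [Nat.succ_le_iff, card_pos, ite_and]

/-- The 3 is 1 from the sets containing `v`, reindexed by erasing `v`, plus 2 from the others. -/
theorem sum_avoidExcess_le (hn : 256 ≤ Fintype.card V) (p : unitInterval) (v : V) :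
    (1 / 2) ^ Fintype.card V * ∑ S : Finset V with Fintype.card V < 128 * #S,
      ∫ G, (if v ∈ S then avoidExcess G v (S.erase v) else 2 * avoidExcess G v S)
        ∂SimpleGraph.binomialRandom V p ≤
      3 * (smallSum (Fintype.card V) (1 - p) / Fintype.card V + largeBound (Fintype.card V) p) := by
  have hp := p.2.1
  have hp1 := p.2.2
  have hq : (0 : ℝ) ≤ 1 - p := by linarith
  set n := Fintype.card V with hn'
  refine le_trans ?_ (mul_le_mul_of_nonneg_left (sum_large_erase_le hn hp hp1 v)
    (by norm_num : (0 : ℝ) ≤ 3))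
  rw [mul_left_comm, ← hn']
  gcongr
  set F : Finset V → ℝ := fun S => (1 - p : ℝ) ^ #S * (1 + (1 - p : ℝ) ^ #S) ^ (n - 1 - #S) with hF
  have hF0 : ∀ S, 0 ≤ F S := fun S => by positivity
  have h1 : ∑ S : Finset V with n < 128 * #S,
      ∫ G, (if v ∈ S then avoidExcess G v (S.erase v) else 2 * avoidExcess G v S)
        ∂SimpleGraph.binomialRandom V p =
      ∑ S : Finset V with n < 128 * #S ∧ v ∈ S, F (S.erase v) +
      2 * ∑ S : Finset V with n < 128 * #S ∧ v ∉ S, F S := by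
    rw [← sum_filter_add_sum_filter_not _ (fun S => v ∈ S), filter_filter, filter_filter, mul_sum]
    congr 1 <;> refine sum_congr rfl fun S hS => ?_ <;> rw [mem_filter] at hS
    · simp only [hS.2.2, if_true]
      rw [integral_avoidExcess p (notMem_erase v S)]
    · simp only [hS.2.2, if_false]
      rw [integral_const_mul, integral_avoidExcess p hS.2.2]
  have h2 : ∑ S : Finset V with n < 128 * #S ∧ v ∈ S, F (S.erase v) ≤
      ∑ S ∈ (univ.erase v).powerset with n < 128 * (#S + 1), F S := by
    rw [← sum_image (f := F) (s := {S : Finset V | n < 128 * #S ∧ v ∈ S}) (g := fun S => S.erase v)]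
    · refine sum_le_sum_of_subset_of_nonneg (fun T hT => ?_) fun S _ _ => hF0 S
      obtain ⟨S, hS, rfl⟩ := mem_image.1 hT
      rw [mem_filter] at hS
      rw [mem_filter, mem_powerset, card_erase_of_mem hS.2.2]
      have := card_pos.2 ⟨v, hS.2.2⟩
      exact ⟨erase_subset_erase _ (subset_univ _), by omega⟩
    · intro S hS T hT hST
      simp only [coe_filter, Set.mem_ofPred_eq] at hS hT
      rw [← insert_erase hS.2.2, ← insert_erase hT.2.2]
      exact congrArg (insert v) hST
  have h3 : ∑ S : Finset V with n < 128 * #S ∧ v ∉ S, F S ≤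
      ∑ S ∈ (univ.erase v).powerset with n < 128 * (#S + 1), F S := by
    refine sum_le_sum_of_subset_of_nonneg (fun S hS => ?_) fun S _ _ => hF0 S
    rw [mem_filter] at hS
    rw [mem_filter, mem_powerset, subset_erase]
    exact ⟨⟨subset_univ _, hS.2.2⟩, by omega⟩
  rw [h1]
  linarith

/-- Small sets need no avoidance: the indicator is dropped and sign cancellation suffices. For large
sets a union bound over the avoiding vertex in `M` is used. The condition `hU` covers both moments
in the Stein error. -/
theorem integral_avoidMoment_le (hn : 256 ≤ Fintype.card V) (p : unitInterval) {U M : Finset V}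
    (hU : Mᶜ ⊆ U) :
    ∫ G, avoidMoment G U M ∂SimpleGraph.binomialRandom V p ≤
      p * smallSum (Fintype.card V) (1 - p) +
        2 ^ #M * ((1 + (1 - p : ℝ)) / 2) ^ (Fintype.card V - #M) +
      #M * (3 * (smallSum (Fintype.card V) (1 - p) / Fintype.card V +
        largeBound (Fintype.card V) p)) := by
  classical
  have hp := p.2.1
  have hp1 := p.2.2
  have hq : (0 : ℝ) ≤ 1 - p := by linarith
  rw [integral_avoidMoment]
  set n := Fintype.card V with hn'
  rw [← sum_filter_add_sum_filter_not _ (fun S => 128 * #S ≤ n), filter_filter, filter_filter, mul_add]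
  refine add_le_add ?_ ?_
  · refine le_trans ?_ (sum_small_crossEdges_le hp hp1 M)
    rw [← hn']
    gcongr with S hS
    rw [mem_filter] at hS
    -- Replacing `U` by `(M ∩ S)ᶜ` only increases the product and leaves no vertex of `M` inside `S`
    -- in the alternating sum.
    have hR : (M ∩ S)ᶜ ∩ S = Mᶜ ∩ S := by
      ext x; simp only [mem_inter, mem_compl]; tauto
    refine le_trans ?_ (abs_sum_crossEdges_le hp hp1 (card_pos.1 hS.2.1) hR)
    refine le_trans ?_ (le_abs_self _)
    rw [← integral_prod_avoidSign]
    refine integral_mono (integrable_graph p _) (integrable_graph p _) fun G => ?_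
    have h0 : ∏ v ∈ U, (1 + avoidSign G S v) ≤ ∏ v ∈ (M ∩ S)ᶜ, (1 + avoidSign G S v) := by
      refine prod_avoidSign_le (fun x hx => ?_) (disjoint_left.2 fun x hx hxS => ?_)
      · simp only [Finset.mem_sdiff, mem_compl, mem_inter, not_not] at hx
        exact hx.2.2
      · simp only [Finset.mem_sdiff, mem_compl, mem_inter] at hx
        exact hx.2 (hU (mem_compl.2 fun hM => hx.1 ⟨hM, hxS⟩))
    dsimp only
    split_ifs
    · exact h0
    · exact prod_nonneg fun w _ => one_add_avoidSign_nonneg S w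
  · have h1 : ∀ S : Finset V,
        ∫ G, (if ∃ v ∈ M, Avoids G S v then ∏ v ∈ U, (1 + avoidSign G S v) else 0)
          ∂SimpleGraph.binomialRandom V p ≤
        ∑ v ∈ M, ∫ G, (if v ∈ S then avoidExcess G v (S.erase v) else 2 * avoidExcess G v S)
        ∂SimpleGraph.binomialRandom V p := by
      intro S
      rw [← integral_finsetSum _ fun S _ => integrable_graph p _]
      refine integral_mono (integrable_graph p _) (integrable_graph p _) fun G => ?_
      have hnn : ∀ v ∈ M, 0 ≤ if v ∈ S then avoidExcess G v (S.erase v) else 2 * avoidExcess G v S := by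
        intro v _
        split_ifs with hv
        · exact avoidExcess_nonneg (notMem_erase v S)
        · linarith [avoidExcess_nonneg (G := G) hv]
      dsimp only
      split_ifs with h
      · obtain ⟨v, hvM, hv⟩ := h
        refine le_trans ?_ (single_le_sum hnn hvM)
        refine le_trans ?_ (prod_compl_le_avoidExcess hv)
        refine prod_avoidSign_le (fun x hx => ?_) (disjoint_left.2 fun x hx hxS => ?_)
        · simpa using (Finset.mem_sdiff.1 hx).2
        · exact mem_compl.1 (Finset.mem_sdiff.1 hx).1 hxS
      · exact sum_nonneg hnn
    calc _ ≤ (1 / 2) ^ n * ∑ S : Finset V with n < 128 * #S, ∑ v ∈ M,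
          ∫ G, (if v ∈ S then avoidExcess G v (S.erase v) else 2 * avoidExcess G v S)
            ∂SimpleGraph.binomialRandom V p := by
          gcongr
          have h2 : ({S : Finset V | 1 ≤ #S ∧ ¬ 128 * #S ≤ n} : Finset (Finset V)) =
              ({S : Finset V | n < 128 * #S} : Finset (Finset V)) := by
            ext S; simp only [mem_filter, mem_univ, true_and]; omega
          rw [h2]
          exact sum_le_sum fun S _ => h1 S
      _ = ∑ v ∈ M, (1 / 2) ^ n * ∑ S : Finset V with n < 128 * #S,
          ∫ G, (if v ∈ S then avoidExcess G v (S.erase v) else 2 * avoidExcess G v S)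
            ∂SimpleGraph.binomialRandom V p := by
          rw [sum_comm, mul_sum]
      _ ≤ _ := by
          refine (sum_le_card_nsmul _ _ _ fun v _ => sum_avoidExcess_le hn p v).trans_eq ?_
          rw [nsmul_eq_mul]

/-- An avoiding vertex inside `S` makes the product zero. One outside makes the product over the
complement at least 2, hence at most twice its excess over 1. -/
theorem integral_avoidMoment_univ_le (hn : 256 ≤ Fintype.card V) (p : unitInterval) :
    ∫ G, avoidMoment G (univ : Finset V) univ ∂SimpleGraph.binomialRandom V p ≤
      2 * (2 * smallSum (Fintype.card V) (1 - p) +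
        Fintype.card V * largeBound (Fintype.card V) p) := by
  classical
  rw [integral_avoidMoment]
  refine le_trans ?_ (mul_le_mul_of_nonneg_left (sum_one_add_pow_sub_one_le hn p.2.1 p.2.2)
    (by norm_num : (0 : ℝ) ≤ 2))
  rw [mul_left_comm]
  gcongr
  rw [mul_sum]
  refine sum_le_sum fun S _ => ?_
  rw [← card_compl, ← integral_prod_compl_avoidSign p S _ disjoint_compl_right]
  have h1 : ∫ G, (2 * (∏ v ∈ Sᶜ, (1 + avoidSign G S v) - 1)) ∂SimpleGraph.binomialRandom V p =
      2 * (∫ G, ∏ v ∈ Sᶜ, (1 + avoidSign G S v) ∂SimpleGraph.binomialRandom V p - 1) := by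
    rw [integral_const_mul, integral_sub (integrable_graph p _) (integrable_graph p _)]
    simp
  rw [← h1]
  refine integral_mono (integrable_graph p _) (integrable_graph p _) fun G => ?_
  have h2 := one_le_prod_avoidSign (G := G) (S := S) (W := Sᶜ) disjoint_compl_right
  dsimp only
  split_ifs with h
  · obtain ⟨v, -, hv⟩ := h
    by_cases hvS : v ∈ S
    · rw [prod_eq_zero (mem_univ v)]
      · linarith
      · rw [avoidSign, if_pos hv, if_pos hvS]
        norm_num
    · have h3 : ∏ v, (1 + avoidSign G S v) ≤ ∏ v ∈ Sᶜ, (1 + avoidSign G S v) :=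
        prod_avoidSign_le (fun x hx => by simpa using (Finset.mem_sdiff.1 hx).2)
          (disjoint_left.2 fun x hx _ => (Finset.mem_sdiff.1 hx).2 (mem_univ x))
      linarith [two_le_prod_compl_avoidSign hvS hv]
  · linarith

/-- The derivative of the binomial theorem. -/
theorem sum_card_mul_pow_pred (n : ℕ) (q : ℝ) :
    ∑ s ∈ range (n + 1) with 1 ≤ s, n.choose s * (s * q ^ (s - 1)) = n * (1 + q) ^ (n - 1) := by
  cases n with
  | zero => simp [sum_filter]
  | succ n =>
    rw [Nat.add_sub_cancel, add_comm (1 : ℝ) q, add_pow, mul_sum]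
    refine sum_nbij' (fun s => s - 1) (fun j => j + 1) ?_ ?_ ?_ ?_ ?_
    · intro t ht; simp only [mem_filter, mem_range] at ht ⊢; omega
    · intro j hj; simp only [mem_filter, mem_range] at hj ⊢; omega
    · intro t ht; simp only [mem_filter, mem_range] at ht ⊢; omega
    · intro j hj; simp
    · intro t ht
      simp only [mem_filter, mem_range] at ht
      obtain ⟨j, rfl⟩ := Nat.exists_eq_succ_of_ne_zero (by omega : t ≠ 0)
      have : ((n + 1 : ℕ) : ℝ) * n.choose j = (n + 1).choose (j + 1) * (j + 1 : ℕ) := by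
        exact_mod_cast Nat.add_one_mul_choose_eq n j
      simp only [Nat.succ_eq_add_one, Nat.add_sub_cancel, one_pow, mul_one]
      linear_combination (-q ^ j) * this

open scoped Classical in
theorem integral_avoids_self_le (p : unitInterval) {S : Finset V} {v : V} (hv : v ∈ S) :
    ∫ G, (if Avoids G S v then (1 : ℝ) else 0) ∂SimpleGraph.binomialRandom V p ≤
      (1 - p : ℝ) ^ (#S - 1) := by
  have h := integral_avoids p S {v}
  simp only [mem_singleton, forall_eq] at h
  rw [h]
  refine pow_le_pow_of_le_one (by linarith [p.2.2]) (by linarith [p.2.1]) ?_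
  have h1 := card_crossEdges_union (S := {v}) (A := {v}) (C := S.erase v) subset_rfl (by simp)
  rw [← insert_eq, insert_erase hv, crossEdges_comm, card_singleton, one_mul,
    card_erase_of_mem hv] at h1
  omega

/-- The indicator is dominated by the excess over 1 of the product over the complement, for avoiding
vertices outside `S`, plus the number of avoiding vertices inside. The mean of the latter is
absorbed in the term `t = 1` of `smallSum`. -/
theorem integral_avoidMoment_empty_le (hn : 256 ≤ Fintype.card V) (p : unitInterval) :
    ∫ G, avoidMoment G (∅ : Finset V) univ ∂SimpleGraph.binomialRandom V p ≤
      3 * smallSum (Fintype.card V) (1 - p) +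
        Fintype.card V * largeBound (Fintype.card V) p := by
  classical
  have hq : (0 : ℝ) ≤ 1 - p := by linarith [p.2.2]
  rw [integral_avoidMoment]
  have h1 : ∀ S : Finset V,
      ∫ G, (if ∃ v ∈ univ, Avoids G S v then ∏ v ∈ (∅ : Finset V), (1 + avoidSign G S v) else 0)
        ∂SimpleGraph.binomialRandom V p ≤
      ((1 + (1 - p : ℝ) ^ #S) ^ (Fintype.card V - #S) - 1) + #S * (1 - p : ℝ) ^ (#S - 1) := by
    intro S
    have h2 : ∫ G, ((∏ v ∈ Sᶜ, (1 + avoidSign G S v) - 1) + ∑ v ∈ S, if Avoids G S v then (1 : ℝ) else 0)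
        ∂SimpleGraph.binomialRandom V p ≤
        ((1 + (1 - p : ℝ) ^ #S) ^ (Fintype.card V - #S) - 1) + #S * (1 - p : ℝ) ^ (#S - 1) := by
      rw [integral_add (integrable_graph p _) (integrable_graph p _),
        integral_sub (integrable_graph p _) (integrable_graph p _),
        integral_prod_compl_avoidSign p S _ disjoint_compl_right, card_compl,
        integral_finsetSum _ fun S _ => integrable_graph p _]
      refine add_le_add (le_of_eq (by simp)) ?_
      refine (sum_le_card_nsmul _ _ _ fun v hv => integral_avoids_self_le p hv).trans_eq ?_
      rw [nsmul_eq_mul]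
    refine le_trans ?_ h2
    refine integral_mono (integrable_graph p _) (integrable_graph p _) fun G => ?_
    have h3 := one_le_prod_avoidSign (G := G) (S := S) (W := Sᶜ) disjoint_compl_right
    have h4 : ∀ v ∈ S, (0 : ℝ) ≤ if Avoids G S v then (1 : ℝ) else 0 := fun v _ => by
      split_ifs <;> norm_num
    have h5 := sum_nonneg h4
    dsimp only
    split_ifs with h
    · obtain ⟨v, -, hv⟩ := h
      rw [prod_empty]
      by_cases hvS : v ∈ S
      · have h6 := single_le_sum h4 hvS
        rw [if_pos hv] at h6
        linarith
      · linarith [two_le_prod_compl_avoidSign hvS hv]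
    · linarith
  have h2 : (1 / 2) ^ Fintype.card V * ∑ S : Finset V with 1 ≤ #S, (#S * (1 - p : ℝ) ^ (#S - 1)) ≤
      smallSum (Fintype.card V) (1 - p) := by
    rw [sum_filter_card (fun s => 1 ≤ s) fun s => (s : ℝ) * (1 - p : ℝ) ^ (s - 1), sum_card_mul_pow_pred]
    refine le_trans ?_ (single_le_sum (f := fun t : ℕ => ((Fintype.card V).choose t : ℝ) *
      ((t : ℝ) ^ 2 * ((1 + (1 - p : ℝ) ^ t) / 2) ^ (Fintype.card V - t)))
      (fun _ _ => by positivity) (mem_filter.2 ⟨mem_range.2 (by omega : 1 < _), le_rfl, by omega⟩))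
    rw [← half_pow_mul_eq (by omega : 1 ≤ Fintype.card V), Nat.choose_one_right, pow_one, pow_one,
      Nat.cast_one]
    have h3 : 0 ≤ (1 / 2) ^ Fintype.card V *
        (Fintype.card V * (1 + (1 - p : ℝ)) ^ (Fintype.card V - 1)) := by positivity
    linarith
  calc _ ≤ (1 / 2) ^ Fintype.card V * ∑ S : Finset V with 1 ≤ #S,
        (((1 + (1 - p : ℝ) ^ #S) ^ (Fintype.card V - #S) - 1) + #S * (1 - p : ℝ) ^ (#S - 1)) := by
        gcongr with S
        convert! h1 S
    _ ≤ _ := by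
        rw [sum_add_distrib, mul_add]
        linarith [sum_one_add_pow_sub_one_le hn p.2.1 p.2.2]

end AvoidMoments

/-! ### Exponential estimates for small sets. -/

section Analysis

open Finset

/-- Chernoff's bound with weight 1/32 per element: removing the weights costs at most exp(n/32)
because 32 ≤ e^4, and the weighted sum is at most (33/32)^n. -/
theorem smallCount_le (n : ℕ) : smallCount n ≤ Real.exp (n / 16) := by
  have h1 : ∀ t ∈ {t ∈ range (n + 1) | 128 * t ≤ n},
      (n.choose t : ℝ) ≤ Real.exp (n / 32) * ((1 / 32) ^ t * 1 ^ (n - t) * n.choose t) := by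
    intro t ht
    rw [mem_filter] at ht
    have h2 : (128 : ℝ) * t ≤ n := by exact_mod_cast ht.2
    have h3 : (32 : ℝ) ^ t ≤ Real.exp (n / 32) := by
      have h4 : (32 : ℝ) ≤ Real.exp 4 := by
        have := Real.exp_one_gt_d9
        have h5 : Real.exp 4 = Real.exp 1 ^ 4 := by rw [← Real.exp_nat_mul]; norm_num
        rw [h5]
        calc (32 : ℝ) ≤ 2.7 ^ 4 := by norm_num
          _ ≤ _ := by gcongr; linarith
      calc (32 : ℝ) ^ t ≤ Real.exp 4 ^ t := by gcongr
        _ = Real.exp (t * 4) := by rw [← Real.exp_nat_mul]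
        _ ≤ _ := by rw [Real.exp_le_exp]; linarith
    have h5 : (32 : ℝ) ^ t * (1 / 32) ^ t = 1 := by rw [← mul_pow]; norm_num
    calc (n.choose t : ℝ) = 32 ^ t * ((1 / 32) ^ t * 1 ^ (n - t) * n.choose t) := by
          rw [one_pow, mul_one, ← mul_assoc, h5, one_mul]
      _ ≤ _ := by gcongr
  refine (sum_le_sum h1).trans ?_
  rw [← mul_sum]
  have h2 : ∑ t ∈ range (n + 1) with 128 * t ≤ n, (1 / 32 : ℝ) ^ t * 1 ^ (n - t) * n.choose t ≤
      (1 / 32 + 1) ^ n := by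
    rw [add_pow]
    exact sum_le_sum_of_subset_of_nonneg (filter_subset _ _) fun _ _ _ => by positivity
  have h3 : (1 / 32 + 1 : ℝ) ^ n ≤ Real.exp (n / 32) := by
    calc (1 / 32 + 1 : ℝ) ^ n ≤ Real.exp (1 / 32) ^ n := by
          gcongr
          exact Real.add_one_le_exp _
      _ = _ := by rw [← Real.exp_nat_mul]; ring_nf
  calc _ ≤ Real.exp (n / 32) * Real.exp (n / 32) := by gcongr; exact h2.trans h3
    _ = _ := by rw [← Real.exp_add]; ring_nf

theorem choose_le_exp_of_small {n t : ℕ} (ht : 128 * t ≤ n) :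
    (n.choose t : ℝ) ≤ Real.exp (n / 16) := by
  refine le_trans ?_ (smallCount_le n)
  exact single_le_sum (f := fun t => (n.choose t : ℝ)) (fun _ _ => by positivity)
    (mem_filter.2 ⟨mem_range.2 (by omega), ht⟩)

/-- The left side is exp(-x/2) cosh(x/2), and cosh y ≤ exp(y²/2). -/
theorem half_one_add_exp_neg_le (x : ℝ) :
    (1 + Real.exp (-x)) / 2 ≤ Real.exp (-x / 2 + x ^ 2 / 8) := by
  have h1 : (1 + Real.exp (-x)) / 2 = Real.exp (-x / 2) * Real.cosh (x / 2) := by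
    rw [Real.cosh_eq, mul_div_assoc', mul_add, ← Real.exp_add, ← Real.exp_add]
    ring_nf
    simp [add_comm]
  rw [h1, Real.exp_add]
  gcongr
  refine (Real.cosh_le_exp_half_sq _).trans_eq ?_
  ring_nf

theorem pow_card_le_exp {p : ℝ} (hp1 : p ≤ 1) (t : ℕ) : (1 - p) ^ t ≤ Real.exp (-(p * t)) := by
  have h1 : (1 - p) ≤ Real.exp (-p) := by
    have := Real.add_one_le_exp (-p); linarith
  refine (pow_le_pow_left₀ (by linarith) h1 t).trans_eq ?_
  rw [← Real.exp_nat_mul]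
  ring_nf

theorem sq_le_two_mul_exp {x : ℝ} (hx : 0 ≤ x) : x ^ 2 ≤ 2 * Real.exp x := by
  have := Real.quadratic_le_exp_of_nonneg hx
  linarith

/-- The case `1 ≤ p t` of the bound for the terms of `smallSum`. -/
theorem small_term_le_of_one_le {n t : ℕ} {p : ℝ} (hp1 : p ≤ 1) (ht : 128 * t ≤ n)
    (hpt : 1 ≤ p * t) (hn : (n : ℝ) ^ 2 * (n + 1) * Real.exp (-(n / 20)) ≤ 1) :
    n.choose t * ((t : ℝ) ^ 2 * ((1 + (1 - p) ^ t) / 2) ^ (n - t)) ≤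
      Real.exp (-(n / 4)) / (n + 1) := by
  have hn0 : (128 : ℝ) * t ≤ n := by exact_mod_cast ht
  have h0 : 0 ≤ (1 - p) ^ t := pow_nonneg (by linarith) t
  have h1 : (1 + (1 - p) ^ t) / 2 ≤ Real.exp (-(3 / 8)) := by
    have h2 := pow_card_le_exp hp1 t
    have h3 : Real.exp (-(p * t)) ≤ Real.exp (-1) := by rw [Real.exp_le_exp]; linarith
    have h4 := half_one_add_exp_neg_le 1
    calc _ ≤ (1 + Real.exp (-1)) / 2 := by linarith
      _ ≤ _ := h4
      -- The value -3/8 is -1/2 + 1/8, from `x = 1`.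
      _ = _ := by norm_num
  have h2 : ((1 + (1 - p) ^ t) / 2) ^ (n - t) ≤ Real.exp (-(3 / 8) * (n - t)) := by
    refine (pow_le_pow_left₀ (by linarith) h1 _).trans_eq ?_
    rw [← Real.exp_nat_mul, Nat.cast_sub (by omega)]
    ring_nf
  have h3 : (t : ℝ) ^ 2 ≤ n ^ 2 := by gcongr; omega
  rw [le_div_iff₀ (by positivity)]
  calc _ ≤ Real.exp (n / 16) * (n ^ 2 * Real.exp (-(3 / 8) * (n - t))) * (n + 1) := by
        gcongr
        exact choose_le_exp_of_small ht
    _ = n ^ 2 * (n + 1) * (Real.exp (n / 16) * Real.exp (-(3 / 8) * (n - t))) := by ring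
    _ ≤ n ^ 2 * (n + 1) * (Real.exp (-(n / 20)) * Real.exp (-(n / 4))) := by
        rw [← Real.exp_add, ← Real.exp_add]
        exact mul_le_mul_of_nonneg_left (Real.exp_le_exp.2 (by linarith)) (by positivity)
    _ = n ^ 2 * (n + 1) * Real.exp (-(n / 20)) * Real.exp (-(n / 4)) := by ring
    _ ≤ 1 * Real.exp (-(n / 4)) := by gcongr
    _ = _ := one_mul _

/-- Passing from exponent `n - t` to `n` costs the term `t / 2`, as `p * t ≤ 1`. -/
theorem half_pow_le_of_le_one {n t : ℕ} {p : ℝ} (hp : 0 ≤ p) (hp1 : p ≤ 1) (ht : t ≤ n)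
    (hpt : p * t ≤ 1) :
    ((1 + (1 - p) ^ t) / 2) ^ (n - t) ≤
      Real.exp (-(n * p * t / 2) + n * p * t * (p * t) / 8 + t / 2) := by
  have h0 : 0 ≤ (1 - p) ^ t := pow_nonneg (by linarith) t
  have h1 : (1 + (1 - p) ^ t) / 2 ≤ Real.exp (-(p * t) / 2 + (p * t) ^ 2 / 8) := by
    refine le_trans ?_ (half_one_add_exp_neg_le (p * t))
    linarith [pow_card_le_exp hp1 t]
  refine (pow_le_pow_left₀ (by linarith) h1 _).trans ?_
  rw [← Real.exp_nat_mul, Nat.cast_sub ht, Real.exp_le_exp]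
  have hx : 0 ≤ p * t := by positivity
  have h2 : (t : ℝ) * (p * t / 2) ≤ t * (1 / 2) := by gcongr
  have h3 : 0 ≤ (t : ℝ) * (p * t) ^ 2 := by positivity
  nlinarith

theorem choose_le_exp_mul_log {n t : ℕ} (hn : 1 ≤ n) :
    (n.choose t : ℝ) ≤ Real.exp (t * Real.log n) := by
  rw [Real.exp_nat_mul, Real.exp_log (by exact_mod_cast hn)]
  exact_mod_cast Nat.choose_le_pow n t

theorem choose_le_exp_mul_log_sub {n t : ℕ} (hn : 1 ≤ n) (ht : 1 ≤ t) :
    (n.choose t : ℝ) ≤ Real.exp (t * (Real.log n + 1 - Real.log t)) := by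
  have h1 : (n.choose t : ℝ) ≤ n ^ t / t.factorial := Nat.choose_le_pow_div t n
  have h2 := Real.pow_div_factorial_le_exp (t : ℝ) (by positivity) t
  have ht0 : (0 : ℝ) < t := by exact_mod_cast ht
  have hn0 : (0 : ℝ) < n := by exact_mod_cast hn
  rw [Real.exp_nat_mul, Real.exp_sub, Real.exp_add, Real.exp_log hn0, Real.exp_log ht0, div_pow,
    mul_pow, ← Real.exp_nat_mul, mul_one]
  refine h1.trans ?_
  rw [div_le_iff₀ (by positivity)] at h2
  rw [div_le_div_iff₀ (by positivity) (by positivity)]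
  calc (n : ℝ) ^ t * t ^ t ≤ n ^ t * (Real.exp t * t.factorial) := by gcongr
    _ = _ := by ring

/-- The case of not too sparse graphs in the bound for the terms of `smallSum`. -/
theorem small_term_le_of_dense {n t : ℕ} {p : ℝ} (hp : 0 ≤ p) (hp1 : p ≤ 1) (hn : 1 ≤ n)
    (ht : t ≤ n) (hpt : p * t ≤ 1) (hnp : Real.log n + 5 / 2 ≤ n * p / 8) (ht1 : 1 ≤ t) :
    n.choose t * ((t : ℝ) ^ 2 * ((1 + (1 - p) ^ t) / 2) ^ (n - t)) ≤
      2 * Real.exp (-(n * p / 4)) * Real.exp (-t) := by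
  have ht1' : (1 : ℝ) ≤ t := by exact_mod_cast ht1
  have hb : 0 ≤ (1 - p) ^ t := pow_nonneg (by linarith) t
  calc _ ≤ Real.exp (t * Real.log n) * (2 * Real.exp t *
        Real.exp (-(n * p * t / 2) + n * p * t * (p * t) / 8 + t / 2)) := by
        gcongr
        · exact choose_le_exp_mul_log hn
        · exact sq_le_two_mul_exp (by positivity)
        · exact half_pow_le_of_le_one hp hp1 ht hpt
    _ = 2 * Real.exp (t * Real.log n + (t +
          (-(n * p * t / 2) + n * p * t * (p * t) / 8 + t / 2))) := by
        rw [Real.exp_add (t * _) _, Real.exp_add (t : ℝ) _]; ring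
    _ ≤ 2 * Real.exp (-(n * p / 4) + -t) := by
        refine mul_le_mul_of_nonneg_left (Real.exp_le_exp.2 ?_) zero_le_two
        have h1 : (n : ℝ) * p * t * (p * t) ≤ n * p * t * 1 := by gcongr
        have h2 : (t : ℝ) * (Real.log n + 5 / 2) ≤ t * (n * p / 8) := by gcongr
        have h3 : (n : ℝ) * p * 1 ≤ n * p * t := by gcongr
        nlinarith
    _ = _ := by rw [Real.exp_add]; ring

/-- On [1, 1/p] the concave logarithm lies above its chord, whose slope is at least (log n)/2
because `p ^ 2 * n ≤ 1`. This makes the quadratic error in the exponent payable by half of the t log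
t gained from t!. -/
theorem mul_log_le_log {n : ℕ} {p t : ℝ} (hn : 2 ≤ n) (hp : 0 < p) (hpn : p ^ 2 * n ≤ 1)
    (ht : 1 ≤ t) (hpt : p * t ≤ 1) :
    Real.log n * (p * t) / 4 ≤ Real.log t / 2 + Real.log n * p / 4 := by
  have hn0 : (2 : ℝ) ≤ n := by exact_mod_cast hn
  have hL : 0 ≤ Real.log n := Real.log_nonneg (by linarith)
  have hp1 : p < 1 := by
    by_contra h
    push Not at h
    nlinarith
  have hlogp : Real.log n / 2 ≤ Real.log (1 / p) := by
    have h1 : Real.log (p ^ 2 * n) ≤ 0 := Real.log_nonpos (by positivity) hpn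
    rw [Real.log_mul (by positivity) (by positivity), Real.log_pow] at h1
    rw [one_div, Real.log_inv]
    push_cast at h1
    linarith
  have hθ0 : 0 ≤ p * (t - 1) / (1 - p) := div_nonneg (mul_nonneg hp.le (by linarith)) (by linarith)
  have hθ1 : p * (t - 1) / (1 - p) ≤ 1 := by rw [div_le_one (by linarith)]; linarith
  have hconc := strictConcaveOn_log_Ioi.concaveOn.2 (show (1 : ℝ) ∈ Set.Ioi 0 by simp)
    (show 1 / p ∈ Set.Ioi 0 by simpa using hp) (sub_nonneg.2 hθ1) hθ0 (sub_add_cancel _ _)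
  have hval : (1 - p * (t - 1) / (1 - p)) • (1 : ℝ) + (p * (t - 1) / (1 - p)) • (1 / p) = t := by
    have : 1 - p ≠ 0 := by linarith
    simp only [smul_eq_mul]
    field_simp
    ring
  rw [hval, Real.log_one, smul_zero, zero_add, smul_eq_mul] at hconc
  have h2 : p * (t - 1) ≤ p * (t - 1) / (1 - p) := by
    rw [le_div_iff₀ (by linarith)]
    have : 0 ≤ p * (t - 1) := mul_nonneg hp.le (by linarith)
    nlinarith
  have h3 : p * (t - 1) * (Real.log n / 2) ≤ p * (t - 1) / (1 - p) * Real.log (1 / p) := by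
    gcongr
  linarith

/-- The case of sparse graphs in the bound for the terms of `smallSum`. -/
theorem small_term_le_of_sparse {n t : ℕ} {p ε : ℝ} (hp : 0 < p) (hp1 : p ≤ 1) (hn : 2 ≤ n)
    (ht : t ≤ n) (ht1 : 1 ≤ t) (hpt : p * t ≤ 1) (hpn : p ^ 2 * n ≤ 1) (hε : 0 ≤ ε)
    (hnp : n * p = (2 + ε) * Real.log n) (hL : Real.log n * p ≤ 4) :
    n.choose t * ((t : ℝ) ^ 2 * ((1 + (1 - p) ^ t) / 2) ^ (n - t)) ≤
      2 * Real.exp (-(ε * Real.log n / 4)) * (Real.exp (9 / 2 * Real.exp 9) * Real.exp (-t)) := by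
  have ht1' : (1 : ℝ) ≤ t := by exact_mod_cast ht1
  have hn0 : (2 : ℝ) ≤ n := by exact_mod_cast hn
  have hL0 : 0 ≤ Real.log n := Real.log_nonneg (by linarith)
  have hlt : 0 ≤ Real.log t := Real.log_nonneg ht1'
  have hb : 0 ≤ (1 - p) ^ t := pow_nonneg (by linarith) t
  have hlog := mul_log_le_log hn hp hpn ht1' hpt
  -- Beyond log t = 9 the bracket is nonpositive; below it `t` is bounded.
  have hcut : t * (9 / 2 - Real.log t / 2) ≤ 9 / 2 * Real.exp 9 := by
    rcases le_total 9 (Real.log t) with h | h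
    · have h1 : t * (9 / 2 - Real.log t / 2) ≤ 0 :=
        mul_nonpos_of_nonneg_of_nonpos (by positivity) (by linarith)
      have := Real.exp_pos 9
      linarith
    · have h1 : (t : ℝ) ≤ Real.exp 9 := (Real.log_le_iff_le_exp (by positivity)).1 h
      calc t * (9 / 2 - Real.log t / 2) ≤ t * (9 / 2) := by gcongr; linarith
        _ ≤ Real.exp 9 * (9 / 2) := by gcongr
        _ = _ := by ring
  calc _ ≤ Real.exp (t * (Real.log n + 1 - Real.log t)) * (2 * Real.exp t *
        Real.exp (-(n * p * t / 2) + n * p * t * (p * t) / 8 + t / 2)) := by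
        gcongr
        · exact choose_le_exp_mul_log_sub (by omega) ht1
        · exact sq_le_two_mul_exp (by positivity)
        · exact half_pow_le_of_le_one hp.le hp1 ht hpt
    _ = 2 * Real.exp (t * (Real.log n + 1 - Real.log t) + (t +
          (-(n * p * t / 2) + n * p * t * (p * t) / 8 + t / 2))) := by
        rw [Real.exp_add (t * _) _, Real.exp_add (t : ℝ) _]; ring
    _ ≤ 2 * Real.exp (-(ε * Real.log n / 4) + (9 / 2 * Real.exp 9 + -t)) := by
        refine mul_le_mul_of_nonneg_left (Real.exp_le_exp.2 ?_) zero_le_two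
        rw [hnp]
        have hεL : 0 ≤ ε * Real.log n := by positivity
        have h1 : ε * Real.log n * (p * t) ≤ ε * Real.log n * 1 := by gcongr
        have h2 : (2 + ε) * Real.log n * (p * t) / 8 ≤
            Real.log t / 2 + 1 + ε * Real.log n / 8 := by nlinarith
        -- The choice of 2 in `p` cancels the leading log n exactly, so the factor t! in the
        -- binomial coefficient must pay for the remaining constants.
        have h3 : t * (Real.log n + 1 - Real.log t + 1 - (2 + ε) * Real.log n / 2 +
            (2 + ε) * Real.log n * (p * t) / 8 + 1 / 2) ≤
            t * (7 / 2 - Real.log t / 2 - 3 * (ε * Real.log n) / 8) := by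
          gcongr
          linarith
        have h4 : 1 * (ε * Real.log n) ≤ t * (ε * Real.log n) := by gcongr
        nlinarith
    _ = _ := by rw [Real.exp_add, Real.exp_add (9 / 2 * Real.exp 9)]; ring

end Analysis

/-! ### Uniform rates for large n. -/

section Rates

open Finset

/-- The requirements on the number of vertices in the error estimates. -/
structure IsLarge (n : ℕ) : Prop where
  le_card : 256 ≤ n
  le_log : 65536 ≤ Real.log n
  log_le : Real.log n + 5 / 2 ≤ √n / 8
  poly_le : (n : ℝ) ^ 2 * (n + 1) * Real.exp (-(n / 20)) ≤ 1

theorem eventually_isLarge : ∀ᶠ n : ℕ in atTop, IsLarge n := by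
  have hcast := tendsto_natCast_atTop_atTop (R := ℝ)
  have h1 : ∀ᶠ n : ℕ in atTop, 65536 ≤ Real.log n :=
    (Real.tendsto_log_atTop.comp hcast).eventually_ge_atTop _
  have h2 : ∀ᶠ n : ℕ in atTop, Real.log n + 5 / 2 ≤ √n / 8 := by
    have h := ((isLittleO_log_rpow_atTop (r := 1 / 2) (by norm_num)).bound
      (c := 1 / 16) (by norm_num))
    filter_upwards [hcast.eventually h, h1] with n hn hl
    rw [← Real.sqrt_eq_rpow, Real.norm_of_nonneg (by linarith),
      Real.norm_of_nonneg (Real.sqrt_nonneg _)] at hn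
    linarith
  have h3 : ∀ᶠ n : ℕ in atTop, (n : ℝ) ^ 2 * (n + 1) * Real.exp (-(n / 20)) ≤ 1 := by
    have ht : Tendsto (fun n : ℕ => (n : ℝ) / 20) atTop atTop :=
      hcast.atTop_div_const (by norm_num)
    have h := (Real.tendsto_pow_mul_exp_neg_atTop_nhds_zero 3).comp ht
    have h' : ∀ᶠ n : ℕ in atTop, ((n : ℝ) / 20) ^ 3 * Real.exp (-(n / 20)) ≤ 1 / 16000 :=
      h.eventually_le_const (by norm_num)
    filter_upwards [h', eventually_ge_atTop 1] with n hn h1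
    have h1' : (1 : ℝ) ≤ n := by exact_mod_cast h1
    calc (n : ℝ) ^ 2 * (n + 1) * Real.exp (-(n / 20))
        ≤ (n : ℝ) ^ 2 * (n + n) * Real.exp (-(n / 20)) := by gcongr
      _ = 16000 * ((n / 20) ^ 3 * Real.exp (-(n / 20))) := by ring
      _ ≤ 1 := by linarith
  filter_upwards [h1, h2, h3, eventually_ge_atTop 256] with n a b c d using ⟨d, a, b, c⟩

/-- The constant in the bound for `smallSum`. -/
noncomputable def smallConst : ℝ := 1 + 4 * (1 + Real.exp (9 / 2 * Real.exp 9))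

theorem smallConst_pos : 0 < smallConst := by unfold smallConst; positivity

theorem sum_exp_neg_le (s : Finset ℕ) : ∑ t ∈ s, Real.exp (-(t : ℝ)) ≤ 2 := by
  have h : ∀ t ∈ s, Real.exp (-(t : ℝ)) ≤ (1 / 2) ^ t := by
    intro t _
    have h1 : Real.exp (-1) ≤ 1 / 2 := by
      rw [Real.exp_neg, one_div]
      have := Real.add_one_le_exp (1 : ℝ)
      gcongr
      linarith
    calc Real.exp (-(t : ℝ)) = Real.exp (-1) ^ t := by rw [← Real.exp_nat_mul]; simp
      _ ≤ _ := by gcongr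
  refine (sum_le_sum h).trans ?_
  exact (summable_geometric_two.sum_le_tsum s fun _ _ => by positivity).trans_eq tsum_geometric_two

variable {n : ℕ} {p ε : ℝ}

theorem IsLarge.mul_log_le (h : IsLarge n) (hp1 : p ≤ 1) (hp : p = (2 + ε) * Real.log n / n) :
    n * p = (2 + ε) * Real.log n ∧ ε * Real.log n ≤ n := by
  have hn : (0 : ℝ) < n := by exact_mod_cast (show 0 < n by have := h.le_card; omega)
  have hL := h.le_log
  have h1 : n * p = (2 + ε) * Real.log n := by rw [hp]; field_simp
  refine ⟨h1, ?_⟩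
  have : (n : ℝ) * p ≤ n * 1 := by gcongr
  linarith

theorem IsLarge.pos (h : IsLarge n) (hε : 0 < ε) (hp : p = (2 + ε) * Real.log n / n) : 0 < p := by
  have hn : (0 : ℝ) < n := by exact_mod_cast (show 0 < n by have := h.le_card; omega)
  have hL := h.le_log
  rw [hp]
  have : 0 < Real.log n := by linarith
  positivity

theorem IsLarge.exp_neg_le (h : IsLarge n) (hp1 : p ≤ 1) (hp : p = (2 + ε) * Real.log n / n) :
    Real.exp (-(n / 4 : ℝ)) ≤ Real.exp (-(ε * Real.log n / 4)) := by
  rw [Real.exp_le_exp]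
  have := (h.mul_log_le hp1 hp).2
  linarith

theorem IsLarge.small_term_le (h : IsLarge n) (hε : 0 < ε) (hp1 : p ≤ 1)
    (hp : p = (2 + ε) * Real.log n / n) {t : ℕ} (ht1 : 1 ≤ t) (ht : 128 * t ≤ n) :
    n.choose t * ((t : ℝ) ^ 2 * ((1 + (1 - p) ^ t) / 2) ^ (n - t)) ≤
      Real.exp (-(ε * Real.log n / 4)) *
        (1 / (n + 1) + 2 * (1 + Real.exp (9 / 2 * Real.exp 9)) * Real.exp (-t)) := by
  obtain ⟨hnp, hεn⟩ := h.mul_log_le hp1 hp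
  have hE := h.exp_neg_le hp1 hp
  have hp0 := h.pos hε hp
  have hn256 := h.le_card
  have hn0 : (0 : ℝ) < n := by exact_mod_cast (show 0 < n by omega)
  have hL := h.le_log
  have hLs := h.log_le
  have hs : √(n : ℝ) * √n = n := Real.mul_self_sqrt hn0.le
  have hs0 : 0 < √(n : ℝ) := Real.sqrt_pos.2 hn0
  set E := Real.exp (-(ε * Real.log n / 4)) with hEdef
  have hE0 : 0 < E := Real.exp_pos _
  set B := Real.exp (9 / 2 * Real.exp 9) with hB
  have hB0 : 0 < B := Real.exp_pos _
  have he0 := Real.exp_pos (-(t : ℝ))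
  rcases le_total 1 (p * t) with hpt | hpt
  · refine (small_term_le_of_one_le hp1 ht hpt h.poly_le).trans ?_
    rw [mul_add, mul_one_div]
    have h1 : Real.exp (-(n / 4 : ℝ)) / (n + 1) ≤ E / (n + 1) := by gcongr
    have h2 : 0 ≤ E * (2 * (1 + B) * Real.exp (-t)) := by positivity
    linarith
  · have h3 : 0 ≤ E * (1 / (n + 1)) := by positivity
    have h5 : 0 ≤ E * Real.exp (-t) := by positivity
    have h6 : 0 ≤ E * Real.exp (-t) * B := by positivity
    -- In the dense case np ≥ √n dominates log n; in the sparse case p ≤ 1/√n, as the chord argument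
    -- requires.
    rcases le_total 1 (p ^ 2 * n) with hpn | hpn
    · have h4 : √(n : ℝ) ≤ n * p := by
        rw [Real.sqrt_le_left (by positivity)]
        nlinarith
      refine (small_term_le_of_dense hp0.le hp1 (by omega) (by omega) hpt (by linarith)
        ht1).trans ?_
      have h7 : Real.exp (-(n * p / 4)) ≤ E := by
        rw [hEdef, Real.exp_le_exp]
        linarith
      have h8 : Real.exp (-(n * p / 4)) * Real.exp (-t) ≤ E * Real.exp (-t) := by gcongr
      linarith
    · have hLp : Real.log n * p ≤ 4 := by
        have h9 : p * √n ≤ 1 := by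
          have : (p * √n) ^ 2 ≤ 1 := by rw [mul_pow, Real.sq_sqrt hn0.le]; exact hpn
          exact (sq_le_one_iff₀ (by positivity)).1 this
        have h10 : Real.log n * p ≤ √n * p := by gcongr; linarith
        linarith
      refine (small_term_le_of_sparse hp0 hp1 (by omega) (by omega) ht1 hpt hpn hε.le hnp
        hLp).trans ?_
      linarith

theorem IsLarge.smallSum_le (h : IsLarge n) (hε : 0 < ε) (hp1 : p ≤ 1)
    (hp : p = (2 + ε) * Real.log n / n) :
    smallSum n (1 - p) ≤ smallConst * Real.exp (-(ε * Real.log n / 4)) := by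
  unfold smallSum smallConst
  set E := Real.exp (-(ε * Real.log n / 4)) with hEdef
  set B := Real.exp (9 / 2 * Real.exp 9) with hB
  calc _ ≤ ∑ t ∈ range (n + 1) with 1 ≤ t ∧ 128 * t ≤ n,
        E * (1 / (n + 1) + 2 * (1 + B) * Real.exp (-(t : ℝ))) := by
        refine sum_le_sum fun t ht => ?_
        rw [mem_filter] at ht
        exact h.small_term_le hε hp1 hp ht.2.1 ht.2.2
    _ ≤ ∑ t ∈ range (n + 1), E * (1 / (n + 1) + 2 * (1 + B) * Real.exp (-(t : ℝ))) :=
        sum_le_sum_of_subset_of_nonneg (filter_subset _ _) fun _ _ _ => by positivity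
    _ = E * (1 + 2 * (1 + B) * ∑ t ∈ range (n + 1), Real.exp (-(t : ℝ))) := by
        rw [← mul_sum, sum_add_distrib, ← mul_sum, sum_const, card_range, nsmul_eq_mul]
        push_cast
        rw [mul_one_div_cancel (by positivity)]
    _ ≤ E * (1 + 2 * (1 + B) * 2) := by
        gcongr
        exact sum_exp_neg_le _
    _ = _ := by ring

theorem largeBound_nonneg (n : ℕ) (p : ℝ) : 0 ≤ largeBound n p := by
  unfold largeBound; positivity

theorem IsLarge.mul_largeBound_le (h : IsLarge n) (hε : 0 < ε) (hp1 : p ≤ 1)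
    (hp : p = (2 + ε) * Real.log n / n) : n * largeBound n p ≤ Real.exp (-(n / 4 : ℝ)) := by
  obtain ⟨hnp, -⟩ := h.mul_log_le hp1 hp
  have hL := h.le_log
  have hn1 : (1 : ℝ) ≤ n := by exact_mod_cast (show 1 ≤ n by have := h.le_card; omega)
  have h1 : (2 : ℝ) ^ n ≤ Real.exp n := by
    have := Real.add_one_le_exp (1 : ℝ)
    calc (2 : ℝ) ^ n ≤ Real.exp 1 ^ n := by gcongr; linarith
      _ = _ := by rw [← Real.exp_nat_mul, mul_one]
  -- The threshold 65536 for log n is chosen so that the exponent in `largeBound` beats 2^n with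
  -- exp(-n) to spare.
  have h2 : 2 * n ≤ p * n ^ 2 / 65536 := by
    have h3 : 65536 * 2 ≤ n * p := by rw [hnp]; nlinarith
    have h4 : (65536 * 2) * n ≤ (n * p) * n := by gcongr
    nlinarith
  have h5 : largeBound n p ≤ Real.exp (-n) := by
    unfold largeBound
    calc _ ≤ Real.exp n * Real.exp (-(2 * n)) := by gcongr
      _ = _ := by rw [← Real.exp_add]; ring_nf
  have h6 : (n : ℝ) * Real.exp (-(n / 20)) ≤ 1 := by
    refine le_trans ?_ h.poly_le
    gcongr
    nlinarith
  calc _ ≤ (n : ℝ) * Real.exp (-n) := by gcongr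
    _ = n * Real.exp (-(n / 20)) * Real.exp (-(19 * n / 20)) := by
      rw [mul_assoc, ← Real.exp_add]; ring_nf
    _ ≤ 1 * Real.exp (-(n / 4 : ℝ)) :=
        mul_le_mul h6 (Real.exp_le_exp.2 (by linarith)) (Real.exp_pos _).le zero_le_one
    _ = _ := one_mul _

theorem half_pow_le_exp (n : ℕ) : (1 / 2 : ℝ) ^ n ≤ Real.exp (-(n / 4 : ℝ)) := by
  calc (1 / 2 : ℝ) ^ n ≤ Real.exp (-(1 / 4)) ^ n := by
        gcongr
        have := Real.add_one_le_exp (-(1 / 4) : ℝ)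
        linarith
    _ = _ := by rw [← Real.exp_nat_mul]; ring_nf

/-- The bound for the total variation distance given the graph. -/
noncomputable def tvBound {V : Type*} [Fintype V] [DecidableEq V] (G : SimpleGraph V) : ℝ :=
  4 * ((1 / 2) ^ Fintype.card V + avoidMoment G ∅ univ) + 4 * avoidMoment G univ univ

end Rates

/-! ### Total variation on most fixed graphs. -/

section FixedGraph

open Finset

theorem secondMoment_empty {V : Type*} [Fintype V] [DecidableEq V] (G : SimpleGraph V) :
    secondMoment G ∅ = 1 := by
  simp [secondMoment]

theorem avoidMoment_nonneg {V : Type*} [Fintype V] [DecidableEq V] (G : SimpleGraph V)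
    (U M : Finset V) : 0 ≤ avoidMoment G U M := by
  unfold avoidMoment
  exact mul_nonneg (by positivity)
    (sum_nonneg fun S _ => prod_nonneg fun v _ => one_add_avoidSign_nonneg S v)

theorem tvBound_nonneg {V : Type*} [Fintype V] [DecidableEq V] (G : SimpleGraph V) :
    0 ≤ tvBound G := by
  have h1 := avoidMoment_nonneg G ∅ univ
  have h2 := avoidMoment_nonneg G univ univ
  unfold tvBound
  positivity

/-- With every player in `M` there is no fluctuation: the second moment is exactly 1, and the free
parameter `δ` can be sent to 0. -/
theorem tvDist_pneLaw_le_tvBound {V : Type*} [Fintype V] [DecidableEq V] [Nonempty V]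
    (G : SimpleGraph V) (μ : Measure ℝ) [IsProbabilityMeasure μ] [NullSingletonClass μ] :
    tvDist (pneLaw μ G) (poissonMeasure 1) ≤ tvBound G := by
  refine le_of_forall_pos_le_add fun δ hδ => ?_
  refine (tvDist_pneLaw_le μ (M := univ) univ_nonempty hδ).trans_eq ?_
  rw [steinError, tvBound, compl_univ, secondMoment_empty, card_univ]
  ring

theorem tvDist_le_one (P Q : Measure ℕ) [IsProbabilityMeasure P] [IsProbabilityMeasure Q] :
    tvDist P Q ≤ 1 := by
  obtain ⟨h, hh, heq⟩ := tsum_abs_sub_eq_integral_sub P Q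
  have hb : ∀ ν : Measure ℕ, IsProbabilityMeasure ν → |∫ i, h i ∂ν| ≤ 1 := fun ν _ => by
    have := norm_integral_le_of_norm_le_const (μ := ν) (f := h) (C := 1) (ae_of_all _ hh)
    simpa using this
  have h1 := abs_le.1 (hb P inferInstance)
  have h2 := abs_le.1 (hb Q inferInstance)
  rw [tvDist, heq]
  linarith

variable {n : ℕ} {p : unitInterval} {ε : ℝ}

theorem IsLarge.integral_tvBound_le (h : IsLarge n) (hε : 0 < ε)
    (hp : (p : ℝ) = (2 + ε) * Real.log n / n) :
    ∫ G, tvBound G ∂SimpleGraph.binomialRandom (Fin n) p ≤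
      (16 + 28 * smallConst) * Real.exp (-(ε * Real.log n / 4)) := by
  have hcard : 256 ≤ Fintype.card (Fin n) := by simpa using h.le_card
  have h1 := integral_avoidMoment_univ_le (V := Fin n) hcard p
  have h2 := integral_avoidMoment_empty_le (V := Fin n) hcard p
  have h3 := h.smallSum_le hε p.2.2 hp
  have h4 := h.exp_neg_le p.2.2 hp
  have h5 := h.mul_largeBound_le hε p.2.2 hp
  have h6 := half_pow_le_exp n
  unfold tvBound
  simp only [Fintype.card_fin] at *
  rw [integral_add (integrable_graph _ _) (integrable_graph _ _), integral_const_mul,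
    integral_const_mul, integral_add (integrable_graph _ _) (integrable_graph _ _),
    integral_const, probReal_univ, one_smul]
  linarith

/-- Markov's inequality at the square root of the mean rate. For `n < N` the constant exp(N/8) makes
the bound at least 1, hence trivial. -/
theorem tvDist_pneLaw_tail {N : ℕ} (hN : ∀ n, N ≤ n → IsLarge n) (μ : Measure ℝ)
    [IsProbabilityMeasure μ] [NullSingletonClass μ] (hn : 1 ≤ n) (hε : 0 < ε)
    (hp : (p : ℝ) = (2 + ε) * Real.log n / n) :
    1 - (n : ℝ) ^ (-ε / 8) ≤ (SimpleGraph.binomialRandom (Fin n) p).real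
      {G | tvDist (pneLaw μ G) (poissonMeasure 1) ≤
        (16 + 28 * smallConst + Real.exp (N / 8)) * (n : ℝ) ^ (-ε / 8)} := by
  have hn0 : (0 : ℝ) < n := by exact_mod_cast hn
  have hL : 0 ≤ Real.log n := Real.log_natCast_nonneg n
  have hK := smallConst_pos
  have : Nonempty (Fin n) := ⟨⟨0, hn⟩⟩
  have hX : (n : ℝ) ^ (-ε / 8) = Real.exp (-(ε * Real.log n / 8)) := by
    rw [Real.rpow_def_of_pos hn0]; ring_nf
  rw [hX]
  set X := Real.exp (-(ε * Real.log n / 8)) with hXdef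
  have hX0 : 0 < X := Real.exp_pos _
  set D := 16 + 28 * smallConst with hD
  have hD0 : 0 < D := by positivity
  have hprob : ∀ G : SimpleGraph (Fin n), IsProbabilityMeasure (pneLaw μ G) := fun G =>
    Measure.isProbabilityMeasure_map (measurable_numPNE G).aemeasurable
  rcases lt_or_ge n N with hnN | hnN
  · have h1 : 1 ≤ (D + Real.exp (N / 8)) * X := by
      -- The constraint p ≤ 1 keeps n^(-ε/8) above exp(-n/8).
      have h2 : ε * Real.log n ≤ n := by
        have h3 : (2 + ε) * Real.log n / n ≤ 1 := hp ▸ p.2.2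
        rw [div_le_one hn0] at h3
        linarith
      have h4 : (n : ℝ) ≤ N := by exact_mod_cast hnN.le
      calc 1 = Real.exp (N / 8) * Real.exp (-(N / 8)) := by rw [← Real.exp_add]; simp
        _ ≤ (D + Real.exp (N / 8)) * X := by
          gcongr
          · linarith
          · rw [hXdef, Real.exp_le_exp]
            linarith
    have huniv : {G : SimpleGraph (Fin n) | tvDist (pneLaw μ G) (poissonMeasure 1) ≤
        (D + Real.exp (N / 8)) * X} = Set.univ :=
      Set.eq_univ_of_forall fun G => (tvDist_le_one _ _).trans h1
    rw [huniv, probReal_univ]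
    linarith
  · have hint := (hN n hnN).integral_tvBound_le hε hp
    have hmarkov := mul_meas_ge_le_integral_of_nonneg
      (μ := SimpleGraph.binomialRandom (Fin n) p) (f := fun G => tvBound G)
      (ae_of_all _ fun G => tvBound_nonneg G) (integrable_graph _ _) (D * X)
    have hXX : Real.exp (-(ε * Real.log n / 4)) = X * X := by
      rw [hXdef, ← Real.exp_add]; ring_nf
    rw [hXX] at hint
    have htail : (SimpleGraph.binomialRandom (Fin n) p).real {G | D * X ≤ tvBound G} ≤ X := by
      refine le_of_mul_le_mul_left (hmarkov.trans (hint.trans_eq ?_)) (mul_pos hD0 hX0)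
      ring
    have hcompl : (SimpleGraph.binomialRandom (Fin n) p).real {G | D * X ≤ tvBound G}ᶜ =
        1 - (SimpleGraph.binomialRandom (Fin n) p).real {G | D * X ≤ tvBound G} :=
      probReal_compl_eq_one_sub (measurableSet_setOfPred.2 (SimpleGraph.measurable_of_finite _))
    calc 1 - X ≤ (SimpleGraph.binomialRandom (Fin n) p).real {G | D * X ≤ tvBound G}ᶜ := by
          rw [hcompl]; linarith
      _ ≤ _ := by
          refine measureReal_mono fun G hG => ?_
          have hG' : tvBound G < D * X := not_le.1 hG
          have h7 : 0 < Real.exp (N / 8 : ℝ) * X := by positivity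
          have h8 := tvDist_pneLaw_le_tvBound G μ
          have h9 : tvDist (pneLaw μ G) (poissonMeasure 1) ≤ (D + Real.exp (N / 8)) * X := by
            linarith
          exact h9

end FixedGraph

/-! ### Convergence in distribution for the random graph game. -/

section RandomGraph

open Finset

theorem measurable_sigma_iff {ι α : Type*} {X : ι → Type*} [∀ i, MeasurableSpace (X i)]
    [MeasurableSpace α] {f : (Σ i, X i) → α} (hf : ∀ i, Measurable fun x => f ⟨i, x⟩) :
    Measurable f := fun _ hs => MeasurableSpace.measurableSet_iInf.2 fun i => hf i hs

theorem measurable_numPNE_game {V : Type*} [Finite V] :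
    Measurable fun g : GraphicalGame V => numPNE g.2 :=
  measurable_sigma_iff fun G => measurable_numPNE G

theorem integral_randomGameLaw {V : Type*} [Finite V] (μ : Measure ℝ) [IsProbabilityMeasure μ]
    (p : unitInterval) {h : ℕ → ℝ} (hh : ∀ k, |h k| ≤ 1) :
    ∫ g, h (numPNE g.2) ∂randomGameLaw V μ p =
      ∫ G, ∫ u, h (numPNE u) ∂payoffLaw μ G ∂SimpleGraph.binomialRandom V p := by
  have hm : Measurable fun g : GraphicalGame V => h (numPNE g.2) :=
    (measurable_of_countable h).comp measurable_numPNE_game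
  let κ : Kernel (SimpleGraph V) (GraphicalGame V) :=
    ⟨fun G => (payoffLaw μ G).map (Sigma.mk G), SimpleGraph.measurable_of_finite _⟩
  have hκ : randomGameLaw V μ p = (κ ∘ₖ Kernel.const Unit (SimpleGraph.binomialRandom V p)) () :=
    Measure.comp_eq_comp_const_apply (κ := κ)
  have hi : Integrable (fun g => h (numPNE g.2)) (randomGameLaw V μ p) :=
    Integrable.of_bound hm.aestronglyMeasurable 1 (ae_of_all _ fun _ => hh _)
  rw [hκ] at hi ⊢
  rw [Kernel.integral_comp hi, Kernel.const_apply]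
  refine integral_congr_ae (ae_of_all _ fun G => ?_)
  exact integral_map (measurable_sigma_mk G).aemeasurable hm.aestronglyMeasurable

theorem abs_integral_randomGameLaw_sub_le {V : Type*} [Fintype V] [DecidableEq V] (μ : Measure ℝ)
    [IsProbabilityMeasure μ] [NullSingletonClass μ] (p : unitInterval) {M : Finset V}
    (hM : M.Nonempty) {δ : ℝ} (hδ : 0 < δ) {h : ℕ → ℝ} (hh : ∀ k, |h k| ≤ 1) :
    |∫ g, h (numPNE g.2) ∂randomGameLaw V μ p - ∫ i, h i ∂poissonMeasure 1| ≤
      ∫ G, steinError G M δ ∂SimpleGraph.binomialRandom V p := by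
  have hc : ∫ i, h i ∂poissonMeasure 1 =
      ∫ _ : SimpleGraph V, ∫ i, h i ∂poissonMeasure 1 ∂SimpleGraph.binomialRandom V p := by
    rw [integral_const, probReal_univ, one_smul]
  rw [integral_randomGameLaw μ p hh, hc,
    ← integral_sub (integrable_graph _ _) (integrable_const _)]
  refine (abs_integral_le_integral_abs).trans ?_
  exact integral_mono (integrable_graph _ _) (integrable_graph _ _) fun G =>
    abs_integral_numPNE_sub_le μ hM hδ hh

/-- The bound for the expectation of `steinError` in terms of `p * smallSum n (1 - p)`,
`smallSum n (1 - p) / n`, `largeBound n p`, the contribution of the pairs of small sets and of the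
sets which do not meet `M`. -/
noncomputable def meanSteinBound (m : ℕ) (δ a s l c r : ℝ) : ℝ :=
  4 * (δ / 2 + (2 * a + l + (1 / 2) ^ m + c + 2 ^ m * r) / (2 * δ)) +
    8 * ((1 / 2) ^ m + (a + 2 ^ m * r + m * (3 * (s + l)))) +
    8 * (a + 2 ^ m * r + m * (3 * (s + l)))

theorem integral_steinError_le {n : ℕ} (hn : 256 ≤ n) (p : unitInterval) (M : Finset (Fin n))
    {δ : ℝ} (hδ : 0 < δ) :
    ∫ G, steinError G M δ ∂SimpleGraph.binomialRandom (Fin n) p ≤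
      meanSteinBound #M δ (p * smallSum n (1 - p)) (smallSum n (1 - p) / n) (largeBound n p)
        ((1 / 2) ^ n * smallCount n ^ 2) (((1 + (1 - p : ℝ)) / 2) ^ (n - #M)) := by
  have hcard : 256 ≤ Fintype.card (Fin n) := by simpa using hn
  have h1 := integral_secondMoment_sub_one_le (V := Fin n) hcard p M
  have h2 := integral_avoidMoment_le (V := Fin n) hcard p (U := Mᶜ) (M := M) subset_rfl
  have h3 := integral_avoidMoment_le (V := Fin n) hcard p (U := univ) (M := M) (subset_univ _)
  simp only [Fintype.card_fin] at h1 h2 h3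
  unfold steinError meanSteinBound
  rw [integral_add (integrable_graph _ _) (integrable_graph _ _),
    integral_add (integrable_graph _ _) (integrable_graph _ _), integral_const_mul,
    integral_const_mul, integral_const_mul,
    integral_add (integrable_graph _ _) (integrable_graph _ _),
    integral_add (integrable_graph _ _) (integrable_graph _ _)]
  simp only [integral_div]
  rw [integral_sub (integrable_graph _ _) (integrable_graph _ _)]
  simp only [integral_const, probReal_univ, one_smul]
  norm_num only
  gcongr

theorem tendsto_meanSteinBound {m : ℕ} {δ : ℝ} {a s l c r : ℕ → ℝ} (ha : Tendsto a atTop (𝓝 0))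
    (hs : Tendsto s atTop (𝓝 0)) (hl : Tendsto l atTop (𝓝 0)) (hc : Tendsto c atTop (𝓝 0))
    (hr : Tendsto r atTop (𝓝 0)) :
    Tendsto (fun n => meanSteinBound m δ (a n) (s n) (l n) (c n) (r n)) atTop
      (𝓝 (4 * (δ / 2 + (1 / 2) ^ m / (2 * δ)) + 8 * (1 / 2) ^ m)) := by
  have hcont : Continuous fun x : ℝ × ℝ × ℝ × ℝ × ℝ =>
      meanSteinBound m δ x.1 x.2.1 x.2.2.1 x.2.2.2.1 x.2.2.2.2 := by
    unfold meanSteinBound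
    fun_prop
  have := (hcont.tendsto (0, 0, 0, 0, 0)).comp
    (ha.prodMk_nhds (hs.prodMk_nhds (hl.prodMk_nhds (hc.prodMk_nhds hr))))
  simpa [meanSteinBound, Function.comp_def] using this

theorem tendsto_exp_neg_div {c : ℝ} (hc : 0 < c) :
    Tendsto (fun n : ℕ => Real.exp (-(n / c : ℝ))) atTop (𝓝 0) :=
  Real.tendsto_exp_neg_atTop_nhds_zero.comp
    ((tendsto_natCast_atTop_atTop (R := ℝ)).atTop_div_const hc)

theorem tendsto_half_pow_mul_smallCount_sq :
    Tendsto (fun n => (1 / 2 : ℝ) ^ n * smallCount n ^ 2) atTop (𝓝 0) := by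
  refine squeeze_zero (fun n => by positivity) (fun n => ?_)
    (tendsto_exp_neg_div (c := 8) (by norm_num))
  have h0 : 0 ≤ smallCount n := sum_nonneg fun _ _ => by positivity
  calc (1 / 2 : ℝ) ^ n * smallCount n ^ 2 ≤ Real.exp (-(n / 4 : ℝ)) * Real.exp (n / 16) ^ 2 := by
        gcongr
        · exact half_pow_le_exp n
        · exact smallCount_le n
    _ = _ := by rw [← Real.exp_nat_mul, ← Real.exp_add]; push_cast; ring_nf

variable {p : ℕ → unitInterval} {ε : ℕ → ℝ}

/-- Uniform in `ε`: np may contain a large ε log n, but the factor exp(-ε log n / 4) keeps its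
contribution bounded, leaving O((log n)/n). -/
theorem tendsto_mul_smallSum (hε : ∀ᶠ n in atTop, 0 < ε n)
    (hp : ∀ᶠ n : ℕ in atTop, (p n : ℝ) = (2 + ε n) * Real.log n / n) :
    Tendsto (fun n => p n * smallSum n (1 - p n)) atTop (𝓝 0) := by
  have hlim : Tendsto (fun n : ℕ => smallConst * (2 * (Real.log n / n) + 4 / n)) atTop (𝓝 0) := by
    have h1 : Tendsto (fun n : ℕ => Real.log n / n) atTop (𝓝 0) :=
      (Real.isLittleO_log_id_atTop.tendsto_div_nhds_zero).comp tendsto_natCast_atTop_atTop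
    simpa using ((h1.const_mul 2).add (tendsto_const_div_atTop_nhds_zero_nat 4)).const_mul
      smallConst
  refine squeeze_zero' (Eventually.of_forall fun n =>
    mul_nonneg (p n).2.1 (smallSum_nonneg n (by linarith [(p n).2.2]))) ?_ hlim
  filter_upwards [hε, hp, eventually_isLarge] with n hε hp h
  have hL := h.le_log
  have hK := smallConst_pos
  set L := Real.log n
  calc p n * smallSum n (1 - p n) ≤ p n * (smallConst * Real.exp (-(ε n * L / 4))) := by
        gcongr
        · exact (p n).2.1
        · exact h.smallSum_le hε (p n).2.2 hp
    _ = smallConst * ((2 * L * Real.exp (-(ε n * L / 4)) +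
          4 * (ε n * L / 4 * Real.exp (-(ε n * L / 4)))) / n) := by rw [hp]; ring
    _ ≤ smallConst * ((2 * L * 1 + 4 * 1) / n) := by
        have h1 : 0 ≤ ε n * L / 4 := by positivity
        have h2 : ε n * L / 4 * Real.exp (-(ε n * L / 4)) ≤ 1 := by
          rw [Real.exp_neg, ← div_eq_mul_inv, div_le_one (Real.exp_pos _)]
          linarith [Real.add_one_le_exp (ε n * L / 4)]
        have h3 : Real.exp (-(ε n * L / 4)) ≤ 1 := Real.exp_le_one_iff.2 (by linarith)
        gcongr
    _ = _ := by ring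

theorem tendsto_smallSum_div (hε : ∀ᶠ n in atTop, 0 < ε n)
    (hp : ∀ᶠ n : ℕ in atTop, (p n : ℝ) = (2 + ε n) * Real.log n / n) :
    Tendsto (fun n : ℕ => smallSum n (1 - p n) / n) atTop (𝓝 0) := by
  refine squeeze_zero' (Eventually.of_forall fun n =>
    div_nonneg (smallSum_nonneg n (by linarith [(p n).2.2])) n.cast_nonneg) ?_
    (tendsto_const_div_atTop_nhds_zero_nat smallConst)
  filter_upwards [hε, hp, eventually_isLarge] with n hε hp h
  have hL := h.le_log
  have hK := smallConst_pos
  gcongr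
  refine (h.smallSum_le hε (p n).2.2 hp).trans (mul_le_of_le_one_right hK.le ?_)
  have : 0 ≤ ε n * Real.log n / 4 := by positivity
  exact Real.exp_le_one_iff.2 (by linarith)

theorem tendsto_largeBound (hε : ∀ᶠ n in atTop, 0 < ε n)
    (hp : ∀ᶠ n : ℕ in atTop, (p n : ℝ) = (2 + ε n) * Real.log n / n) :
    Tendsto (fun n => largeBound n (p n)) atTop (𝓝 0) := by
  refine squeeze_zero' (Eventually.of_forall fun n => largeBound_nonneg n _) ?_
    (tendsto_exp_neg_div (c := 4) (by norm_num))
  filter_upwards [hε, hp, eventually_isLarge] with n hε hp h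
  refine le_trans ?_ (h.mul_largeBound_le hε (p n).2.2 hp)
  have h1 : (1 : ℝ) ≤ n := by exact_mod_cast (show 1 ≤ n by have := h.le_card; omega)
  exact le_mul_of_one_le_left (largeBound_nonneg n _) h1

theorem tendsto_half_add_pow (hε : ∀ᶠ n in atTop, 0 < ε n)
    (hp : ∀ᶠ n : ℕ in atTop, (p n : ℝ) = (2 + ε n) * Real.log n / n) (m : ℕ) :
    Tendsto (fun n => ((1 + (1 - p n : ℝ)) / 2) ^ (n - m)) atTop (𝓝 0) := by
  have hlim : Tendsto (fun n : ℕ => Real.exp (-(Real.log n / 2))) atTop (𝓝 0) :=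
    Real.tendsto_exp_neg_atTop_nhds_zero.comp
      ((Real.tendsto_log_atTop.comp tendsto_natCast_atTop_atTop).atTop_div_const (by norm_num))
  have h0 : ∀ n, 0 ≤ (1 + (1 - p n : ℝ)) / 2 := fun n => by linarith [(p n).2.2]
  refine squeeze_zero' (Eventually.of_forall fun n => pow_nonneg (h0 n) _) ?_ hlim
  filter_upwards [hε, hp, eventually_isLarge, eventually_ge_atTop (2 * m)] with n hε hp h hm
  have hL := h.le_log
  obtain ⟨hnp, -⟩ := h.mul_log_le (p n).2.2 hp
  have h1 : (1 + (1 - p n : ℝ)) / 2 ≤ Real.exp (-(p n / 2)) := by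
    have := Real.add_one_le_exp (-(p n / 2) : ℝ)
    linarith
  refine (pow_le_pow_left₀ (h0 n) h1 _).trans ?_
  rw [← Real.exp_nat_mul, Real.exp_le_exp, Nat.cast_sub (by omega)]
  have h2 : 2 * (m : ℝ) ≤ n := by exact_mod_cast hm
  have h3 : (p n : ℝ) * (n / 2) ≤ p n * (n - m) :=
    mul_le_mul_of_nonneg_left (by linarith) (p n).2.1
  have h4 : 0 < ε n * Real.log n := by positivity
  linarith

theorem tendsto_integral_randomGameLaw (hε : ∀ᶠ n in atTop, 0 < ε n)
    (hp : ∀ᶠ n : ℕ in atTop, (p n : ℝ) = (2 + ε n) * Real.log n / n) (μ : Measure ℝ)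
    [IsProbabilityMeasure μ] [NullSingletonClass μ] {h : ℕ → ℝ} (hh : ∀ k, |h k| ≤ 1) :
    Tendsto (fun n => ∫ g, h (numPNE g.2) ∂randomGameLaw (Fin n) μ (p n)) atTop
      (𝓝 (∫ i, h i ∂poissonMeasure 1)) := by
  rw [Metric.tendsto_nhds]
  intro η hη
  have hδ : 0 < η / 4 := by positivity
  have hlim : Tendsto (fun m : ℕ => 4 * (η / 4 / 2 + (1 / 2 : ℝ) ^ m / (2 * (η / 4))) +
      8 * (1 / 2) ^ m) atTop (𝓝 (4 * (η / 4 / 2 + 0 / (2 * (η / 4))) + 8 * 0)) := by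
    have h1 : Tendsto (fun m : ℕ => (1 / 2 : ℝ) ^ m) atTop (𝓝 0) :=
      tendsto_pow_atTop_nhds_zero_of_lt_one (by norm_num) (by norm_num)
    exact (((h1.div_const _).const_add _).const_mul 4).add (h1.const_mul 8)
  -- With `δ = η / 4` the δ-term is η/2, so a large fixed `m` brings the limit in n below η.
  obtain ⟨m, hm, hm1⟩ := ((hlim.eventually_lt_const (u := η) (by
    ring_nf; linarith)).and (eventually_ge_atTop 1)).exists
  have hbound := (tendsto_meanSteinBound (m := m) (δ := η / 4) (tendsto_mul_smallSum hε hp)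
    (tendsto_smallSum_div hε hp) (tendsto_largeBound hε hp) tendsto_half_pow_mul_smallCount_sq
    (tendsto_half_add_pow hε hp m)).eventually_lt_const hm
  filter_upwards [hbound, eventually_ge_atTop 256, eventually_ge_atTop m] with n hn hn256 hnm
  obtain ⟨M, -, hM⟩ := exists_subset_card_eq (s := (univ : Finset (Fin n))) (n := m) (by simpa)
  have hM0 : M.Nonempty := card_pos.1 (by omega)
  rw [Real.dist_eq]
  have h2 := integral_steinError_le hn256 (p n) M hδ
  rw [hM] at h2
  exact (abs_integral_randomGameLaw_sub_le μ (p n) hM0 hδ hh).trans_lt (h2.trans_lt hn)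

theorem tendstoInDistribution_numPNE (hε : ∀ᶠ n in atTop, 0 < ε n)
    (hp : ∀ᶠ n : ℕ in atTop, (p n : ℝ) = (2 + ε n) * Real.log n / n) (μ : Measure ℝ)
    [IsProbabilityMeasure μ] [NullSingletonClass μ] :
    TendstoInDistribution (fun (n : ℕ) (g : GraphicalGame (Fin n)) => numPNE g.2) atTop
      (id : ℕ → ℕ) (fun n => randomGameLaw (Fin n) μ (p n)) (poissonMeasure 1) := by
  refine ⟨fun n => measurable_numPNE_game.aemeasurable, aemeasurable_id, ?_⟩
  refine ProbabilityMeasure.tendsto_iff_forall_integral_tendsto.2 fun f => ?_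
  have hC : 0 < ‖f‖ + 1 := by positivity
  have hh : ∀ k, |f k / (‖f‖ + 1)| ≤ 1 := fun k => by
    rw [abs_div, abs_of_pos hC, div_le_one hC]
    have := f.norm_coe_le_norm k
    rw [Real.norm_eq_abs] at this
    linarith
  have key := (tendsto_integral_randomGameLaw hε hp μ hh).mul_const (‖f‖ + 1)
  simp only [integral_div, div_mul_cancel₀ _ hC.ne'] at key
  have hmap : ∀ n, ∫ k, f k ∂(randomGameLaw (Fin n) μ (p n)).map
      (fun g : GraphicalGame (Fin n) => numPNE g.2) =
      ∫ g, f (numPNE g.2) ∂randomGameLaw (Fin n) μ (p n) := fun n =>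
    integral_map measurable_numPNE_game.aemeasurable
      (measurable_of_countable _).aestronglyMeasurable
  simpa [hmap] using key

end RandomGraph

theorem theorem1 :
    (∀ (μ : Measure ℝ) [IsProbabilityMeasure μ] [NullSingletonClass μ] (ε : ℕ → ℝ) (p : ℕ → unitInterval),
      (∀ᶠ n in atTop, 0 < ε n) →
      (∀ᶠ n : ℕ in atTop, (p n : ℝ) = (2 + ε n) * Real.log n / n) →
      TendstoInDistribution (fun (n : ℕ) (g : GraphicalGame (Fin n)) => numPNE g.2) atTop
        (id : ℕ → ℕ) (fun n => randomGameLaw (Fin n) μ (p n)) (poissonMeasure 1)) ∧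
    ∃ C c : ℝ, 0 < C ∧ 0 < c ∧
      ∀ (μ : Measure ℝ) [IsProbabilityMeasure μ] [NullSingletonClass μ] (n : ℕ) (ε : ℝ) (p : unitInterval),
        1 ≤ n → 0 < ε → (p : ℝ) = (2 + ε) * Real.log n / n →
        1 - (n : ℝ) ^ (-ε / 8) - (2 : ℝ) ^ (-(n : ℝ)) ≤
          (SimpleGraph.binomialRandom (Fin n) p).real
            {G | tvDist (pneLaw μ G) (poissonMeasure 1) ≤
              C * (n : ℝ) ^ (-ε / 8) + Real.exp (-c * n)} := by
  refine ⟨fun μ _ _ ε p hε hp => tendstoInDistribution_numPNE hε hp μ, ?_⟩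
  obtain ⟨N, hN⟩ := eventually_atTop.1 eventually_isLarge
  have hK := smallConst_pos
  -- The power of `n` alone already gives the estimate, so `c = 1` is arbitrary and the exponential
  -- terms are slack.
  refine ⟨16 + 28 * smallConst + Real.exp (N / 8), 1, by positivity, one_pos,
    fun μ _ _ n ε p hn hε hp => ?_⟩
  have h1 := tvDist_pneLaw_tail hN μ hn hε hp
  have h2 : (0 : ℝ) ≤ 2 ^ (-(n : ℝ)) := by positivity
  refine (by linarith : _ ≤ _).trans (h1.trans (measureReal_mono fun G hG => ?_))
  exact le_trans hG (le_add_of_nonneg_right (Real.exp_pos _).le)
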